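/- Let $0<\alpha\le 1$. For a function $u$ on $[0,\pi]$ put $D^\alpha u(x)=\lim_{h\to0}\frac{u(x+hx^{1-\alpha})-u(x)}{h}$ for $0<x\le\pi$ (a one-sided limit at $x=\pi$), $D^\alpha u(0)=\lim_{x\to0^+}D^\alpha u(x)$, and $\int_0^x u\,d_\alpha t=\int_0^x t^{\alpha-1}u(t)\,dt$; the $\alpha$-mean of $u$ is $\langle u\rangle=\frac{\alpha}{\pi^\alpha}\int_0^\pi u\,d_\alpha t$. Let $W$ be the space of absolutely continuous real functions $u$ on $[0,\pi]$ with $\int_0^\pi|D^\alpha u|^2\,d_\alpha t<\infty$. Let $p,\,D^\alpha p,\,q\in W$, let $p$ be non-constant with $\int_0^\pi p\,d_\alpha t=0$ (call such a pair $(p,q)$ admissible), and consider the problem $$-D^\alpha D^\alpha y+[2\lambda p(x)+q(x)]y=\lambda^2y\quad(0<x<\pi),\qquad y(0)=y(\pi)=0,\quad\lambda\in\mathbb C .$$ An eigenvalue $\lambda$ has index $n\in\mathbb Z$ if $n\alpha\pi^{1-\alpha}$ is the point of $\alpha\pi^{1-\alpha}\mathbb Z$ nearest to $\operatorname{Re}\lambda$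 (ties rounded up). If an eigenfunction belongs to an eigenvalue of index $n$, then its zeros in $(0,\pi)$, in increasing order, are the nodal points $x_n^1<x_n^2<\cdots$ if $n>0$ and $x_n^{-1}<x_n^{-2}<\cdots$ if $n<0$ (if $n=0$, they all carry the second index $0$). Let $X$ be the set of all nodal points $x_n^j$, each given together with its indices $n,j$, and let $X_0\subset X$ be a subset whose points are dense in $[0,\pi]$. Then: (a) $X_0$ determines $p$ and $q$: if $X_0$ is also contained in the set of (indexed) nodal points of the problem with the same $\alpha$ and another admissible pair $(\tilde p,\tilde q)$, then $\tilde p=p$ and $\tilde q=q$ a.e. on $[0,\pi]$. (b) $p$ and $q$ are found by the following algorithm. Step 1. For each $x\in[0,\pi]$ there is a sequence of points $x_n^{j_n}$ of $X_0$ (along some sequence of indices $n$ with $|n|\to\infty$) that converges to $x$. Each limit below exists along every such sequence and depends on $x$ only. Step 2. Let $Q(x)=\int_0^x p\,d_\alpha t$. Then $Q(x)=\pi^{1-\alpha}\lim\left(n(x_n^{j_n})^\alpha-j_n\pi^\alpha\right)$ and $p=D^\alpha Q$ on $[0,\pi]$. Step 3. Let $f(x)=2\pi^{1-\alpha}\alpha\lim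 n\left[\pi^{1-\alpha}\left(n(x_n^{j_n})^\alpha-j_n\pi^\alpha\right)-Q(x_n^{j_n})\right]$. Then $f$ has a conformable derivative on $[0,\pi]$ and $q-\langle q\rangle=r:=D^\alpha f-p^2+\langle p^2\rangle$. Step 4. Put $A_n(x)=\int_0^x(q+p^2)\cos\left(\frac{2nt^\alpha}{\pi^{\alpha-1}}-2Q(t)\right)d_\alpha t-\int_0^xD^\alpha p(t)\,\sin\left(\frac{2nt^\alpha}{\pi^{\alpha-1}}-2Q(t)\right)d_\alpha t$ and $$g(x)=\pi^{1-\alpha}\alpha\lim n\Big\{2\pi^{1-\alpha}\alpha\,n\left[\pi^{1-\alpha}\left(n(x_n^{j_n})^\alpha-j_n\pi^\alpha\right)-Q(x_n^{j_n})\right]-f(x_n^{j_n})+A_n(x_n^{j_n})-A_n(\pi)\tfrac{(x_n^{j_n})^\alpha}{\pi^\alpha}\Big\}.$$ There are $x\in[0,\pi]$ with $Q(x)\ne0$, and for each of them $$\langle q\rangle=\frac1{Q(x)}\Big[g(x)-\int_0^x(r+p^2)p\,d_\alpha t+\frac{x^\alpha}{\pi^\alpha}\int_0^\pi(r+p^2)p\,d_\alpha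 t\Big].$$ Step 5. $q=r+\langle q\rangle$ on $[0,\pi]$. -/

import Mathlib

open MeasureTheory Filter Topology Set

noncomputable section

/-- `f` has conformable derivative `d` of order `α` at `x`, relative to `[0, π]`
(meant for `0 < x ≤ π`; at interior points the limit is two-sided):
`(f (x + h x ^ (1 - α)) - f x) / h → d` as `h → 0`. -/
def HasConfDerivAt {E : Type*} [NormedAddCommGroup E] [NormedSpace ℝ E]
    (α : ℝ) (f : ℝ → E) (d : E) (x : ℝ) : Prop :=
  Tendsto (fun h : ℝ => h⁻¹ • (f (x + h * x ^ (1 - α)) - f x))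
    (𝓝[{h : ℝ | h ≠ 0 ∧ x + h * x ^ (1 - α) ∈ Icc 0 Real.pi}] 0) (𝓝 d)

/-- `g` is the conformable derivative of `f` on `[0, π]`; its value at `0` is the limit of its
values from the right. -/
def IsConfDeriv {E : Type*} [NormedAddCommGroup E] [NormedSpace ℝ E]
    (α : ℝ) (f g : ℝ → E) : Prop :=
  (∀ x ∈ Ioc 0 Real.pi, HasConfDerivAt α f (g x) x) ∧ Tendsto g (𝓝[>] 0) (𝓝 (g 0))

/-- The conformable integral `∫₀ˣ f(t) d_α t = ∫₀ˣ t ^ (α - 1) f(t) dt`. -/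
def confInt (α : ℝ) (f : ℝ → ℝ) (x : ℝ) : ℝ :=
  ∫ t in (0 : ℝ)..x, t ^ (α - 1) * f t

/-- The `α`-mean of `f` on `[0, π]`; note that `∫₀^π d_α t = π ^ α / α`. -/
def confMean (α : ℝ) (f : ℝ → ℝ) : ℝ :=
  α / Real.pi ^ α * confInt α f Real.pi

/-- The measure `d_α x = x ^ (α - 1) dx` on `(0, π]`. -/
def confMeasure (α : ℝ) : Measure ℝ :=
  (volume.restrict (Ioc 0 Real.pi)).withDensity (fun x => ENNReal.ofReal (x ^ (α - 1)))

/-- The Sobolev space `W_α²(0, π)`: `f` is absolutely continuous on `[0, π]` and its conformable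
derivative (which exists almost everywhere) lies in `L_α²(0, π)`. -/
def MemConfSobolev (α : ℝ) (f : ℝ → ℝ) : Prop :=
  AbsolutelyContinuousOnInterval f 0 Real.pi ∧
    ∃ g : ℝ → ℝ, (∀ᵐ x ∂(volume.restrict (Ioo 0 Real.pi)), HasConfDerivAt α f (g x) x) ∧
      MemLp g 2 (confMeasure α)

/-- Admissible coefficients: `p`, `dp = D^α p` and `q` are real functions in `W_α²(0, π)`,
`p` is not constant on `[0, π]`, and `∫₀^π p d_α x = 0`. -/
structure IsAdmissible (α : ℝ) (p dp q : ℝ → ℝ) : Prop where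
  confDeriv_p : IsConfDeriv α p dp
  sobolev_p : MemConfSobolev α p
  sobolev_dp : MemConfSobolev α dp
  sobolev_q : MemConfSobolev α q
  not_const : ¬ ∃ c : ℝ, ∀ x ∈ Icc 0 Real.pi, p x = c
  int_eq_zero : confInt α p Real.pi = 0

/-- `y` is an eigenfunction with eigenvalue `μ` of the Dirichlet problem
`-D^α D^α y + (2 μ p + q) y = μ² y` on `(0, π)`, `y(0) = y(π) = 0`. -/
def IsEigenfunction (α : ℝ) (p q : ℝ → ℝ) (μ : ℂ) (y : ℝ → ℂ) : Prop :=
  ContinuousOn y (Icc 0 Real.pi) ∧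
  (∃ z : ℝ → ℂ, IsConfDeriv α y z ∧
    ∀ x ∈ Ioo 0 Real.pi, ∃ w : ℂ, HasConfDerivAt α z w x ∧
      -w + (2 * μ * (p x : ℂ) + (q x : ℂ)) * y x = μ ^ 2 * y x) ∧
  y 0 = 0 ∧ y Real.pi = 0 ∧ ∃ x ∈ Icc 0 Real.pi, y x ≠ 0

/-- The index of an eigenvalue `μ`: the integer `n` for which `n α π ^ (1 - α)`, the leading term
of the `n`-th eigenvalue, is nearest to the real part of `μ`. -/
def eigenIndex (α : ℝ) (μ : ℂ) : ℤ :=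
  round (μ.re / (α * Real.pi ^ (1 - α)))

/-- The set `X` of all nodal points, each listed with its indices: `(n, j, x) ∈ X` says that
`x = x_n^j` is a zero in `(0, π)` of an eigenfunction `y` whose eigenvalue has index `n`, and that
`x` is the `|j|`-th zero of `y` in `(0, π)`, where `j` has the sign of `n`. -/
def nodalPoints (α : ℝ) (p q : ℝ → ℝ) : Set (ℤ × ℤ × ℝ) :=
  {s | ∃ (μ : ℂ) (y : ℝ → ℂ), IsEigenfunction α p q μ y ∧ s.1 = eigenIndex α μ ∧
    s.2.2 ∈ Ioo 0 Real.pi ∧ y s.2.2 = 0 ∧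
    s.2.1 = s.1.sign * (({t : ℝ | t ∈ Ioc 0 s.2.2 ∧ y t = 0}.ncard : ℕ) : ℤ)}

/-- The points `x_n^j` of `X₀` are dense in `[0, π]`. -/
def NodallyDense (X₀ : Set (ℤ × ℤ × ℝ)) : Prop :=
  Icc 0 Real.pi ⊆ closure ((fun s : ℤ × ℤ × ℝ => s.2.2) '' X₀)

/-- `s` is a sequence of points `x_n^{j_n}` of `X₀` along which `|n| → ∞` and `x_n^{j_n} → x`. -/
structure IsNodalSeq (X₀ : Set (ℤ × ℤ × ℝ)) (s : ℕ → ℤ × ℤ × ℝ) (x : ℝ) : Prop where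
  mem : ∀ k, s k ∈ X₀
  index : Tendsto (fun k => |(s k).1|) atTop atTop
  lim : Tendsto (fun k => (s k).2.2) atTop (𝓝 x)

/-- The nodal quantity `π ^ (1 - α) (n (x_n^j) ^ α - j π ^ α)`. -/
def nodalShift (α : ℝ) (s : ℤ × ℤ × ℝ) : ℝ :=
  Real.pi ^ (1 - α) * ((s.1 : ℝ) * s.2.2 ^ α - (s.2.1 : ℝ) * Real.pi ^ α)

/-- The quantity `2 π ^ (1 - α) α n [π ^ (1 - α) (n (x_n^j) ^ α - j π ^ α) - Q(x_n^j)]`. -/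
def nodalShift₁ (α : ℝ) (Q : ℝ → ℝ) (s : ℤ × ℤ × ℝ) : ℝ :=
  2 * Real.pi ^ (1 - α) * α * (s.1 : ℝ) * (nodalShift α s - Q s.2.2)

/-- The oscillatory integral
`∫₀ˣ (q + p²) cos (2 n t ^ α / π ^ (α - 1) - 2 Q) d_α t - ∫₀ˣ D^α p sin (2 n t ^ α / π ^ (α - 1) - 2 Q) d_α t`;
`A_n^j` is its value at `x = x_n^j`, and `A_n^n` its value at `x = π`. -/
def oscInt (α : ℝ) (p dp q Q : ℝ → ℝ) (n : ℤ) (x : ℝ) : ℝ :=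
  confInt α (fun t => (q t + p t ^ 2) *
      Real.cos (2 * (n : ℝ) * t ^ α / Real.pi ^ (α - 1) - 2 * Q t)) x -
    confInt α (fun t => dp t *
      Real.sin (2 * (n : ℝ) * t ^ α / Real.pi ^ (α - 1) - 2 * Q t)) x

/-- The quantity `π ^ (1 - α) α n {2 π ^ (1 - α) α n [π ^ (1 - α) (n (x_n^j) ^ α - j π ^ α) - Q(x_n^j)]
- f(x_n^j) + A_n^j - A_n^n (x_n^j) ^ α / π ^ α}`. -/
def nodalShift₂ (α : ℝ) (p dp q Q f : ℝ → ℝ) (s : ℤ × ℤ × ℝ) : ℝ :=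
  Real.pi ^ (1 - α) * α * (s.1 : ℝ) *
    (nodalShift₁ α Q s - f s.2.2 + oscInt α p dp q Q s.1 s.2.2 -
      oscInt α p dp q Q s.1 Real.pi * (s.2.2 ^ α / Real.pi ^ α))

end

/-! The substitution `s = x ^ α / α` turns `D^α` into `d/ds`, `d_α x` into `ds` and `[0, π]` into
`[0, L]` with `L = π ^ α / α`. With `V = q + p²` the equation becomes `y'' = (V - (λ - p)²) y`. An
eigenvalue with large real part is real, because the imaginary part of a Green identity has a fixed
sign (`IsDirichletSol.im_eq_zero_of_lt_abs_re`). For real `λ` the modified Prüfer angle `u = r sin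
θ`, `u' = (λ - p) r cos θ` satisfies `θ' = λ - p - (V sin² θ + p' sin θ cos θ) / (λ - p)`. For large
`|λ|` it is strictly monotone, so that `θ = j π` at the node of second index `j` and `θ(L) = n π`
(`IsDirichletSol.exists_phase`).

Put `a = n π / L` and `Q = ∫ p`. The condition at `L` eliminates the eigenvalue: `a s - θ(s) - Q(s)
= R(s) - (s / L) R(L)`, where `R = ∫ (V - V cos 2θ + p' sin 2θ) / (2 (λ - p))`. At a node the left
side is `a s - j π - Q(s)`, which is the nodal data. Three orders in `1 / a` are needed. The right
side tends to `0`, which gives `Q`. Multiplied by `2 a` it tends to `∫ V` minus its linear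
interpolant, by the Riemann–Lebesgue lemma, which gives `f`. For the third order `θ` is replaced by
`a s - Q` in the trigonometric factors. The resulting integrals are the `A_n` that the algorithm
removes, and `a` times what is left is `V p` plus oscillating terms plus a bounded error that tends
to `0` pointwise (`tendsto_mul_phaseErr`). The limit is `∫ V p` minus its linear interpolant. As `∫
p = 0` over the whole interval, adding a constant `c` to `q` changes it by `c Q(x)`, and this
reveals the mean of `q`.

For uniqueness, the first two limits determine `p` and `q` up to a constant `c`. The quantity `A_n`
itself depends on `c`, through `c ∫ cos 2(a t - Q)`, but `a` times this integral tends to `0` along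
nodes (`tendsto_mul_integral_cos_zero`). So `c Q = 0`, and `Q` is not identically zero because `p`
is not constant.

Density of `X₀` alone does not make `|n|` large. That follows from the finiteness of the set of
nodes of bounded index: eigenvalues are the zeros of analytic functions that do not vanish
identically, hence finite in number in each disc, and each eigenfunction has finitely many zeros. -/

noncomputable section

/-! ### Change of variable from the conformable to the ordinary calculus. -/

/-- The change of variable `s = x ^ α / α`, which turns `D^α` into `d/ds`. -/
def confVar (α x : ℝ) : ℝ := x ^ α / α

/-- The inverse of `confVar`, extended to a continuous map of `ℝ` onto `[0, π]`. -/
def confInv (α s : ℝ) : ℝ := min Real.pi ((α * max s 0) ^ (1 / α))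

theorem confVar_zero {α : ℝ} (hα : 0 < α) : confVar α 0 = 0 := by
  simp [confVar, Real.zero_rpow hα.ne']

theorem confVar_pi_pos {α : ℝ} (hα : 0 < α) : 0 < confVar α Real.pi := by
  unfold confVar; have := Real.pi_pos; positivity

theorem confVar_strictMonoOn {α : ℝ} (hα : 0 < α) : StrictMonoOn (confVar α) (Ici 0) := by
  intro x hx y hy hxy
  unfold confVar
  have := Real.rpow_lt_rpow hx hxy hα
  gcongr

theorem confVar_mem_Icc {α x : ℝ} (hα : 0 < α) (hx : x ∈ Icc 0 Real.pi) :
    confVar α x ∈ Icc 0 (confVar α Real.pi) := by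
  have h := (confVar_strictMonoOn hα).monotoneOn
  refine ⟨?_, h hx.1 Real.pi_pos.le hx.2⟩
  rw [← confVar_zero hα]
  exact h (mem_Ici.2 le_rfl) hx.1 hx.1

theorem continuous_confVar {α : ℝ} (hα : 0 < α) : Continuous (confVar α) := by
  unfold confVar
  exact (Real.continuous_rpow_const hα.le).div_const _

theorem continuous_confInv {α : ℝ} (hα : 0 < α) : Continuous (confInv α) := by
  unfold confInv
  have : Continuous fun x : ℝ => x ^ (1 / α) := Real.continuous_rpow_const (by positivity)
  exact continuous_const.min (this.comp (by fun_prop))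

theorem confInv_mem_Icc {α : ℝ} (s : ℝ) (hα : 0 < α) : confInv α s ∈ Icc 0 Real.pi := by
  unfold confInv
  refine ⟨le_min Real.pi_pos.le ?_, min_le_left _ _⟩
  have : 0 ≤ max s 0 := le_max_right _ _
  positivity

theorem confInv_confVar {α x : ℝ} (hα : 0 < α) (hx : x ∈ Icc 0 Real.pi) :
    confInv α (confVar α x) = x := by
  unfold confInv
  rw [max_eq_left (confVar_mem_Icc hα hx).1, confVar, mul_div_cancel₀ _ hα.ne', one_div,
    Real.rpow_rpow_inv hx.1 hα.ne', min_eq_right hx.2]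

theorem confVar_confInv {α s : ℝ} (hα : 0 < α) (hs : s ∈ Icc 0 (confVar α Real.pi)) :
    confVar α (confInv α s) = s := by
  have h0 : 0 ≤ α * s := mul_nonneg hα.le hs.1
  have h : confInv α s = (α * s) ^ (1 / α) := by
    unfold confInv
    rw [max_eq_left hs.1, min_eq_right]
    have h1 : α * s ≤ Real.pi ^ α := by
      have := hs.2
      rw [confVar, le_div_iff₀ hα] at this
      linarith
    calc (α * s) ^ (1 / α) ≤ (Real.pi ^ α) ^ (1 / α) := Real.rpow_le_rpow h0 h1 (by positivity)
      _ = Real.pi := by rw [one_div, Real.rpow_rpow_inv Real.pi_pos.le hα.ne']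
  rw [h, confVar, one_div, Real.rpow_inv_rpow h0 hα.ne', mul_div_cancel_left₀ _ hα.ne']

theorem confInv_mem_Ioo {α s : ℝ} (hα : 0 < α) (hs : s ∈ Ioo 0 (confVar α Real.pi)) :
    confInv α s ∈ Ioo 0 Real.pi := by
  have h := confInv_mem_Icc s hα
  have h1 := confVar_confInv hα (Ioo_subset_Icc_self hs)
  refine ⟨lt_of_le_of_ne h.1 fun h0 => ?_, lt_of_le_of_ne h.2 fun h0 => ?_⟩
  · rw [← h0, confVar_zero hα] at h1; exact hs.1.ne h1
  · rw [h0] at h1; exact hs.2.ne h1.symm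

theorem hasDerivAt_confVar {α x : ℝ} (hα : 0 < α) (hx : 0 < x) :
    HasDerivAt (confVar α) (x ^ (α - 1)) x := by
  have := (Real.hasDerivAt_rpow_const (p := α) (Or.inl hx.ne')).div_const α
  rwa [mul_div_cancel_left₀ _ hα.ne'] at this

theorem hasDerivAt_confInv {α s : ℝ} (hα : 0 < α) (hs : s ∈ Ioo 0 (confVar α Real.pi)) :
    HasDerivAt (confInv α) (confInv α s ^ (1 - α)) s := by
  have hx := confInv_mem_Ioo hα hs
  have h := HasDerivAt.of_local_left_inverse (f := confVar α) (g := confInv α) (a := s)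
    (f' := confInv α s ^ (α - 1)) (continuous_confInv hα).continuousAt
    (hasDerivAt_confVar hα hx.1) (Real.rpow_pos_of_pos hx.1 _).ne'
    (by
      filter_upwards [Ioo_mem_nhds hs.1 hs.2] with t ht
      exact confVar_confInv hα (Ioo_subset_Icc_self ht))
  rwa [← Real.rpow_neg hx.1.le, neg_sub] at h

section
variable {E : Type*} [NormedAddCommGroup E] [NormedSpace ℝ E]

/-- For fixed `x > 0` the factor `x ^ (1 - α)` is a positive constant, so `y = x + h x ^ (1 - α)`
turns the conformable quotient into a rescaled slope. The one-sided limit at `π` becomes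
differentiability within `[0, π]`. -/
theorem hasConfDerivAt_iff {α x : ℝ} {f : ℝ → E} {d : E} (hx : x ∈ Ioc 0 Real.pi) :
    HasConfDerivAt α f d x ↔ HasDerivWithinAt f (x ^ (α - 1) • d) (Icc 0 Real.pi) x := by
  have hc : 0 < x ^ (1 - α) := Real.rpow_pos_of_pos hx.1 _
  have hc' : x ^ (α - 1) = (x ^ (1 - α))⁻¹ := by rw [← Real.rpow_neg hx.1.le, neg_sub]
  rw [hasDerivWithinAt_iff_tendsto_slope, hc']
  unfold HasConfDerivAt
  set c := x ^ (1 - α)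
  constructor
  · intro h
    have hm : Tendsto (fun y : ℝ => (y - x) / c) (𝓝[Icc 0 Real.pi \ {x}] x)
        (𝓝[{h : ℝ | h ≠ 0 ∧ x + h * c ∈ Icc 0 Real.pi}] 0) := by
      refine tendsto_nhdsWithin_iff.2 ⟨?_, ?_⟩
      · have : ContinuousAt (fun y : ℝ => (y - x) / c) x := by fun_prop
        have := this.tendsto
        simp only [sub_self, zero_div] at this
        exact this.mono_left nhdsWithin_le_nhds
      · filter_upwards [self_mem_nhdsWithin] with y hy
        refine ⟨div_ne_zero (sub_ne_zero.2 hy.2) hc.ne', ?_⟩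
        rw [div_mul_cancel₀ _ hc.ne', add_sub_cancel]
        exact hy.1
    refine ((h.comp hm).const_smul c⁻¹).congr fun y => ?_
    simp only [Function.comp, slope, vsub_eq_sub]
    rw [div_mul_cancel₀ _ hc.ne', add_sub_cancel, smul_smul, inv_div, inv_mul_eq_div,
      div_div_cancel_left' hc.ne']
  · intro h
    have hm : Tendsto (fun h : ℝ => x + h * c)
        (𝓝[{h : ℝ | h ≠ 0 ∧ x + h * c ∈ Icc 0 Real.pi}] 0) (𝓝[Icc 0 Real.pi \ {x}] x) := by
      refine tendsto_nhdsWithin_iff.2 ⟨?_, ?_⟩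
      · have : ContinuousAt (fun h : ℝ => x + h * c) 0 := by fun_prop
        have := this.tendsto
        simp only [zero_mul, add_zero] at this
        exact this.mono_left nhdsWithin_le_nhds
      · filter_upwards [self_mem_nhdsWithin] with y hy
        refine ⟨hy.2, ?_⟩
        have := mul_ne_zero hy.1 hc.ne'
        simpa using this
    have := (h.comp hm).const_smul c
    rw [smul_smul, mul_inv_cancel₀ hc.ne', one_smul] at this
    refine this.congr fun y => ?_
    simp only [Function.comp, slope, vsub_eq_sub, add_sub_cancel_left]
    rw [smul_smul, mul_inv, mul_comm y⁻¹, mul_inv_cancel_left₀ hc.ne']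

theorem HasConfDerivAt.comp_confInv {α s : ℝ} (hα : 0 < α) {f : ℝ → E} {d : E}
    (hs : s ∈ Ioo 0 (confVar α Real.pi)) (h : HasConfDerivAt α f d (confInv α s)) :
    HasDerivAt (fun t => f (confInv α t)) d s := by
  have hx := confInv_mem_Ioo hα hs
  have h1 := ((hasConfDerivAt_iff (Ioo_subset_Ioc_self hx)).1 h).hasDerivAt (Icc_mem_nhds hx.1 hx.2)
  have h2 := h1.scomp s (hasDerivAt_confInv hα hs)
  rwa [smul_smul, ← Real.rpow_add hx.1, sub_add_sub_cancel', sub_self, Real.rpow_zero,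
    one_smul] at h2

theorem HasDerivAt.hasConfDerivAt_of_eqOn {α x : ℝ} (hα : 0 < α) {f F : ℝ → E} {d : E}
    (hx : x ∈ Ioc 0 Real.pi) (hF : HasDerivAt F d (confVar α x))
    (h : ∀ t ∈ Icc 0 Real.pi, f t = F (confVar α t)) : HasConfDerivAt α f d x := by
  rw [hasConfDerivAt_iff hx]
  exact ((hF.scomp x (hasDerivAt_confVar hα hx.1)).hasDerivWithinAt).congr h
    (h x (Ioc_subset_Icc_self hx))

end

theorem continuous_comp_confInv {E : Type*} [TopologicalSpace E] {α : ℝ} (hα : 0 < α)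
    {f : ℝ → E}
    (hf : ContinuousOn f (Icc 0 Real.pi)) : Continuous fun s => f (confInv α s) :=
  hf.comp_continuous (continuous_confInv hα) fun s => confInv_mem_Icc s hα

/-- The fundamental theorem of calculus is applied to the right side as a function of `x`. This
primitive need only be continuous at `0`, and the weight `t ^ (α - 1)` is integrable there because
`α > 0`. -/
theorem confInt_eq {α x : ℝ} (hα : 0 < α) {f : ℝ → ℝ} (hf : ContinuousOn f (Icc 0 Real.pi))
    (hx : x ∈ Icc 0 Real.pi) :
    confInt α f x = ∫ s in (0 : ℝ)..confVar α x, f (confInv α s) := by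
  have hc := continuous_comp_confInv hα hf
  have hF : ∀ s : ℝ, HasDerivAt (fun u => ∫ s in (0 : ℝ)..u, f (confInv α s))
      (f (confInv α s)) s := fun s =>
    intervalIntegral.integral_hasDerivAt_right (hc.intervalIntegrable _ _)
      (hc.stronglyMeasurableAtFilter _ _) hc.continuousAt
  have hsub : Icc 0 x ⊆ Icc 0 Real.pi := Icc_subset_Icc_right hx.2
  have key := intervalIntegral.integral_eq_sub_of_hasDerivAt_of_le (a := 0) (b := x)
    (f := fun u => ∫ s in (0 : ℝ)..confVar α u, f (confInv α s))
    (f' := fun t => t ^ (α - 1) * f t) hx.1 ?_ ?_ ?_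
  · simp only [confVar_zero hα, intervalIntegral.integral_same, sub_zero] at key
    exact key
  · have : Continuous fun u => ∫ s in (0 : ℝ)..u, f (confInv α s) :=
      continuous_iff_continuousAt.2 fun s => (hF s).continuousAt
    exact (this.comp (continuous_confVar hα)).continuousOn
  · intro t ht
    have := (hF (confVar α t)).scomp t (hasDerivAt_confVar hα ht.1)
    rwa [confInv_confVar hα (hsub (Ioo_subset_Icc_self ht)), smul_eq_mul] at this
  · refine (intervalIntegral.intervalIntegrable_rpow' (by linarith)).mul_continuousOn ?_
    rw [uIcc_of_le hx.1]
    exact hf.mono hsub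

theorem hasDerivAt_integral_of_continuous {E : Type*} [NormedAddCommGroup E] [NormedSpace ℝ E]
    [CompleteSpace E] {f : ℝ → E} (hf : Continuous f) (a s : ℝ) :
    HasDerivAt (fun u => ∫ t in a..u, f t) (f s) s :=
  intervalIntegral.integral_hasDerivAt_right (hf.intervalIntegrable _ _)
    (hf.stronglyMeasurableAtFilter _ _) hf.continuousAt

theorem eq_zero_of_hasDerivAt_zero {E : Type*} [NormedAddCommGroup E] [NormedSpace ℝ E]
    [CompleteSpace E] {a b : ℝ} {f : ℝ → E} (hf : ContinuousOn f (Icc a b))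
    (hd : ∀ x ∈ Ioo a b, HasDerivAt f 0 x) (ha : f a = 0) : ∀ x ∈ Icc a b, f x = 0 := by
  intro x hx
  have := intervalIntegral.integral_eq_sub_of_hasDerivAt_of_le hx.1
    (hf.mono (Icc_subset_Icc_right hx.2)) (f' := fun _ => 0)
    (fun t ht => hd t ⟨ht.1, ht.2.trans_le hx.2⟩) (by simp)
  simpa [ha] using this.symm

/-! ### The Dirichlet problem in the variable `s`; uniqueness for the Cauchy problem. -/

/-- `y`, with derivative `z`, is a nontrivial solution of `y'' = (2 μ p + q - μ²) y` on `[0, L]`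
with `y(0) = y(L) = 0`. -/
structure IsDirichletSol (L : ℝ) (p q : ℝ → ℝ) (μ : ℂ) (y z : ℝ → ℂ) : Prop where
  deriv_y : ∀ s, HasDerivAt y (z s) s
  cont_z : Continuous z
  deriv_z : ∀ s ∈ Icc 0 L, HasDerivAt z ((2 * μ * p s + q s - μ ^ 2) * y s) s
  zero_left : y 0 = 0
  zero_right : y L = 0
  deriv_ne_zero : z 0 ≠ 0

section energy

variable {L C : ℝ} {K y z : ℝ → ℂ}

/-- The two-sided bound serves two Grönwall arguments: the energy times `exp ((1 + C) s)` is
nondecreasing, so it stays positive, and the energy times `exp (-(1 + C) s)` is nonincreasing, so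
zero Cauchy data give the zero solution. -/
theorem hasDerivAt_energy {s : ℝ} (hy : HasDerivAt y (z s) s) (hz : HasDerivAt z (K s * y s) s)
    (hK : ‖K s‖ ≤ C) : ∃ d, HasDerivAt (fun s => ‖y s‖ ^ 2 + ‖z s‖ ^ 2) d s ∧
      |d| ≤ (1 + C) * (‖y s‖ ^ 2 + ‖z s‖ ^ 2) := by
  refine ⟨_, hy.norm_sq.add hz.norm_sq, ?_⟩
  have h1 : |inner ℝ (y s) (z s)| ≤ ‖y s‖ * ‖z s‖ := abs_real_inner_le_norm _ _
  have h2 : |inner ℝ (z s) (K s * y s)| ≤ ‖z s‖ * (C * ‖y s‖) := by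
    refine (abs_real_inner_le_norm _ _).trans ?_
    rw [norm_mul]
    gcongr
  have hC : 0 ≤ C := (norm_nonneg _).trans hK
  have h3 := sq_nonneg (‖y s‖ - ‖z s‖)
  refine (abs_add_le _ _).trans ?_
  rw [abs_mul, abs_mul, abs_two]
  nlinarith [mul_nonneg hC h3]

variable (hy : ∀ s ∈ Icc 0 L, HasDerivAt y (z s) s)
  (hz : ∀ s ∈ Icc 0 L, HasDerivAt z (K s * y s) s) (hK : ∀ s, ‖K s‖ ≤ C)
include hy hz hK

theorem energy_pos (h0 : z 0 ≠ 0) {s : ℝ} (hs : s ∈ Icc 0 L) : 0 < ‖y s‖ ^ 2 + ‖z s‖ ^ 2 := by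
  choose! d hd hdb using fun s hs => hasDerivAt_energy (hy s hs) (hz s hs) (hK s)
  have hE : ∀ s ∈ Icc 0 L, HasDerivAt
      (fun s => (‖y s‖ ^ 2 + ‖z s‖ ^ 2) * Real.exp ((1 + C) * s))
      (d s * Real.exp ((1 + C) * s) +
        (‖y s‖ ^ 2 + ‖z s‖ ^ 2) * (Real.exp ((1 + C) * s) * ((1 + C) * 1))) s := fun s hs =>
    (hd s hs).mul ((hasDerivAt_id s).const_mul (1 + C)).exp
  have hm := monotoneOn_of_deriv_nonneg (convex_Icc 0 L)
    (fun s hs => (hE s hs).continuousAt.continuousWithinAt)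
    (fun s hs => (hE s (interior_subset hs)).differentiableAt.differentiableWithinAt)
    (fun s hs => by
      rw [(hE s (interior_subset hs)).deriv]
      have := abs_le.1 (hdb s (interior_subset hs))
      have he := Real.exp_pos ((1 + C) * s)
      nlinarith)
  have h := hm ⟨le_rfl, hs.1.trans hs.2⟩ hs hs.1
  have h1 : 0 < ‖y 0‖ ^ 2 + ‖z 0‖ ^ 2 := by
    have := norm_pos_iff.2 h0
    positivity
  simp only [mul_zero, Real.exp_zero, mul_one] at h
  exact pos_of_mul_pos_left (h1.trans_le h) (Real.exp_pos _).le

theorem eq_zero_of_initial_zero (hy0 : y 0 = 0) (h0 : z 0 = 0) {s : ℝ} (hs : s ∈ Icc 0 L) :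
    y s = 0 := by
  choose! d hd hdb using fun s hs => hasDerivAt_energy (hy s hs) (hz s hs) (hK s)
  have hE : ∀ s ∈ Icc 0 L, HasDerivAt
      (fun s => (‖y s‖ ^ 2 + ‖z s‖ ^ 2) * Real.exp (-(1 + C) * s))
      (d s * Real.exp (-(1 + C) * s) +
        (‖y s‖ ^ 2 + ‖z s‖ ^ 2) * (Real.exp (-(1 + C) * s) * (-(1 + C) * 1))) s := fun s hs =>
    (hd s hs).mul ((hasDerivAt_id s).const_mul (-(1 + C))).exp
  have hm := antitoneOn_of_deriv_nonpos (convex_Icc 0 L)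
    (fun s hs => (hE s hs).continuousAt.continuousWithinAt)
    (fun s hs => (hE s (interior_subset hs)).differentiableAt.differentiableWithinAt)
    (fun s hs => by
      rw [(hE s (interior_subset hs)).deriv]
      have := abs_le.1 (hdb s (interior_subset hs))
      have he := Real.exp_pos (-(1 + C) * s)
      nlinarith)
  have h := hm ⟨le_rfl, hs.1.trans hs.2⟩ hs hs.1
  simp only [hy0, h0, norm_zero, ne_eq, OfNat.ofNat_ne_zero, not_false_eq_true, zero_pow,
    add_zero, zero_mul] at h
  have h1 := nonpos_of_mul_nonpos_left h (Real.exp_pos _)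
  have h2 : ‖y s‖ ^ 2 = 0 := le_antisymm (by nlinarith [sq_nonneg ‖z s‖]) (by positivity)
  simpa using h2

end energy

theorem norm_potential_le {M : ℝ} {p q : ℝ → ℝ} (hp : ∀ s, |p s| ≤ M) (hq : ∀ s, |q s| ≤ M)
    (μ : ℂ) (s : ℝ) :
    ‖2 * μ * p s + q s - μ ^ 2‖ ≤ 2 * ‖μ‖ * M + M + ‖μ‖ ^ 2 := by
  refine (norm_sub_le _ _).trans ?_
  rw [norm_pow]
  gcongr
  refine (norm_add_le _ _).trans ?_
  simp only [norm_mul, Complex.norm_real, Complex.norm_ofNat, Real.norm_eq_abs]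
  gcongr
  exacts [hp s, hq s]

theorem IsDirichletSol.energy_pos {L M : ℝ} {p q : ℝ → ℝ} {μ : ℂ} {y z : ℝ → ℂ}
    (h : IsDirichletSol L p q μ y z) (hp : ∀ s, |p s| ≤ M) (hq : ∀ s, |q s| ≤ M) {s : ℝ}
    (hs : s ∈ Icc 0 L) : 0 < ‖y s‖ ^ 2 + ‖z s‖ ^ 2 :=
  _root_.energy_pos (fun s _ => h.deriv_y s) h.deriv_z (norm_potential_le hp hq μ)
    h.deriv_ne_zero hs

/-! ### Criteria for an eigenvalue to be real. -/

theorem deriv_eq_zero_of_nonneg {L : ℝ} {H h : ℝ → ℝ} (hc : ContinuousOn H (Icc 0 L))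
    (hd : ∀ s ∈ Ioo 0 L, HasDerivAt H (h s) s) (hn : ∀ s ∈ Ioo 0 L, 0 ≤ h s)
    (h0 : H 0 = 0) (hL : H L = 0) : ∀ s ∈ Ioo 0 L, h s = 0 := by
  have hm := monotoneOn_of_deriv_nonneg (convex_Icc 0 L) hc
    (fun s hs => (hd s (by rwa [interior_Icc] at hs)).differentiableAt.differentiableWithinAt)
    (fun s hs => by rw [interior_Icc] at hs; rw [(hd s hs).deriv]; exact hn s hs)
  intro s hs
  have hz : H =ᶠ[𝓝 s] fun _ => 0 := by
    filter_upwards [Ioo_mem_nhds hs.1 hs.2] with t ht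
    have h1 := hm ⟨le_rfl, hs.1.le.trans hs.2.le⟩ (Ioo_subset_Icc_self ht) ht.1.le
    have h2 := hm (Ioo_subset_Icc_self ht) ⟨hs.1.le.trans hs.2.le, le_rfl⟩ ht.2.le
    linarith
  exact (hd s hs).unique ((hasDerivAt_const s (0 : ℝ)).congr_of_eventuallyEq hz)

section nonreal

variable {L M : ℝ} {p q : ℝ → ℝ} {μ : ℂ} {y z : ℝ → ℂ}

theorem IsDirichletSol.exists_ne_zero (h : IsDirichletSol L p q μ y z) (hL : 0 < L) :
    ∃ s ∈ Ioo 0 L, y s ≠ 0 := by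
  by_contra! hc
  have hz : ∀ s ∈ Ioo 0 L, z s = 0 := fun s hs =>
    (h.deriv_y s).unique ((hasDerivAt_const s (0 : ℂ)).congr_of_eventuallyEq (by
      filter_upwards [Ioo_mem_nhds hs.1 hs.2] with t ht using hc t ht))
  have : EqOn z (fun _ => 0) (closure (Ioo 0 L)) :=
    EqOn.closure (fun s hs => hz s hs) h.cont_z continuous_const
  rw [closure_Ioo hL.ne] at this
  exact h.deriv_ne_zero (this ⟨le_rfl, hL.le⟩)

theorem IsDirichletSol.hasDerivAt_mul_conj (h : IsDirichletSol L p q μ y z) {s : ℝ}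
    (hs : s ∈ Icc 0 L) : HasDerivAt (fun s => z s * star (y s))
      ((2 * μ * p s + q s - μ ^ 2) * (‖y s‖ ^ 2 : ℝ) + (‖z s‖ ^ 2 : ℝ)) s := by
  have := (h.deriv_z s hs).mul (h.deriv_y s).star
  refine this.congr_deriv ?_
  rw [mul_assoc]
  simp only [RCLike.star_def, Complex.mul_conj, Complex.normSq_eq_norm_sq]

theorem IsDirichletSol.continuous_y (h : IsDirichletSol L p q μ y z) : Continuous y :=
  continuous_iff_continuousAt.2 fun s => (h.deriv_y s).continuousAt

/-- The imaginary part of `(z ȳ)'` is `2 Im μ (p - Re μ) |y|²`. If `|Re μ|` exceeds the bound of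
`p`, it has a fixed sign, while `z ȳ` vanishes at both ends. The factor `-(Re μ · Im μ)` makes the
sign nonnegative in every case. -/
theorem IsDirichletSol.im_eq_zero_of_lt_abs_re (h : IsDirichletSol L p q μ y z) (hL : 0 < L)
    (hp : ∀ s, |p s| ≤ M) (hμ : M < |μ.re|) : μ.im = 0 := by
  by_contra him
  have hd : ∀ s ∈ Ioo 0 L, HasDerivAt
      (fun s => -(μ.re * μ.im) * (z s * star (y s)).im)
      (2 * (μ.im ^ 2 * (μ.re ^ 2 - p s * μ.re) * ‖y s‖ ^ 2)) s := by
    intro s hs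
    have := (Complex.imCLM.hasFDerivAt.comp_hasDerivAt s
      (h.hasDerivAt_mul_conj (Ioo_subset_Icc_self hs))).const_mul (-(μ.re * μ.im))
    refine this.congr_deriv ?_
    simp [pow_two]
    ring
  have hpos : ∀ s, 0 < μ.re ^ 2 - p s * μ.re := by
    intro s
    have h1 : p s * μ.re ≤ |p s| * |μ.re| := by rw [← abs_mul]; exact le_abs_self _
    have h2 : |p s| * |μ.re| < |μ.re| * |μ.re| := by
      have h0 := abs_nonneg (p s)
      exact mul_lt_mul_of_pos_right ((hp s).trans_lt hμ) (h0.trans_lt ((hp s).trans_lt hμ))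
    rw [← sq_abs]
    nlinarith
  have hz := deriv_eq_zero_of_nonneg (by
      have := h.continuous_y; have := h.cont_z
      exact Continuous.continuousOn (continuous_const.mul
        (Complex.continuous_im.comp (by fun_prop)))) hd
    (fun s _ => by have := hpos s; positivity) (by simp [h.zero_left]) (by simp [h.zero_right])
  obtain ⟨s, hs, hne⟩ := h.exists_ne_zero hL
  have h1 := hz s hs
  have := hpos s
  have : 0 < 2 * (μ.im ^ 2 * (μ.re ^ 2 - p s * μ.re) * ‖y s‖ ^ 2) := by positivity
  exact this.ne' h1

/-- Multiplying `z ȳ` by the conjugate of `μ` makes the coefficient of `p` real, so `p` drops out of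
the imaginary part, which leaves `-Im μ (|z|² + (q + |μ|²) |y|²)`. This confines nonreal eigenvalues
to a disc and supplies an imaginary number that is not an eigenvalue. -/
theorem IsDirichletSol.im_eq_zero_of_lt_norm_sq (h : IsDirichletSol L p q μ y z) (hL : 0 < L)
    (hq : ∀ s, |q s| ≤ M) (hμ : M < ‖μ‖ ^ 2) : μ.im = 0 := by
  by_contra him
  have hd : ∀ s ∈ Ioo 0 L, HasDerivAt
      (fun s => -μ.im * ((starRingEnd ℂ) μ * (z s * star (y s))).im)
      (μ.im ^ 2 * (‖z s‖ ^ 2 + (q s + ‖μ‖ ^ 2) * ‖y s‖ ^ 2)) s := by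
    intro s hs
    have := (Complex.imCLM.hasFDerivAt.comp_hasDerivAt s
      ((h.hasDerivAt_mul_conj (Ioo_subset_Icc_self hs)).const_mul
        ((starRingEnd ℂ) μ))).const_mul (-μ.im)
    refine this.congr_deriv ?_
    rw [← Complex.normSq_eq_norm_sq μ, Complex.normSq_apply]
    simp [pow_two]
    ring
  have hpos : ∀ s, 0 < q s + ‖μ‖ ^ 2 := by
    intro s
    have := (abs_le.1 (hq s)).1
    linarith
  have hz := deriv_eq_zero_of_nonneg (by
      have := h.continuous_y; have := h.cont_z
      exact Continuous.continuousOn (continuous_const.mul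
        (Complex.continuous_im.comp (by fun_prop)))) hd
    (fun s _ => by have := hpos s; positivity) (by simp [h.zero_left]) (by simp [h.zero_right])
  obtain ⟨s, hs, hne⟩ := h.exists_ne_zero hL
  have h1 := hz s hs
  have := hpos s
  have : 0 < μ.im ^ 2 * (‖z s‖ ^ 2 + (q s + ‖μ‖ ^ 2) * ‖y s‖ ^ 2) := by positivity
  exact this.ne' h1

end nonreal

/-! ### The Prüfer angle and the counting of nodes. -/

/-- For a real spectral parameter the solution is a multiple of a real one. -/
theorem IsDirichletSol.exists_real {L M lam : ℝ} {p q : ℝ → ℝ} {y z : ℝ → ℂ}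
    (h : IsDirichletSol L p q (lam : ℂ) y z) (hp : ∀ s, |p s| ≤ M)
    (hq : ∀ s, |q s| ≤ M) : ∃ u v : ℝ → ℝ, (∀ s, HasDerivAt u (v s) s) ∧ Continuous v ∧
      (∀ s ∈ Icc 0 L, HasDerivAt v ((2 * lam * p s + q s - lam ^ 2) * u s) s) ∧ u 0 = 0 ∧
      (∀ s ∈ Icc 0 L, y s = 0 ↔ u s = 0) ∧ ∀ s ∈ Icc 0 L, 0 < u s ^ 2 + v s ^ 2 := by
  set d := z 0 with hd
  have hd0 : d ≠ 0 := h.deriv_ne_zero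
  set Y : ℝ → ℂ := fun s => d⁻¹ * y s with hY
  set Z : ℝ → ℂ := fun s => d⁻¹ * z s with hZ
  have hYd : ∀ s, HasDerivAt Y (Z s) s := fun s => (h.deriv_y s).const_mul _
  have hZd : ∀ s ∈ Icc 0 L, HasDerivAt Z ((2 * lam * p s + q s - lam ^ 2) * Y s) s := by
    intro s hs
    refine ((h.deriv_z s hs).const_mul d⁻¹).congr_deriv ?_
    simp only [hY]; ring
  have hreal : ∀ s, (starRingEnd ℂ) (2 * (lam : ℂ) * p s + q s - (lam : ℂ) ^ 2)
      = 2 * (lam : ℂ) * p s + q s - (lam : ℂ) ^ 2 := by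
    intro s
    rw [map_sub, map_add, map_mul, map_mul, map_pow, map_ofNat]
    simp only [Complex.conj_ofReal]
  -- The normalisation makes `Z 0 = 1`, and the coefficients are real, so `Y` minus its conjugate
  -- solves the same equation with zero Cauchy data.
  have him : ∀ s ∈ Icc 0 L, Y s - star (Y s) = 0 := fun s hs =>
    eq_zero_of_initial_zero (y := fun s => Y s - star (Y s)) (z := fun s => Z s - star (Z s))
      (K := fun s => 2 * lam * p s + q s - lam ^ 2)
      (fun s _ => (hYd s).sub (hYd s).star)
      (fun s hs => by
        refine ((hZd s hs).sub (hZd s hs).star).congr_deriv ?_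
        simp only [RCLike.star_def, map_mul, hreal]
        ring)
      (norm_potential_le hp hq lam) (by simp [hY, h.zero_left])
      (by simp [hZ, ← hd, hd0]) hs
  have hre : ∀ s ∈ Icc 0 L, Y s = ((Y s).re : ℂ) := fun s hs => by
    have := him s hs
    rw [sub_eq_zero, RCLike.star_def] at this
    exact (Complex.conj_eq_iff_re.1 this.symm).symm
  have hud : ∀ s, HasDerivAt (fun s => (Y s).re) (Z s).re s := fun s =>
    Complex.reCLM.hasFDerivAt.comp_hasDerivAt s (hYd s)
  have hvd : ∀ s ∈ Icc 0 L, HasDerivAt (fun s => (Z s).re)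
      ((2 * lam * p s + q s - lam ^ 2) * (Y s).re) s := fun s hs => by
    refine (Complex.reCLM.hasFDerivAt.comp_hasDerivAt s (hZd s hs)).congr_deriv ?_
    have : (2 * (lam : ℂ) * p s + q s - (lam : ℂ) ^ 2)
      = ((2 * lam * p s + q s - lam ^ 2 : ℝ) : ℂ) := by push_cast; ring
    rw [this, Complex.reCLM_apply, Complex.re_ofReal_mul]
  refine ⟨fun s => (Y s).re, fun s => (Z s).re, hud, ?_, hvd, by simp [hY, h.zero_left], ?_, ?_⟩
  · have := h.cont_z
    exact Complex.continuous_re.comp (by fun_prop)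
  · intro s hs
    have h1 : y s = 0 ↔ Y s = 0 := by simp [hY, hd0]
    rw [h1]
    constructor
    · intro h; simp [h]
    · intro (h : (Y s).re = 0); rw [hre s hs, h]; simp
  · intro s hs
    have := _root_.energy_pos (y := fun s => ((Y s).re : ℂ)) (z := fun s => ((Z s).re : ℂ))
      (K := fun s => 2 * lam * p s + q s - lam ^ 2)
      (fun s _ => (hud s).ofReal_comp) (fun s hs => by
        refine (hvd s hs).ofReal_comp.congr_deriv ?_
        push_cast; ring) (norm_potential_le hp hq lam) (by simp [hZ, ← hd, hd0]) hs
    simpa using this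

/-- The Prüfer angle of a real solution `u` of `u'' = (2 λ p + q - λ²) u`, taken relative to
`u = r sin θ`, `u' = (λ - p) r cos θ`. -/
theorem exists_pruefer {L lam : ℝ} {p dp q : ℝ → ℝ} (hL : 0 < L) (cp : Continuous p)
    (cdp : Continuous dp) (cq : Continuous q) (hdp : ∀ s ∈ Ioo 0 L, HasDerivAt p (dp s) s)
    (hk : ∀ s, lam - p s ≠ 0) {u v : ℝ → ℝ} (hu : ∀ s, HasDerivAt u (v s) s) (cv : Continuous v)
    (hv : ∀ s ∈ Icc 0 L, HasDerivAt v ((2 * lam * p s + q s - lam ^ 2) * u s) s) (hu0 : u 0 = 0)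
    (hE : ∀ s ∈ Icc 0 L, 0 < u s ^ 2 + v s ^ 2) :
    ∃ θ : ℝ → ℝ, Continuous θ ∧ θ 0 = 0 ∧
      (∀ s ∈ Ioo 0 L, HasDerivAt θ (lam - p s - ((q s + p s ^ 2) * Real.sin (θ s) ^ 2 +
        dp s * (Real.sin (θ s) * Real.cos (θ s))) / (lam - p s)) s) ∧
      ∀ s ∈ Icc 0 L, u s = 0 ↔ Real.sin (θ s) = 0 := by
  have cu : Continuous u := continuous_iff_continuousAt.2 fun s => (hu s).continuousAt
  set k : ℝ → ℝ := fun s => lam - p s with hkdef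
  have ck : Continuous k := by fun_prop
  set c : ℝ → ℝ := fun s => v s / k s with hc
  have cc : Continuous c := cv.div ck hk
  set R : ℝ → ℝ := fun s => c s ^ 2 + u s ^ 2 with hR
  have hRpos : ∀ s ∈ Icc 0 L, 0 < R s := by
    intro s hs
    have hks := hk s
    rcases eq_or_ne (u s) 0 with h0 | h0
    · have := hE s hs
      have hv0 : v s ≠ 0 := by
        rintro h1; simp [h0, h1] at this
      have : c s ≠ 0 := div_ne_zero hv0 hks
      positivity
    · positivity
  -- `φ = (u' c - u c') / (c² + u²)` is the rate of rotation of the vector `(c, u)`. The angle is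
  -- obtained by integrating it, which avoids choosing a branch of the argument.
  set φ : ℝ → ℝ := fun s => (k s * c s ^ 2 + (k s - (q s + p s ^ 2) / k s) * u s ^ 2 -
    dp s / k s * (u s * c s)) / R s with hφ
  have cφ : ContinuousOn φ (Icc 0 L) := by
    refine ContinuousOn.div (Continuous.continuousOn ?_) (Continuous.continuousOn ?_)
      fun s hs => (hRpos s hs).ne'
    · have h1 : Continuous fun s => (q s + p s ^ 2) / k s := (cq.add (cp.pow 2)).div ck hk
      have h2 : Continuous fun s => dp s / k s := cdp.div ck hk
      fun_prop
    · fun_prop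
  set ψ : ℝ → ℝ := fun s => φ (max 0 (min s L)) with hψ
  have cψ : Continuous ψ := cφ.comp_continuous (by fun_prop) fun s =>
    ⟨le_max_left _ _, max_le hL.le (min_le_right _ _)⟩
  have hψφ : ∀ s ∈ Ioo 0 L, ψ s = φ s := fun s hs => by
    simp only [hψ]
    rw [min_eq_left hs.2.le, max_eq_right hs.1.le]
  set θ : ℝ → ℝ := fun s => ∫ t in (0 : ℝ)..s, ψ t with hθ
  have hθd : ∀ s, HasDerivAt θ (ψ s) s := fun s => hasDerivAt_integral_of_continuous cψ 0 s
  have cθ : Continuous θ := continuous_iff_continuousAt.2 fun s => (hθd s).continuousAt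
  have hθ0 : θ 0 = 0 := by simp [hθ]
  have hcd : ∀ s ∈ Ioo 0 L, HasDerivAt c
      (-(k s - (q s + p s ^ 2) / k s) * u s + dp s / k s * c s) s := by
    intro s hs
    refine ((hv s (Ioo_subset_Icc_self hs)).div ((hdp s hs).const_sub lam) (hk s)).congr_deriv ?_
    have hks := hk s
    simp only [hc, hkdef]
    field_simp
    ring
  -- `w² / R` is the squared sine of the difference between `θ` and the polar angle of `(c, u)`.
  -- Both rotate at the rate `φ`, so it is constant, and it vanishes at `0`.
  set w : ℝ → ℝ := fun s => u s * Real.cos (θ s) - c s * Real.sin (θ s) with hw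
  have hw0 : ∀ s ∈ Icc 0 L, w s = 0 := by
    intro s hs
    have h := eq_zero_of_hasDerivAt_zero (a := 0) (b := L) (f := fun s => w s ^ 2 / R s) ?_ ?_ ?_
      s hs
    · have := (hRpos s hs).ne'
      simpa [this] using h
    · refine ContinuousOn.div (Continuous.continuousOn ?_) (Continuous.continuousOn ?_)
        fun s hs => (hRpos s hs).ne'
      · fun_prop
      · fun_prop
    · intro s hs
      have hRs := (hRpos s (Ioo_subset_Icc_self hs)).ne'
      have hks := hk s
      have hθs := hθd s
      rw [hψφ s hs] at hθs
      have hRd : HasDerivAt R _ s := ((hcd s hs).pow 2).add ((hu s).pow 2)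
      have hwd : HasDerivAt w _ s := ((hu s).mul hθs.cos).sub ((hcd s hs).mul hθs.sin)
      refine ((hwd.pow 2).div hRd hRs).congr_deriv ?_
      have hvk : v s = k s * c s := by
        simp only [hc]; rw [mul_div_cancel₀ _ hks]
      have hφR : φ s * R s = k s * c s ^ 2 + (k s - (q s + p s ^ 2) / k s) * u s ^ 2 -
          dp s / k s * (u s * c s) := by simp only [hφ]; field_simp
      rw [hvk]
      generalize (q s + p s ^ 2) / k s = A at *
      generalize dp s / k s = B at *
      have hRe : R s = c s ^ 2 + u s ^ 2 := rfl
      have hwe : w s = u s * Real.cos (θ s) - c s * Real.sin (θ s) := rfl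
      rw [div_eq_zero_iff]; left
      push_cast
      simp only [Pi.pow_apply, pow_one]
      rw [hwe]
      rw [hRe] at hφR ⊢
      generalize Real.cos (θ s) = C at *
      generalize Real.sin (θ s) = S at *
      linear_combination (-2 * (u s * C - c s * S) * (u s * S + c s * C)) * hφR
    · simp [hw, hu0, hθ0]
  refine ⟨θ, cθ, hθ0, ?_, ?_⟩
  · intro s hs
    have hRs := (hRpos s (Ioo_subset_Icc_self hs)).ne'
    have hks := hk s
    refine (hθd s).congr_deriv ?_
    rw [hψφ s hs]
    simp only [hφ]
    rw [div_eq_iff hRs]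
    have h1 := hw0 s (Ioo_subset_Icc_self hs)
    simp only [hw] at h1
    have h2 := Real.sin_sq_add_cos_sq (θ s)
    change _ = (k s - _ / k s) * (c s ^ 2 + u s ^ 2)
    generalize Real.cos (θ s) = C at *
    generalize Real.sin (θ s) = S at *
    have h3 : u s ^ 2 = S ^ 2 * (c s ^ 2 + u s ^ 2) := by
      linear_combination (-u s ^ 2) * h2 + (u s * C + c s * S) * h1
    have h4 : u s * c s = S * C * (c s ^ 2 + u s ^ 2) := by
      linear_combination (-(u s * c s)) * h2 + (c s * C - u s * S) * h1
    have h5 : k s * c s ^ 2 + (k s - (q s + p s ^ 2) / k s) * u s ^ 2 - dp s / k s * (u s * c s)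
      = k s * (c s ^ 2 + u s ^ 2) - (q s + p s ^ 2) / k s * u s ^ 2 - dp s / k s * (u s * c s) := by
      ring
    rw [h5, h4]
    nth_rw 2 [h3]
    ring
  · intro s hs
    have h1 := hw0 s hs
    simp only [hw] at h1
    have hRs := hRpos s hs
    have h2 := Real.sin_sq_add_cos_sq (θ s)
    constructor
    · intro h0
      simp only [hR, h0] at hRs
      have hc0 : c s ≠ 0 := by rintro h; simp [h] at hRs
      simpa [h0, hc0] using h1
    · intro h0
      have hc0 : Real.cos (θ s) ≠ 0 := by rintro h; simp [h, h0] at h2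
      simpa [h0, hc0] using h1

/-- By the intermediate value theorem and injectivity, `θ` takes each of the values `π, 2π, …, θ x`
exactly once on `(0, x]`. -/
theorem eq_pi_mul_ncard {θ : ℝ → ℝ} {L : ℝ} (hc : ContinuousOn θ (Icc 0 L))
    (hm : StrictMonoOn θ (Icc 0 L)) (h0 : θ 0 = 0) {x : ℝ} (hx : x ∈ Icc 0 L)
    (hs : Real.sin (θ x) = 0) :
    θ x = Real.pi * ({t | t ∈ Ioc 0 x ∧ Real.sin (θ t) = 0}.ncard : ℝ) := by
  obtain ⟨m, hm'⟩ := Real.sin_eq_zero_iff.1 hs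
  have h00 : (0 : ℝ) ∈ Icc 0 L := ⟨le_rfl, hx.1.trans hx.2⟩
  have hm0 : 0 ≤ m := by
    have : 0 ≤ θ x := by rw [← h0]; exact hm.monotoneOn h00 hx hx.1
    rw [← hm'] at this
    exact_mod_cast nonneg_of_mul_nonneg_left this Real.pi_pos
  lift m to ℕ using hm0
  have hsub : Icc 0 x ⊆ Icc 0 L := Icc_subset_Icc_right hx.2
  have himg : θ '' {t | t ∈ Ioc 0 x ∧ Real.sin (θ t) = 0}
      = (fun i : ℕ => (i : ℝ) * Real.pi) '' (Finset.Icc 1 m : Finset ℕ) := by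
    ext r
    constructor
    · rintro ⟨t, ⟨ht, hts⟩, rfl⟩
      obtain ⟨i, hi⟩ := Real.sin_eq_zero_iff.1 hts
      have htL := hsub (Ioc_subset_Icc_self ht)
      have h1 : 0 < θ t := by rw [← h0]; exact hm h00 htL ht.1
      have h2 : θ t ≤ θ x := hm.monotoneOn htL hx ht.2
      rw [← hi] at h1 h2
      rw [← hm'] at h2
      have h1' : 0 < i := by exact_mod_cast pos_of_mul_pos_left h1 Real.pi_pos.le
      have h2' : i ≤ (m : ℤ) := by exact_mod_cast le_of_mul_le_mul_right h2 Real.pi_pos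
      lift i to ℕ using h1'.le
      refine ⟨i, ?_, by simpa using hi⟩
      simp only [Finset.coe_Icc, mem_Icc]
      omega
    · rintro ⟨i, hi, rfl⟩
      simp only [Finset.coe_Icc, mem_Icc] at hi
      have h1 : (i : ℝ) * Real.pi ∈ Icc (θ 0) (θ x) := by
        rw [h0, ← hm']
        have : (i : ℝ) ≤ m := by exact_mod_cast hi.2
        refine ⟨by have := Real.pi_pos; positivity, ?_⟩
        push_cast
        have := Real.pi_pos
        gcongr
      obtain ⟨t, ht, hti⟩ := intermediate_value_Icc hx.1 (hc.mono hsub) h1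
      refine ⟨t, ⟨⟨lt_of_le_of_ne ht.1 ?_, ht.2⟩, ?_⟩, hti⟩
      · rintro rfl
        rw [h0] at hti
        have : (0 : ℝ) < (i : ℝ) * Real.pi := by
          have : (0 : ℝ) < i := by exact_mod_cast hi.1
          have := Real.pi_pos; positivity
        exact this.ne hti
      · rw [hti]; exact Real.sin_nat_mul_pi i
  have hinj : InjOn θ {t | t ∈ Ioc 0 x ∧ Real.sin (θ t) = 0} :=
    hm.injOn.mono fun t ht => hsub (Ioc_subset_Icc_self ht.1)
  have hcard := hinj.ncard_image
  rw [himg, ncard_image_of_injective _ (fun i j hij => by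
    have := mul_right_cancel₀ Real.pi_pos.ne' hij
    exact_mod_cast this), ncard_coe_finset, Nat.card_Icc, Nat.add_sub_cancel] at hcard
  rw [← hcard, ← hm']
  push_cast
  ring

/-- `θ` solves the Prüfer equation in integrated form, with `θ(L) = n π`. -/
structure IsPhase (L : ℝ) (p dp q : ℝ → ℝ) (lam : ℝ) (n : ℤ) (θ : ℝ → ℝ) : Prop where
  cont : Continuous θ
  eq : ∀ x ∈ Icc 0 L, θ x = lam * x - (∫ t in (0 : ℝ)..x, p t) -
    ∫ t in (0 : ℝ)..x, (q t + p t ^ 2 - (q t + p t ^ 2) * Real.cos (2 * θ t) +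
      dp t * Real.sin (2 * θ t)) / (2 * (lam - p t))
  right : θ L = n * Real.pi

section

variable {L M lam : ℝ} {p dp q : ℝ → ℝ}

theorem abs_sub_pos_of_bound (hp : ∀ s, |p s| ≤ M) (hlam : 3 * M + 1 ≤ |lam|) (s : ℝ) :
    2 * M + 1 ≤ |lam - p s| := by
  have := abs_sub_abs_le_abs_sub lam (p s)
  have := hp s
  linarith

/-- The numerator is at most `2 M` and the denominator at least `2 M + 1`. Since also `|λ| - |p| ≥ 2
M + 1`, the derivative `θ'` has the sign of `λ`. -/
theorem abs_remainder_le (hp : ∀ s, |p s| ≤ M) (hdp : ∀ s, |dp s| ≤ M)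
    (hV : ∀ s, |q s + p s ^ 2| ≤ M) (hlam : 3 * M + 1 ≤ |lam|) (s x : ℝ) :
    |((q s + p s ^ 2) * Real.sin x ^ 2 + dp s * (Real.sin x * Real.cos x)) / (lam - p s)|
      < 1 := by
  have hk := abs_sub_pos_of_bound hp hlam s
  have hM : 0 ≤ M := (abs_nonneg _).trans (hp s)
  have h1 : |Real.sin x ^ 2| ≤ 1 := by
    rw [abs_of_nonneg (sq_nonneg _)]; exact Real.sin_sq_le_one x
  have h2 : |Real.sin x * Real.cos x| ≤ 1 := by
    rw [abs_mul]
    exact mul_le_one₀ (Real.abs_sin_le_one x) (abs_nonneg _) (Real.abs_cos_le_one x)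
  rw [abs_div, div_lt_one (by linarith)]
  refine lt_of_le_of_lt (abs_add_le _ _) ?_
  rw [abs_mul, abs_mul]
  nlinarith [hV s, hdp s, mul_le_mul (hV s) h1 (abs_nonneg _) hM,
    mul_le_mul (hdp s) h2 (abs_nonneg _) hM]

theorem eq_pi_mul_sign_mul_ncard {θ : ℝ → ℝ} (hM : 0 ≤ M) (hp : ∀ s, |p s| ≤ M)
    (hdp : ∀ s, |dp s| ≤ M) (hV : ∀ s, |q s + p s ^ 2| ≤ M) (hlam : 3 * M + 1 ≤ |lam|)
    (hc : Continuous θ) (h0 : θ 0 = 0)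
    (hd : ∀ s ∈ Ioo 0 L, HasDerivAt θ (lam - p s - ((q s + p s ^ 2) * Real.sin (θ s) ^ 2 +
        dp s * (Real.sin (θ s) * Real.cos (θ s))) / (lam - p s)) s) {x : ℝ} (hx : x ∈ Icc 0 L)
    (hs : Real.sin (θ x) = 0) :
    θ x = Real.pi * (SignType.sign lam * ({t | t ∈ Ioc 0 x ∧ Real.sin (θ t) = 0}.ncard : ℝ)) := by
  have hb : ∀ s, 1 < |lam| - |p s| - |((q s + p s ^ 2) * Real.sin (θ s) ^ 2 +
        dp s * (Real.sin (θ s) * Real.cos (θ s))) / (lam - p s)| + 1 := fun s => by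
    have h1 := abs_remainder_le hp hdp hV hlam s (θ s)
    have := hp s
    linarith
  rcases lt_or_gt_of_ne (show lam ≠ 0 by rintro rfl; simp at hlam; linarith) with hneg | hpos
  · have hm : StrictMonoOn (fun s => -θ s) (Icc 0 L) := by
      refine strictMonoOn_of_deriv_pos (convex_Icc 0 L) hc.neg.continuousOn fun s hs => ?_
      rw [interior_Icc] at hs
      rw [(hd s hs).fun_neg.deriv]
      have := hb s
      rw [abs_of_neg hneg] at this
      have := neg_abs_le (p s)
      have := neg_abs_le (((q s + p s ^ 2) * Real.sin (θ s) ^ 2 +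
        dp s * (Real.sin (θ s) * Real.cos (θ s))) / (lam - p s))
      linarith
    have := eq_pi_mul_ncard (θ := fun s => -θ s) hc.neg.continuousOn hm (by simp [h0]) hx (by simp [hs])
    simp only [Real.sin_neg, neg_eq_zero] at this
    rw [sign_neg hneg]
    simp only [SignType.coe_neg, SignType.coe_one]
    linarith
  · have hm : StrictMonoOn θ (Icc 0 L) := by
      refine strictMonoOn_of_deriv_pos (convex_Icc 0 L) hc.continuousOn fun s hs => ?_
      rw [interior_Icc] at hs
      rw [(hd s hs).deriv]
      have := hb s
      rw [abs_of_pos hpos] at this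
      have := le_abs_self (p s)
      have := le_abs_self (((q s + p s ^ 2) * Real.sin (θ s) ^ 2 +
        dp s * (Real.sin (θ s) * Real.cos (θ s))) / (lam - p s))
      linarith
    have := eq_pi_mul_ncard hc.continuousOn hm h0 hx hs
    rw [sign_pos hpos]
    simp only [SignType.coe_one]
    linarith

/-- This links the index, defined by rounding the eigenvalue, to the oscillation count. The bound
`hlamL` keeps the lower order part of `θ(L)` below `π / 2`, and `hlamL'` excludes the index `0`. -/
theorem IsDirichletSol.exists_phase {μ : ℂ} {y z : ℝ → ℂ} (h : IsDirichletSol L p q μ y z)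
    (hL : 0 < L) (cp : Continuous p) (cdp : Continuous dp) (cq : Continuous q)
    (hpd : ∀ s ∈ Ioo 0 L, HasDerivAt p (dp s) s) (hp : ∀ s, |p s| ≤ M)
    (hdp : ∀ s, |dp s| ≤ M) (hV : ∀ s, |q s + p s ^ 2| ≤ M) (hq : ∀ s, |q s| ≤ M)
    (hlam : 3 * M + 1 ≤ |μ.re|) (hint : ∫ t in (0 : ℝ)..L, p t = 0)
    (hlamL : 3 * M * L / (|μ.re| - M) < Real.pi)
    (hlamL' : Real.pi ≤ |μ.re| * L) :
    ∃ θ : ℝ → ℝ, μ = (μ.re : ℂ) ∧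
      IsPhase L p dp q μ.re (round (μ.re * L / Real.pi)) θ ∧
      ∀ x ∈ Icc 0 L, y x = 0 → θ x = Real.pi * (((round (μ.re * L / Real.pi)).sign *
        ({t | t ∈ Ioc 0 x ∧ y t = 0}.ncard : ℤ) : ℤ) : ℝ) := by
  have hM : 0 ≤ M := (abs_nonneg _).trans (hp 0)
  have him := h.im_eq_zero_of_lt_abs_re hL hp (by linarith)
  have hμ : μ = (μ.re : ℂ) := Complex.ext rfl (by simpa using him)
  set lam := μ.re with hlamdef
  clear_value lam
  subst hμ
  obtain ⟨u, v, hu, cv, hv, hu0, huy, hE⟩ := h.exists_real hp hq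
  have hk : ∀ s, lam - p s ≠ 0 := fun s => by
    have := abs_sub_pos_of_bound hp hlam s
    exact abs_pos.1 (by linarith)
  obtain ⟨θ, cθ, hθ0, hθd, hθu⟩ := exists_pruefer hL cp cdp cq hpd hk hu cv hv hu0 hE
  have heq : ∀ x ∈ Icc 0 L, θ x = lam * x - (∫ t in (0 : ℝ)..x, p t) -
    ∫ t in (0 : ℝ)..x, (q t + p t ^ 2 - (q t + p t ^ 2) * Real.cos (2 * θ t) +
      dp t * Real.sin (2 * θ t)) / (2 * (lam - p t)) := by
    intro x hx
    have hrc : Continuous fun t => (q t + p t ^ 2 - (q t + p t ^ 2) * Real.cos (2 * θ t) +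
      dp t * Real.sin (2 * θ t)) / (2 * (lam - p t)) := by
      refine Continuous.div (by fun_prop) (by fun_prop) fun t => ?_
      exact mul_ne_zero two_ne_zero (hk t)
    have hkey := intervalIntegral.integral_eq_sub_of_hasDerivAt_of_le hx.1 cθ.continuousOn
      (f' := fun t => lam - p t - (q t + p t ^ 2 - (q t + p t ^ 2) * Real.cos (2 * θ t) +
      dp t * Real.sin (2 * θ t)) / (2 * (lam - p t)))
      (fun t ht => (hθd t ⟨ht.1, ht.2.trans_le hx.2⟩).congr_deriv (by
        have := hk t
        rw [Real.cos_two_mul, Real.sin_two_mul, Real.cos_sq']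
        field_simp
        ring))
      (Continuous.intervalIntegrable (by fun_prop) _ _)
    rw [hθ0, sub_zero] at hkey
    rw [← hkey, intervalIntegral.integral_sub (Continuous.intervalIntegrable (by fun_prop) _ _)
      (hrc.intervalIntegrable _ _), intervalIntegral.integral_sub
      (Continuous.intervalIntegrable (by fun_prop) _ _) (cp.intervalIntegrable _ _),
      intervalIntegral.integral_const]
    simp only [sub_zero, smul_eq_mul]
    ring
  have hLmem : L ∈ Icc 0 L := ⟨hL.le, le_rfl⟩
  have hzero : ∀ x ∈ Icc 0 L, y x = 0 → θ x = Real.pi * (SignType.sign lam *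
      ({t | t ∈ Ioc 0 x ∧ y t = 0}.ncard : ℝ)) := by
    intro x hx hyx
    have h1 := eq_pi_mul_sign_mul_ncard hM hp hdp hV hlam cθ hθ0 hθd hx
      ((hθu x hx).1 ((huy x hx).1 hyx))
    rw [h1]
    congr 5
    ext t
    refine and_congr_right fun ht => ?_
    have htL : t ∈ Icc 0 L := ⟨ht.1.le, ht.2.trans hx.2⟩
    rw [huy t htL, hθu t htL]
  obtain ⟨N, hN⟩ : ∃ N : ℤ, θ L = N * Real.pi := by
    obtain ⟨N, hN⟩ := Real.sin_eq_zero_iff.1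
      ((hθu L hLmem).1 ((huy L hLmem).1 h.zero_right))
    exact ⟨N, hN.symm⟩
  -- As `∫ p = 0`, only the remainder integral separates `λ L` from `θ(L) = N π`.
  have hNclose : |lam * L - N * Real.pi| < Real.pi / 2 := by
    have h1 := heq L hLmem
    rw [hint, hN, sub_zero] at h1
    have h2 : |lam * L - N * Real.pi| ≤ 3 * M / (2 * (|lam| - M)) * |L - 0| := by
      rw [show lam * L - N * Real.pi = ∫ t in (0 : ℝ)..L, (q t + p t ^ 2 -
        (q t + p t ^ 2) * Real.cos (2 * θ t) + dp t * Real.sin (2 * θ t)) / (2 * (lam - p t)) by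
        linarith, ← Real.norm_eq_abs]
      refine intervalIntegral.norm_integral_le_of_norm_le_const fun t _ => ?_
      rw [Real.norm_eq_abs, abs_div]
      refine div_le_div₀ (by linarith) ?_ (by linarith) ?_
      · have h3 : |(q t + p t ^ 2) * Real.cos (2 * θ t)| ≤ M * 1 := by
          rw [abs_mul]
          exact mul_le_mul (hV t) (Real.abs_cos_le_one _) (abs_nonneg _) hM
        have h4 : |dp t * Real.sin (2 * θ t)| ≤ M * 1 := by
          rw [abs_mul]
          exact mul_le_mul (hdp t) (Real.abs_sin_le_one _) (abs_nonneg _) hM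
        have h5 := hV t
        rw [abs_le] at *
        constructor <;> linarith
      · rw [abs_mul, abs_two]
        have := abs_sub_abs_le_abs_sub lam (p t)
        have := hp t
        linarith
    refine h2.trans_lt ?_
    rw [sub_zero, abs_of_pos hL]
    have : 3 * M / (2 * (|lam| - M)) * L = (3 * M * L / (|lam| - M)) / 2 := by
      field_simp
    rw [this]
    linarith
  have hround : round (lam * L / Real.pi) = N := by
    rw [round_eq, Int.floor_eq_iff]
    rw [abs_lt] at hNclose
    have hpi := Real.pi_pos
    constructor
    · have : (N : ℝ) - 1 / 2 ≤ lam * L / Real.pi := by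
        rw [le_div_iff₀ hpi]; linarith
      linarith
    · have : lam * L / Real.pi < N + 1 / 2 := by
        rw [div_lt_iff₀ hpi]; linarith
      linarith
  -- `N π` is `π` times the sign of `λ` times a number of zeros. This number is positive, since `N =
  -- 0` would give `|λ| L < π / 2`.
  have hsign : (SignType.sign lam : ℝ) = ((N.sign : ℤ) : ℝ) := by
    have h1 := hzero L hLmem h.zero_right
    have hpi := Real.pi_pos
    have hcard : 0 < ({t | t ∈ Ioc 0 L ∧ y t = 0}.ncard : ℝ) := by
      rcases Nat.eq_zero_or_pos {t | t ∈ Ioc 0 L ∧ y t = 0}.ncard with h2 | h2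
      · exfalso
        rw [h2, Nat.cast_zero, mul_zero, mul_zero, hN] at h1
        have hN0 : (N : ℝ) = 0 := by simpa [hpi.ne'] using h1
        rw [hN0, zero_mul, sub_zero, abs_mul, abs_of_pos hL] at hNclose
        linarith
      · exact_mod_cast h2
    rw [hN] at h1
    rcases lt_or_gt_of_ne (show lam ≠ 0 by rintro rfl; simp at hlam; linarith) with hneg | hpos
    · rw [sign_neg hneg] at h1 ⊢
      have h2 : (N : ℝ) < 0 := by
        simp only [SignType.coe_neg, SignType.coe_one] at h1
        nlinarith
      have h3 : N < 0 := by exact_mod_cast h2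
      rw [Int.sign_eq_neg_one_of_neg h3]; simp
    · rw [sign_pos hpos] at h1 ⊢
      have h2 : 0 < (N : ℝ) := by
        simp only [SignType.coe_one] at h1
        nlinarith
      have h3 : 0 < N := by exact_mod_cast h2
      rw [Int.sign_eq_one_of_pos h3]; simp
  refine ⟨θ, rfl, ⟨cθ, ?_, ?_⟩, ?_⟩
  · exact heq
  · rw [hround]; exact hN
  · intro x hx hyx
    rw [hround, hzero x hx hyx, hsign]
    push_cast
    rfl

end

/-! ### Oscillatory integrals with moving end points. -/

/-- A Riemann–Lebesgue lemma with a variable end point and a fixed phase correction. -/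
theorem tendsto_integral_mul_cexp_zero {G Q : ℝ → ℝ} (cG : Continuous G) (cQ : Continuous Q)
    {a : ℕ → ℝ} (ha : Tendsto (fun k => |a k|) atTop atTop) {s : ℕ → ℝ} {x L : ℝ}
    (hsL : ∀ k, s k ∈ Icc 0 L) (hx : x ∈ Icc 0 L) (hs : Tendsto s atTop (𝓝 x)) :
    Tendsto (fun k => ∫ t in (0 : ℝ)..s k,
      (G t : ℂ) * Complex.exp ((2 * (a k * t - Q t) : ℝ) * Complex.I)) atTop (𝓝 0) := by
  set g : ℕ → ℝ → ℂ := fun k t => (G t : ℂ) * Complex.exp ((2 * (a k * t - Q t) : ℝ) * Complex.I)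
    with hg
  have cg : ∀ k, Continuous (g k) := fun k => by fun_prop
  obtain ⟨C, hC⟩ := (isCompact_Icc (a := 0) (b := L)).exists_bound_of_continuousOn cG.continuousOn
  have hgn : ∀ k, ∀ t ∈ Icc 0 L, ‖g k t‖ ≤ C := fun k t ht => by
    simp only [hg]
    rw [norm_mul, Complex.norm_exp_ofReal_mul_I, mul_one, Complex.norm_real]
    exact hC t ht
  -- At the fixed end point this is the Riemann–Lebesgue lemma for the fixed function `G exp (-2 i
  -- Q)` on `(0, x]`. The Fourier kernel is `exp (-2 π i t w)`, whence the frequency `w = -a / π`.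
  -- The piece from `x` to `s k` is small because the integrand is bounded.
  have h1 : Tendsto (fun k => ∫ t in (0 : ℝ)..x, g k t) atTop (𝓝 0) := by
    have hRL := Real.tendsto_integral_exp_smul_cocompact
      (indicator (Ioc 0 x) fun t => (G t : ℂ) * Complex.exp ((-2 * Q t : ℝ) * Complex.I))
    have hw : Tendsto (fun k => -(a k / Real.pi)) atTop (cocompact ℝ) := by
      rw [← Metric.cobounded_eq_cocompact, ← tendsto_norm_atTop_iff_cobounded]
      simp only [norm_neg, norm_div, Real.norm_eq_abs]
      exact ha.atTop_div_const (abs_pos.2 Real.pi_ne_zero)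
    refine (hRL.comp hw).congr fun k => ?_
    simp only [Function.comp]
    rw [intervalIntegral.integral_of_le hx.1, ← integral_indicator measurableSet_Ioc]
    congr 1
    ext t
    by_cases ht : t ∈ Ioc 0 x
    · rw [indicator_of_mem ht, indicator_of_mem ht, Circle.smul_def, Real.fourierChar_apply,
        smul_eq_mul, mul_left_comm, ← Complex.exp_add]
      simp only [hg]
      congr 2
      have : (Real.pi : ℂ) ≠ 0 := by exact_mod_cast Real.pi_ne_zero
      push_cast
      field_simp
      ring
    · rw [indicator_of_notMem ht, indicator_of_notMem ht, smul_zero]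
  have h2 : Tendsto (fun k => ∫ t in x..s k, g k t) atTop (𝓝 0) := by
    refine squeeze_zero_norm (a := fun k => C * |s k - x|) (fun k => ?_) ?_
    · exact intervalIntegral.norm_integral_le_of_norm_le_const fun t ht =>
        hgn k t (uIcc_subset_Icc hx (hsL k) (uIoc_subset_uIcc ht))
    · have : Tendsto (fun k => C * |s k - x|) atTop (𝓝 (C * |x - x|)) :=
        ((hs.sub_const x).abs).const_mul C
      simpa using this
  refine (by simpa using h1.add h2 : Tendsto _ _ (𝓝 (0 : ℂ))).congr fun k => ?_
  exact intervalIntegral.integral_add_adjacent_intervals ((cg k).intervalIntegrable _ _)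
    ((cg k).intervalIntegrable _ _)

theorem tendsto_integral_mul_cos_zero {G Q : ℝ → ℝ} (cG : Continuous G) (cQ : Continuous Q)
    {a : ℕ → ℝ} (ha : Tendsto (fun k => |a k|) atTop atTop) {s : ℕ → ℝ} {x L : ℝ}
    (hsL : ∀ k, s k ∈ Icc 0 L) (hx : x ∈ Icc 0 L) (hs : Tendsto s atTop (𝓝 x)) :
    Tendsto (fun k => ∫ t in (0 : ℝ)..s k, G t * Real.cos (2 * (a k * t - Q t))) atTop (𝓝 0) := by
  have h := (Complex.continuous_re.tendsto 0).comp
    (tendsto_integral_mul_cexp_zero cG cQ ha hsL hx hs)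
  refine h.congr fun k => ?_
  have := Complex.reCLM.intervalIntegral_comp_comm (μ := volume) (a := 0) (b := s k)
    (f := fun t => (G t : ℂ) * Complex.exp ((2 * (a k * t - Q t) : ℝ) * Complex.I))
    (Continuous.intervalIntegrable (by fun_prop) _ _)
  simp only [Complex.reCLM_apply, Complex.re_ofReal_mul, Complex.exp_ofReal_mul_I_re] at this
  exact this.symm

theorem tendsto_integral_mul_sin_zero {G Q : ℝ → ℝ} (cG : Continuous G) (cQ : Continuous Q)
    {a : ℕ → ℝ} (ha : Tendsto (fun k => |a k|) atTop atTop) {s : ℕ → ℝ} {x L : ℝ}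
    (hsL : ∀ k, s k ∈ Icc 0 L) (hx : x ∈ Icc 0 L) (hs : Tendsto s atTop (𝓝 x)) :
    Tendsto (fun k => ∫ t in (0 : ℝ)..s k, G t * Real.sin (2 * (a k * t - Q t))) atTop (𝓝 0) := by
  have h := (Complex.continuous_im.tendsto 0).comp
    (tendsto_integral_mul_cexp_zero cG cQ ha hsL hx hs)
  refine h.congr fun k => ?_
  have := Complex.imCLM.intervalIntegral_comp_comm (μ := volume) (a := 0) (b := s k)
    (f := fun t => (G t : ℂ) * Complex.exp ((2 * (a k * t - Q t) : ℝ) * Complex.I))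
    (Continuous.intervalIntegrable (by fun_prop) _ _)
  simp only [Complex.imCLM_apply, Complex.im_ofReal_mul, Complex.exp_ofReal_mul_I_im] at this
  exact this.symm

theorem tendsto_integral_zero_of_bounded {L C : ℝ} {F : ℕ → ℝ → ℝ}
    (cF : ∀ k, Continuous (F k)) (hC : ∀ k, ∀ t ∈ Icc 0 L, |F k t| ≤ C)
    (hF : ∀ t ∈ Icc 0 L, Tendsto (fun k => F k t) atTop (𝓝 0)) {s : ℕ → ℝ}
    (hs : ∀ k, s k ∈ Icc 0 L) :
    Tendsto (fun k => ∫ t in (0 : ℝ)..s k, F k t) atTop (𝓝 0) := by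
  rcases lt_or_ge L 0 with hL | hL
  · exact absurd ((hs 0).1.trans (hs 0).2) (not_le.2 hL)
  have h : Tendsto (fun k => ∫ t in (0 : ℝ)..L, |F k t|) atTop (𝓝 (∫ t in (0 : ℝ)..L, 0)) := by
    refine intervalIntegral.tendsto_integral_filter_of_dominated_convergence (fun _ => C)
      (Eventually.of_forall fun k => (cF k).abs.aestronglyMeasurable)
      (Eventually.of_forall fun k => Eventually.of_forall fun t ht => ?_)
      (by simp) (Eventually.of_forall fun t ht => ?_)
    · rw [uIoc_of_le hL] at ht
      rw [Real.norm_eq_abs, abs_abs]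
      exact hC k t (Ioc_subset_Icc_self ht)
    · rw [uIoc_of_le hL] at ht
      simpa using (hF t (Ioc_subset_Icc_self ht)).abs
  rw [intervalIntegral.integral_zero] at h
  refine squeeze_zero_norm (fun k => ?_) h
  refine (intervalIntegral.norm_integral_le_integral_norm (hs k).1).trans ?_
  refine intervalIntegral.integral_mono_interval le_rfl (hs k).1 (hs k).2
    (Eventually.of_forall fun t => abs_nonneg _) ((cF k).abs.intervalIntegrable _ _)

/-! ### Quantitative estimates of the Prüfer angle. -/

section estimates

variable {L M lam a : ℝ} {p dp V θ : ℝ → ℝ}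

/-- The part of the Prüfer angle that comes from the lower order terms. -/
def phaseRem (p dp V : ℝ → ℝ) (lam : ℝ) (θ : ℝ → ℝ) (x : ℝ) : ℝ :=
  ∫ t in (0 : ℝ)..x, (V t - V t * Real.cos (2 * θ t) + dp t * Real.sin (2 * θ t)) /
    (2 * (lam - p t))

/-- A Prüfer angle for the potential `V = q + p²` and the spectral parameter `lam`, whose value at
`L` is `a L`, with the bounds that the estimates use. -/
structure IsPhaseWith (L M : ℝ) (p dp V : ℝ → ℝ) (lam a : ℝ) (θ : ℝ → ℝ) : Prop where
  pos : 0 < L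
  cont_p : Continuous p
  cont_dp : Continuous dp
  cont_V : Continuous V
  bound_p : ∀ t, |p t| ≤ M
  bound_dp : ∀ t, |dp t| ≤ M
  bound_V : ∀ t, |V t| ≤ M
  int_eq_zero : ∫ t in (0 : ℝ)..L, p t = 0
  cont : Continuous θ
  eq : ∀ x ∈ Icc 0 L, θ x = lam * x - (∫ t in (0 : ℝ)..x, p t) - phaseRem p dp V lam θ x
  right : θ L = a * L
  le_lam : 3 * M + 1 ≤ |lam|
  le_a : 4 * M + 4 ≤ |a|

namespace IsPhaseWith

variable (h : IsPhaseWith L M p dp V lam a θ)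
include h

theorem nonneg : 0 ≤ M := (abs_nonneg _).trans (h.bound_p 0)

theorem abs_num_le (x t : ℝ) :
    |V t - V t * Real.cos x + dp t * Real.sin x| ≤ 3 * M := by
  have h3 : |V t * Real.cos x| ≤ M * 1 := by
    rw [abs_mul]
    exact mul_le_mul (h.bound_V t) (Real.abs_cos_le_one _) (abs_nonneg _) h.nonneg
  have h4 : |dp t * Real.sin x| ≤ M * 1 := by
    rw [abs_mul]
    exact mul_le_mul (h.bound_dp t) (Real.abs_sin_le_one _) (abs_nonneg _) h.nonneg
  have h5 := h.bound_V t
  rw [abs_le] at *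
  constructor <;> linarith

/-- The lower bound `c` is left free for a bootstrap: `c = 2 M + 1` gives `|λ - a| ≤ 1`, hence `|λ -
p| ≥ |a| / 2`, and then `c = |a| / 2` gives bounds of order `1 / |a|`. -/
theorem abs_phaseRem_le {c x : ℝ} (hc : 0 < c) (hck : ∀ t, c ≤ |lam - p t|)
    (hx : x ∈ Icc 0 L) : |phaseRem p dp V lam θ x| ≤ 3 * M / (2 * c) * x := by
  have hM := h.nonneg
  have : |phaseRem p dp V lam θ x| ≤ 3 * M / (2 * c) * |x - 0| := by
    rw [← Real.norm_eq_abs]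
    refine intervalIntegral.norm_integral_le_of_norm_le_const fun t _ => ?_
    rw [Real.norm_eq_abs, abs_div, abs_mul, abs_two]
    exact div_le_div₀ (by linarith) (h.abs_num_le _ t) (by linarith) (by have := hck t; linarith)
  rwa [sub_zero, abs_of_nonneg hx.1] at this

theorem phaseRem_right : phaseRem p dp V lam θ L = (lam - a) * L := by
  have := h.eq L ⟨h.pos.le, le_rfl⟩
  rw [h.right, h.int_eq_zero] at this
  linarith

theorem le_abs_sub (t : ℝ) : 2 * M + 1 ≤ |lam - p t| := by
  have := abs_sub_abs_le_abs_sub lam (p t)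
  have := h.bound_p t
  have := h.le_lam
  linarith

theorem sub_ne_zero (t : ℝ) : lam - p t ≠ 0 :=
  abs_pos.1 (by have := h.le_abs_sub t; have := h.nonneg; linarith)

theorem abs_lam_sub_le_of {c : ℝ} (hc : 0 < c) (hck : ∀ t, c ≤ |lam - p t|) :
    |lam - a| ≤ 3 * M / (2 * c) := by
  have h1 := h.abs_phaseRem_le hc hck ⟨h.pos.le, le_rfl⟩
  rw [h.phaseRem_right, abs_mul, abs_of_pos h.pos] at h1
  exact le_of_mul_le_mul_right h1 h.pos

theorem abs_lam_sub_le_one : |lam - a| ≤ 1 := by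
  have hM := h.nonneg
  refine (h.abs_lam_sub_le_of (by linarith) h.le_abs_sub).trans ?_
  rw [div_le_one (by linarith)]
  linarith

theorem abs_pos_a : 0 < |a| := by have := h.le_a; have := h.nonneg; linarith

theorem half_le_abs_sub (t : ℝ) : |a| / 2 ≤ |lam - p t| := by
  have h1 := abs_sub_abs_le_abs_sub a (a - (lam - p t))
  have h2 := abs_add_le (-(lam - a)) (p t)
  rw [abs_neg] at h2
  rw [sub_sub_cancel, show a - (lam - p t) = -(lam - a) + p t by ring] at h1
  have := h.abs_lam_sub_le_one
  have := h.bound_p t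
  have := h.le_a
  have := h.nonneg
  linarith

theorem abs_lam_sub_le : |lam - a| ≤ 3 * M / |a| := by
  have := h.abs_lam_sub_le_of (half_pos h.abs_pos_a) h.half_le_abs_sub
  rwa [mul_div_cancel₀ _ two_ne_zero] at this

/-- The value at `L` expresses `λ - a` through `phaseRem`. So the unknown eigenvalue disappears from
the leading terms, and the linear correction in `bridge` appears. -/
theorem phase_sub {x : ℝ} (hx : x ∈ Icc 0 L) :
    a * x - (∫ t in (0 : ℝ)..x, p t) - θ x =
      phaseRem p dp V lam θ x - x / L * phaseRem p dp V lam θ L := by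
  have := h.pos
  rw [h.eq x hx, h.phaseRem_right]
  field_simp
  ring

theorem abs_phase_sub_le {x : ℝ} (hx : x ∈ Icc 0 L) :
    |a * x - (∫ t in (0 : ℝ)..x, p t) - θ x| ≤ 6 * M * L / |a| := by
  have h1 := h.abs_phaseRem_le (half_pos h.abs_pos_a) h.half_le_abs_sub hx
  have h2 := h.abs_lam_sub_le
  have h3 : a * x - (∫ t in (0 : ℝ)..x, p t) - θ x =
      phaseRem p dp V lam θ x + (-(x * (lam - a))) := by
    rw [h.eq x hx]; ring
  rw [mul_div_cancel₀ _ two_ne_zero] at h1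
  have h4 : |(-(x * (lam - a)))| ≤ x * (3 * M / |a|) := by
    rw [abs_neg, abs_mul, abs_of_nonneg hx.1]
    exact mul_le_mul_of_nonneg_left h2 hx.1
  rw [h3]
  refine (abs_add_le _ _).trans ((add_le_add h1 h4).trans ?_)
  have h5 : 6 * M * L / |a| = 3 * M / |a| * (2 * L) := by ring
  have h6 : 0 ≤ 3 * M / |a| := by have := h.nonneg; have := h.abs_pos_a; positivity
  rw [h5]
  have := hx.2
  nlinarith

theorem abs_div_sub_one_le (t : ℝ) : |a / (lam - p t) - 1| ≤ 2 * (1 + M) / |a| := by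
  have hk := h.sub_ne_zero t
  have h1 : a / (lam - p t) - 1 = (-(lam - a) + p t) / (lam - p t) := by field_simp; ring
  rw [h1, abs_div]
  have h2 : |(-(lam - a)) + p t| ≤ 1 + M := by
    refine (abs_add_le _ _).trans (add_le_add ?_ (h.bound_p t))
    rw [abs_neg]; exact h.abs_lam_sub_le_one
  have h3 := h.half_le_abs_sub t
  have h4 := h.abs_pos_a
  calc _ ≤ (1 + M) / (|a| / 2) := div_le_div₀ (by have := h.nonneg; linarith) h2 (by linarith) h3
    _ = _ := by field_simp

end IsPhaseWith

/-- The density of `2 a` times `phaseRem`, minus its expected leading part. -/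
def phaseErr (p dp V : ℝ → ℝ) (lam a : ℝ) (θ : ℝ → ℝ) (t : ℝ) : ℝ :=
  (V t - V t * Real.cos (2 * θ t) + dp t * Real.sin (2 * θ t)) * (a / (lam - p t) - 1) +
    V t * (Real.cos (2 * (a * t - ∫ u in (0 : ℝ)..t, p u)) - Real.cos (2 * θ t)) +
    dp t * (Real.sin (2 * θ t) - Real.sin (2 * (a * t - ∫ u in (0 : ℝ)..t, p u)))

namespace IsPhaseWith

variable (h : IsPhaseWith L M p dp V lam a θ)
include h

theorem continuous_int : Continuous fun t => ∫ u in (0 : ℝ)..t, p u :=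
  continuous_iff_continuousAt.2 fun s =>
    (hasDerivAt_integral_of_continuous h.cont_p 0 s).continuousAt

theorem continuous_phaseErr : Continuous (phaseErr p dp V lam a θ) := by
  have h1 := h.continuous_int
  have h2 := h.cont_p
  have h3 := h.cont_dp
  have h4 := h.cont_V
  have h5 := h.cont
  have h6 : Continuous fun t => a / (lam - p t) :=
    Continuous.div (by fun_prop) (by fun_prop) h.sub_ne_zero
  unfold phaseErr
  fun_prop

theorem abs_phaseErr_le {t : ℝ} (ht : t ∈ Icc 0 L) :
    |phaseErr p dp V lam a θ t| ≤ (6 * M * (1 + M) + 24 * M ^ 2 * L) / |a| := by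
  have hM := h.nonneg
  have hd := h.abs_phase_sub_le ht
  have h1 := h.abs_num_le (2 * θ t) t
  have h2 := h.abs_div_sub_one_le t
  set P := a * t - ∫ u in (0 : ℝ)..t, p u with hP
  have hc : |Real.cos (2 * P) - Real.cos (2 * θ t)| ≤ 12 * M * L / |a| := by
    have := Real.abs_cos_sub_cos_le (2 * P) (2 * θ t)
    rw [← mul_sub, abs_mul, abs_two] at this
    refine this.trans ((mul_le_mul_of_nonneg_left hd zero_le_two).trans (le_of_eq (by ring)))
  have hs : |Real.sin (2 * θ t) - Real.sin (2 * P)| ≤ 12 * M * L / |a| := by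
    have := Real.abs_sin_sub_sin_le (2 * θ t) (2 * P)
    rw [← mul_sub, abs_mul, abs_two, abs_sub_comm (θ t) P] at this
    refine this.trans ((mul_le_mul_of_nonneg_left hd zero_le_two).trans (le_of_eq (by ring)))
  unfold phaseErr
  rw [← hP]
  refine (abs_add_three _ _ _).trans ?_
  rw [abs_mul, abs_mul, abs_mul]
  have e1 := mul_le_mul h1 h2 (abs_nonneg _) (by linarith)
  have e2 := mul_le_mul (h.bound_V t) hc (abs_nonneg _) hM
  have e3 := mul_le_mul (h.bound_dp t) hs (abs_nonneg _) hM
  refine (add_le_add (add_le_add e1 e2) e3).trans (le_of_eq (by ring))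

/-- An exact decomposition: `a / (λ - p)` is replaced by `1`, `θ` by `a t - Q(t)`, and `phaseErr`
collects the cost, which is of order `1 / |a|`. -/
theorem two_mul_phaseRem (x : ℝ) : 2 * a * phaseRem p dp V lam θ x =
    (∫ t in (0 : ℝ)..x, V t) -
      ((∫ t in (0 : ℝ)..x, V t * Real.cos (2 * (a * t - ∫ u in (0 : ℝ)..t, p u))) -
        ∫ t in (0 : ℝ)..x, dp t * Real.sin (2 * (a * t - ∫ u in (0 : ℝ)..t, p u))) +
      ∫ t in (0 : ℝ)..x, phaseErr p dp V lam a θ t := by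
  have h1 := h.continuous_int
  have h2 := h.cont_p
  have h3 := h.cont_dp
  have h4 := h.cont_V
  have h5 := h.continuous_phaseErr
  rw [phaseRem, ← intervalIntegral.integral_const_mul,
    ← intervalIntegral.integral_sub (Continuous.intervalIntegrable (by fun_prop) _ _)
      (Continuous.intervalIntegrable (by fun_prop) _ _),
    ← intervalIntegral.integral_sub (Continuous.intervalIntegrable (by fun_prop) _ _)
      (Continuous.intervalIntegrable (by fun_prop) _ _),
    ← intervalIntegral.integral_add (Continuous.intervalIntegrable (by fun_prop) _ _)
      (Continuous.intervalIntegrable (by fun_prop) _ _)]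
  congr 1
  ext t
  have := h.sub_ne_zero t
  unfold phaseErr
  field_simp
  ring

end IsPhaseWith

end estimates

/-- The oscillatory integral in the variable `s`. -/
def oscRem (p dp V : ℝ → ℝ) (a x : ℝ) : ℝ :=
  (∫ t in (0 : ℝ)..x, V t * Real.cos (2 * (a * t - ∫ u in (0 : ℝ)..t, p u))) -
    ∫ t in (0 : ℝ)..x, dp t * Real.sin (2 * (a * t - ∫ u in (0 : ℝ)..t, p u))

/-- The integral of `V` with the linear function that has the same end values subtracted. -/
def bridge (L : ℝ) (V : ℝ → ℝ) (x : ℝ) : ℝ :=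
  (∫ t in (0 : ℝ)..x, V t) - x / L * ∫ t in (0 : ℝ)..L, V t

theorem continuous_bridge {L : ℝ} {V : ℝ → ℝ} (cV : Continuous V) : Continuous (bridge L V) := by
  have : Continuous fun x => ∫ t in (0 : ℝ)..x, V t := continuous_iff_continuousAt.2 fun s =>
    (hasDerivAt_integral_of_continuous cV 0 s).continuousAt
  unfold bridge
  fun_prop

/-! ### The three orders of the asymptotic expansion. -/

section limits

variable {L M : ℝ} {p dp V : ℝ → ℝ} {lam a : ℕ → ℝ} {θ : ℕ → ℝ → ℝ}

theorem tendsto_const_div_abs (ha : Tendsto (fun k => |a k|) atTop atTop) (C : ℝ) :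
    Tendsto (fun k => C / |a k|) atTop (𝓝 0) := ha.const_div_atTop C

/-- First-order Taylor expansion, uniform in the base points `x k`, which need not converge. With `2
a d → f` the quadratic error `a d²` tends to `0`; the oscillating factors `sin (x k)` and `cos (x
k)` remain, to be averaged out under the integral. -/
theorem tendsto_mul_cos_sub {a d x : ℕ → ℝ} {f : ℝ} (hd : Tendsto d atTop (𝓝 0))
    (had : Tendsto (fun k => a k * (2 * d k)) atTop (𝓝 f)) :
    Tendsto (fun k => a k * (Real.cos (x k) - Real.cos (x k - 2 * d k)) + f * Real.sin (x k))
      atTop (𝓝 0) ∧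
    Tendsto (fun k => a k * (Real.sin (x k - 2 * d k) - Real.sin (x k)) + f * Real.cos (x k))
      atTop (𝓝 0) := by
  have hd2 : Tendsto (fun k => 2 * d k) atTop (𝓝 0) := by simpa using hd.const_mul 2
  have hc : Tendsto (fun k => a k * (1 - Real.cos (2 * d k))) atTop (𝓝 0) := by
    have h2 : Tendsto (fun k => |a k * (2 * d k)| * |2 * d k|) atTop (𝓝 0) := by
      simpa using had.abs.mul hd2.abs
    refine squeeze_zero_norm (fun k => ?_) h2
    have h3 : |1 - Real.cos (2 * d k)| ≤ |2 * d k| * |2 * d k| := by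
      rw [abs_of_nonneg (sub_nonneg.2 (Real.cos_le_one _)), ← abs_mul, abs_mul_self]
      nlinarith [Real.one_sub_sq_div_two_le_cos (x := 2 * d k), sq_nonneg (2 * d k)]
    rw [Real.norm_eq_abs, abs_mul, abs_mul, mul_assoc]
    exact mul_le_mul_of_nonneg_left h3 (abs_nonneg _)
  have hs : Tendsto (fun k => f - a k * Real.sin (2 * d k)) atTop (𝓝 0) := by
    have h1 : Tendsto (fun k => (f - a k * (2 * d k)) +
        a k * (2 * d k - Real.sin (2 * d k))) atTop (𝓝 ((f - f) + 0)) := by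
      refine (had.const_sub f).add ?_
      have h2 : Tendsto (fun k => |a k * (2 * d k)| * |2 * d k| ^ 2) atTop (𝓝 0) := by
        simpa using had.abs.mul (hd2.abs.pow 2)
      have hev : ∀ᶠ k in atTop, |2 * d k| ≤ 1 := by
        have := hd2.abs
        rw [abs_zero] at this
        exact this.eventually_le_const one_pos
      refine squeeze_zero_norm' ?_ h2
      filter_upwards [hev] with k hk
      have h3 : |2 * d k - Real.sin (2 * d k)| ≤ |2 * d k| * |2 * d k| ^ 2 := by
        have h4 := Real.sin_bound hk
        have h5 : |2 * d k| ^ 5 ≤ |2 * d k| ^ 3 :=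
          pow_le_pow_of_le_one (abs_nonneg _) hk (by norm_num)
        have h6 : |(2 * d k) ^ 3 / 6| = |2 * d k| ^ 3 / 6 := by rw [abs_div, abs_pow]; norm_num
        have h7 := abs_sub_le (2 * d k - Real.sin (2 * d k)) ((2 * d k) ^ 3 / 6) 0
        rw [sub_zero, sub_zero, h6] at h7
        have h8 : |2 * d k - Real.sin (2 * d k) - (2 * d k) ^ 3 / 6|
          = |Real.sin (2 * d k) - (2 * d k - (2 * d k) ^ 3 / 6)| := by
          rw [← abs_neg]; congr 1; ring
        rw [h8] at h7
        have h9 : 0 ≤ |2 * d k| ^ 3 := by positivity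
        calc _ ≤ |2 * d k| ^ 3 := by linarith
          _ = _ := by ring
      rw [Real.norm_eq_abs, abs_mul, abs_mul, mul_assoc]
      exact mul_le_mul_of_nonneg_left h3 (abs_nonneg _)
    simp only [sub_self, add_zero] at h1
    refine h1.congr fun k => by ring
  have hb : ∀ {b c : ℕ → ℝ}, Tendsto b atTop (𝓝 0) → (∀ k, |c k| ≤ 1) →
      Tendsto (fun k => b k * c k) atTop (𝓝 0) := by
    intro b c hb hc
    refine squeeze_zero_norm (fun k => ?_) (by simpa using hb.abs)
    rw [Real.norm_eq_abs, abs_mul]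
    exact mul_le_of_le_one_right (abs_nonneg _) (hc k)
  constructor
  · have := (hb hc fun k => Real.abs_cos_le_one (x k)).add
      (hb hs fun k => Real.abs_sin_le_one (x k))
    rw [add_zero] at this
    refine this.congr fun k => ?_
    rw [Real.cos_sub]; ring
  · have := (hb hc fun k => Real.abs_sin_le_one (x k)).neg.add
      (hb hs fun k => Real.abs_cos_le_one (x k))
    rw [neg_zero, add_zero] at this
    refine this.congr fun k => ?_
    rw [Real.sin_sub]; ring

variable (h : ∀ k, IsPhaseWith L M p dp V (lam k) (a k) (θ k))
  (ha : Tendsto (fun k => |a k|) atTop atTop) {s : ℕ → ℝ} {x : ℝ} (hsL : ∀ k, s k ∈ Icc 0 L)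
  (hx : x ∈ Icc 0 L) (hs : Tendsto s atTop (𝓝 x))
include h ha hsL hx hs

theorem tendsto_oscRem_zero : Tendsto (fun k => oscRem p dp V (a k) (s k)) atTop (𝓝 0) := by
  have := (tendsto_integral_mul_cos_zero (h 0).cont_V (h 0).continuous_int ha hsL hx hs).sub
    (tendsto_integral_mul_sin_zero (h 0).cont_dp (h 0).continuous_int ha hsL hx hs)
  rwa [sub_zero] at this

theorem tendsto_two_mul_phaseRem :
    Tendsto (fun k => 2 * a k * phaseRem p dp V (lam k) (θ k) (s k)) atTop
      (𝓝 (∫ t in (0 : ℝ)..x, V t)) := by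
  have hI : Tendsto (fun k => ∫ t in (0 : ℝ)..s k, V t) atTop (𝓝 (∫ t in (0 : ℝ)..x, V t)) :=
    (hasDerivAt_integral_of_continuous (h 0).cont_V 0 x).continuousAt.tendsto.comp hs
  have hE : Tendsto (fun k => ∫ t in (0 : ℝ)..s k, phaseErr p dp V (lam k) (a k) (θ k) t) atTop
      (𝓝 0) := by
    refine squeeze_zero_norm (fun k => ?_)
      (tendsto_const_div_abs ha ((6 * M * (1 + M) + 24 * M ^ 2 * L) * L))
    have h1 := intervalIntegral.norm_integral_le_of_norm_le_const
      (f := phaseErr p dp V (lam k) (a k) (θ k)) (a := 0) (b := s k)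
      (C := (6 * M * (1 + M) + 24 * M ^ 2 * L) / |a k|) fun t ht => (h k).abs_phaseErr_le (by
        rw [uIoc_of_le (hsL k).1] at ht
        exact ⟨ht.1.le, ht.2.trans (hsL k).2⟩)
    refine h1.trans ?_
    rw [sub_zero, abs_of_nonneg (hsL k).1, div_mul_eq_mul_div]
    have := (h k).abs_pos_a
    have := (h k).nonneg
    have := (h k).pos
    gcongr
    exact (hsL k).2
  have := (hI.sub (tendsto_oscRem_zero h ha hsL hx hs)).add hE
  rw [sub_zero, add_zero] at this
  exact this.congr fun k => ((h k).two_mul_phaseRem (s k)).symm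

omit hsL hs in
theorem tendsto_two_mul_phase_sub :
    Tendsto (fun k => a k * (2 * (a k * x - (∫ t in (0 : ℝ)..x, p t) - θ k x))) atTop
      (𝓝 (bridge L V x)) := by
  have h1 := tendsto_two_mul_phaseRem h ha (fun _ => hx) hx tendsto_const_nhds
  have hL : L ∈ Icc 0 L := ⟨(h 0).pos.le, le_rfl⟩
  have h2 := tendsto_two_mul_phaseRem h ha (fun _ => hL) hL tendsto_const_nhds
  refine (h1.sub (h2.const_mul (x / L))).congr fun k => ?_
  rw [(h k).phase_sub hx]
  ring

omit hsL hs in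
-- Two corrections enter: `a (a / (λ - p) - 1) → p`, and `2 a (a x - Q - θ) → bridge L V x`, which
-- shifts the trigonometric arguments. The only limiting term without oscillation is `V p`.
theorem tendsto_mul_phaseErr :
    Tendsto (fun k => a k * phaseErr p dp V (lam k) (a k) (θ k) x - V x * p x +
      (p x * V x + bridge L V x * dp x) *
        Real.cos (2 * (a k * x - ∫ u in (0 : ℝ)..x, p u)) -
      (p x * dp x - bridge L V x * V x) *
        Real.sin (2 * (a k * x - ∫ u in (0 : ℝ)..x, p u))) atTop (𝓝 0) := by
  have h1 : Tendsto (fun k => a k / (lam k - p x) - 1) atTop (𝓝 0) :=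
    squeeze_zero_norm (fun k => (h k).abs_div_sub_one_le x) (tendsto_const_div_abs ha _)
  have h2 : Tendsto (fun k => lam k - a k) atTop (𝓝 0) :=
    squeeze_zero_norm (fun k => (h k).abs_lam_sub_le) (tendsto_const_div_abs ha _)
  have h3 : Tendsto (fun k => a k * (a k / (lam k - p x) - 1) - p x) atTop (𝓝 0) := by
    have := ((h1.add_const 1).mul (h2.neg.add_const (p x))).sub_const (p x)
    simp only [neg_zero, zero_add, one_mul, sub_self] at this
    refine this.congr fun k => ?_
    have := (h k).sub_ne_zero x
    field_simp
    ring
  have hd : Tendsto (fun k => a k * x - (∫ t in (0 : ℝ)..x, p t) - θ k x) atTop (𝓝 0) :=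
    squeeze_zero_norm (fun k => (h k).abs_phase_sub_le hx) (tendsto_const_div_abs ha _)
  have had := tendsto_two_mul_phase_sub h ha hx
  obtain ⟨h4, h5⟩ := tendsto_mul_cos_sub
    (x := fun k => 2 * (a k * x - ∫ u in (0 : ℝ)..x, p u)) hd had
  have hinv : Tendsto (fun k => (a k)⁻¹) atTop (𝓝 0) := by
    refine squeeze_zero_norm (fun k => le_of_eq ?_) (tendsto_const_div_abs ha 1)
    simp
  have hne : ∀ k, a k ≠ 0 := fun k => abs_pos.1 (h k).abs_pos_a
  have hang : ∀ k, 2 * (a k * x - ∫ u in (0 : ℝ)..x, p u) -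
      2 * (a k * x - (∫ t in (0 : ℝ)..x, p t) - θ k x) = 2 * θ k x := fun k => by ring
  simp only [hang] at h4 h5
  have hc : Tendsto (fun k => Real.cos (2 * (a k * x - ∫ u in (0 : ℝ)..x, p u)) -
      Real.cos (2 * θ k x)) atTop (𝓝 0) := by
    refine squeeze_zero_norm (fun k => ?_) (by simpa using (hd.abs.const_mul 2))
    refine (Real.abs_cos_sub_cos_le _ _).trans (le_of_eq ?_)
    rw [← mul_sub, abs_mul, abs_two]
  have hsn : Tendsto (fun k => Real.sin (2 * θ k x) -
      Real.sin (2 * (a k * x - ∫ u in (0 : ℝ)..x, p u))) atTop (𝓝 0) := by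
    refine squeeze_zero_norm (fun k => ?_) (by simpa using (hd.abs.const_mul 2))
    refine (Real.abs_sin_sub_sin_le _ _).trans (le_of_eq ?_)
    rw [← mul_sub, abs_mul, abs_two, abs_sub_comm]
  have hR : Tendsto (fun k => (V x - V x * Real.cos (2 * θ k x) + dp x * Real.sin (2 * θ k x)) *
      (a k * (a k / (lam k - p x) - 1) - p x)) atTop (𝓝 0) := by
    refine squeeze_zero_norm (a := fun k => 3 * M * |a k * (a k / (lam k - p x) - 1) - p x|)
      (fun k => ?_) (by simpa using h3.abs.const_mul (3 * M))
    rw [norm_mul]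
    exact mul_le_mul_of_nonneg_right ((h k).abs_num_le _ _) (norm_nonneg _)
  have := (((hR.add (hc.const_mul (p x * V x))).add (hsn.const_mul (p x * dp x))).add
    (h4.const_mul (V x))).add (h5.const_mul (dp x))
  simp only [mul_zero, add_zero] at this
  refine this.congr fun k => ?_
  unfold phaseErr
  ring

theorem tendsto_mul_integral_phaseErr :
    Tendsto (fun k => a k * ∫ t in (0 : ℝ)..s k, phaseErr p dp V (lam k) (a k) (θ k) t) atTop
      (𝓝 (∫ t in (0 : ℝ)..x, V t * p t)) := by
  have cp := (h 0).cont_p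
  have cdp := (h 0).cont_dp
  have cV := (h 0).cont_V
  have cQ := (h 0).continuous_int
  have cB : Continuous (bridge L V) := continuous_bridge cV
  set F : ℕ → ℝ → ℝ := fun k t => a k * phaseErr p dp V (lam k) (a k) (θ k) t - V t * p t +
      (p t * V t + bridge L V t * dp t) *
        Real.cos (2 * (a k * t - ∫ u in (0 : ℝ)..t, p u)) -
      (p t * dp t - bridge L V t * V t) *
        Real.sin (2 * (a k * t - ∫ u in (0 : ℝ)..t, p u)) with hF
  have cE : ∀ k, Continuous (phaseErr p dp V (lam k) (a k) (θ k)) :=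
    fun k => (h k).continuous_phaseErr
  have cF : ∀ k, Continuous (F k) := fun k => by have := cE k; fun_prop
  obtain ⟨C1, hC1⟩ := (isCompact_Icc (a := 0) (b := L)).exists_bound_of_continuousOn
    (f := fun t => V t * p t) (by fun_prop)
  obtain ⟨C2, hC2⟩ := (isCompact_Icc (a := 0) (b := L)).exists_bound_of_continuousOn
    (f := fun t => p t * V t + bridge L V t * dp t) (by fun_prop)
  obtain ⟨C3, hC3⟩ := (isCompact_Icc (a := 0) (b := L)).exists_bound_of_continuousOn
    (f := fun t => p t * dp t - bridge L V t * V t) (by fun_prop)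
  have hFb : ∀ k, ∀ t ∈ Icc 0 L, |F k t| ≤
      (6 * M * (1 + M) + 24 * M ^ 2 * L) + C1 + C2 * 1 + C3 * 1 := by
    intro k t ht
    have e1 : |a k * phaseErr p dp V (lam k) (a k) (θ k) t| ≤
        6 * M * (1 + M) + 24 * M ^ 2 * L := by
      have := (h k).abs_phaseErr_le ht
      rw [le_div_iff₀ (h k).abs_pos_a] at this
      rwa [abs_mul, mul_comm]
    have e2 := hC2 t ht
    have e3 := hC3 t ht
    rw [Real.norm_eq_abs] at e2 e3
    refine (abs_sub _ _).trans (add_le_add ((abs_add_le _ _).trans (add_le_add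
      ((abs_sub _ _).trans (add_le_add e1 (hC1 t ht))) ?_)) ?_)
    · rw [abs_mul]
      exact mul_le_mul e2 (Real.abs_cos_le_one _) (abs_nonneg _) ((abs_nonneg _).trans e2)
    · rw [abs_mul]
      exact mul_le_mul e3 (Real.abs_sin_le_one _) (abs_nonneg _) ((abs_nonneg _).trans e3)
  -- Dominated convergence handles the part of the density that tends to `0` pointwise, and the
  -- Riemann–Lebesgue lemma its oscillating part, so `∫ V p` survives.
  have t1 := tendsto_integral_zero_of_bounded cF hFb
    (fun t ht => tendsto_mul_phaseErr h ha ht) hsL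
  have t2 := tendsto_integral_mul_cos_zero
    (G := fun t => p t * V t + bridge L V t * dp t) (by fun_prop) cQ ha hsL hx hs
  have t3 := tendsto_integral_mul_sin_zero
    (G := fun t => p t * dp t - bridge L V t * V t) (by fun_prop) cQ ha hsL hx hs
  have t4 : Tendsto (fun k => ∫ t in (0 : ℝ)..s k, V t * p t) atTop
      (𝓝 (∫ t in (0 : ℝ)..x, V t * p t)) :=
    (hasDerivAt_integral_of_continuous (by fun_prop) 0 x).continuousAt.tendsto.comp hs
  have := ((t1.add t4).sub t2).add t3
  rw [zero_add, sub_zero, add_zero] at this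
  refine this.congr fun k => ?_
  have := cE k
  have := cF k
  rw [← intervalIntegral.integral_add (Continuous.intervalIntegrable (by fun_prop) _ _)
      (Continuous.intervalIntegrable (by fun_prop) _ _),
    ← intervalIntegral.integral_sub (Continuous.intervalIntegrable (by fun_prop) _ _)
      (Continuous.intervalIntegrable (by fun_prop) _ _),
    ← intervalIntegral.integral_add (Continuous.intervalIntegrable (by fun_prop) _ _)
      (Continuous.intervalIntegrable (by fun_prop) _ _), ← intervalIntegral.integral_const_mul]
  congr 1
  ext t
  simp only [hF]
  ring

omit hx in
/-- First order: `a s - θ(s) → Q`. -/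
theorem tendsto_phase_shift :
    Tendsto (fun k => a k * s k - θ k (s k)) atTop (𝓝 (∫ t in (0 : ℝ)..x, p t)) := by
  have hI : Tendsto (fun k => ∫ t in (0 : ℝ)..s k, p t) atTop (𝓝 (∫ t in (0 : ℝ)..x, p t)) :=
    (hasDerivAt_integral_of_continuous (h 0).cont_p 0 x).continuousAt.tendsto.comp hs
  have hd : Tendsto (fun k => a k * s k - (∫ t in (0 : ℝ)..s k, p t) - θ k (s k)) atTop (𝓝 0) :=
    squeeze_zero_norm (fun k => (h k).abs_phase_sub_le (hsL k)) (tendsto_const_div_abs ha _)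
  have := hd.add hI
  rw [zero_add] at this
  exact this.congr fun k => by ring

/-- Second order: `2 a (a s - θ(s) - Q) → bridge V`. -/
theorem tendsto_phase_shift₁ :
    Tendsto (fun k => 2 * a k * (a k * s k - θ k (s k) - ∫ t in (0 : ℝ)..s k, p t)) atTop
      (𝓝 (bridge L V x)) := by
  have h1 := tendsto_two_mul_phaseRem h ha hsL hx hs
  have hL : L ∈ Icc 0 L := ⟨(h 0).pos.le, le_rfl⟩
  have h2 := tendsto_two_mul_phaseRem h ha (fun _ => hL) hL tendsto_const_nhds
  refine (h1.sub ((hs.div_const L).mul h2)).congr fun k => ?_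
  have := (h k).phase_sub (hsL k)
  rw [sub_right_comm] at this
  rw [this]
  ring

/-- Third order, after removal of the oscillatory terms. -/
theorem tendsto_phase_shift₂ :
    Tendsto (fun k => a k *
      (2 * a k * (a k * s k - θ k (s k) - ∫ t in (0 : ℝ)..s k, p t) - bridge L V (s k) +
        oscRem p dp V (a k) (s k) - oscRem p dp V (a k) L * (s k / L))) atTop
      (𝓝 (bridge L (fun t => V t * p t) x)) := by
  have h1 := tendsto_mul_integral_phaseErr h ha hsL hx hs
  have hL : L ∈ Icc 0 L := ⟨(h 0).pos.le, le_rfl⟩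
  have h2 := tendsto_mul_integral_phaseErr h ha (fun _ => hL) hL tendsto_const_nhds
  refine (h1.sub ((hs.div_const L).mul h2)).congr fun k => ?_
  have e := (h k).phase_sub (hsL k)
  rw [sub_right_comm] at e
  have e1 : 2 * a k * phaseRem p dp V (lam k) (θ k) (s k) = _ - oscRem p dp V (a k) (s k) + _ :=
    (h k).two_mul_phaseRem (s k)
  have e2 : 2 * a k * phaseRem p dp V (lam k) (θ k) L = _ - oscRem p dp V (a k) L + _ :=
    (h k).two_mul_phaseRem L
  rw [e]
  unfold bridge
  linear_combination (-a k) * e1 + a k * (s k / L) * e2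

/-- With `P = a t - Q` one has `(sin 2P / 2)' = a cos 2P - p cos 2P`. The last term integrates to
`o(1)`. The boundary term is of order `1 / |a|` only because `sin θ = 0` at the end point and `P - θ
= O(1 / |a|)`. -/
theorem tendsto_mul_integral_cos_zero (hnode : ∀ k, Real.sin (θ k (s k)) = 0) :
    Tendsto (fun k => a k * ∫ t in (0 : ℝ)..s k,
      Real.cos (2 * (a k * t - ∫ u in (0 : ℝ)..t, p u))) atTop (𝓝 0) := by
  have cp := (h 0).cont_p
  have cQ := (h 0).continuous_int
  have t1 := tendsto_integral_mul_cos_zero cp cQ ha hsL hx hs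
  have t2 : Tendsto (fun k => Real.sin (2 * (a k * s k - ∫ u in (0 : ℝ)..s k, p u)) / 2) atTop
      (𝓝 0) := by
    refine squeeze_zero_norm (fun k => ?_) (tendsto_const_div_abs ha (6 * M * L))
    have e1 := (h k).abs_phase_sub_le (hsL k)
    set P := a k * s k - ∫ u in (0 : ℝ)..s k, p u
    have e2 : Real.sin (2 * P) = Real.sin (2 * P) - Real.sin (2 * θ k (s k)) := by
      rw [Real.sin_two_mul (θ k (s k)), hnode k]; ring
    rw [e2, norm_div, Real.norm_ofNat, div_le_iff₀ two_pos]
    refine (Real.abs_sin_sub_sin_le _ _).trans ?_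
    rw [← mul_sub, abs_mul, abs_two]
    linarith
  have := t2.add t1
  rw [add_zero] at this
  refine this.congr fun k => ?_
  have hd : ∀ t, HasDerivAt (fun t => Real.sin (2 * (a k * t - ∫ u in (0 : ℝ)..t, p u)) / 2)
      (a k * Real.cos (2 * (a k * t - ∫ u in (0 : ℝ)..t, p u)) -
        p t * Real.cos (2 * (a k * t - ∫ u in (0 : ℝ)..t, p u))) t := fun t => by
    have := (((((hasDerivAt_id t).const_mul (a k)).sub
      (hasDerivAt_integral_of_continuous cp 0 t)).const_mul 2).sin).div_const 2
    refine this.congr_deriv ?_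
    simp only [id, Pi.sub_apply]
    ring
  have hi := intervalIntegral.integral_eq_sub_of_hasDerivAt (a := 0) (b := s k)
    (fun t _ => hd t) (Continuous.intervalIntegrable (by fun_prop) _ _)
  rw [intervalIntegral.integral_sub (Continuous.intervalIntegrable (by fun_prop) _ _)
    (Continuous.intervalIntegrable (by fun_prop) _ _), intervalIntegral.integral_const_mul] at hi
  simp only [mul_zero, intervalIntegral.integral_same, sub_self, Real.sin_zero, zero_div,
    sub_zero] at hi
  linarith

end limits

/-! ### The characteristic function; finiteness of eigenvalues and nodes. -/

theorem continuous_integral_of_continuous {E : Type*} [NormedAddCommGroup E] [NormedSpace ℝ E]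
    [CompleteSpace E] {f : ℝ → E} (hf : Continuous f) (a : ℝ) :
    Continuous fun u => ∫ t in a..u, f t :=
  continuous_iff_continuousAt.2 fun s => (hasDerivAt_integral_of_continuous hf a s).continuousAt

/-- A continuous solution of the integral equation `Y = ∫ (d + ∫ K Y)` that vanishes at `L` is a
solution of the boundary value problem. -/
theorem exists_isDirichletSol {L : ℝ} (hL : 0 ≤ L) {p q : ℝ → ℝ} (cp : Continuous p)
    (cq : Continuous q) {μ d : ℂ} (hd : d ≠ 0) {Y : ℝ → ℂ} (cY : Continuous Y)
    (hY : ∀ s ∈ Icc 0 L, Y s = ∫ r in (0 : ℝ)..s,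
      (d + ∫ t in (0 : ℝ)..r, (2 * μ * p t + q t - μ ^ 2) * Y t)) (hYL : Y L = 0) :
    ∃ y z, IsDirichletSol L p q μ y z ∧ z 0 = d ∧ ∀ s ∈ Icc 0 L, y s = Y s := by
  have cK : Continuous fun t => (2 * μ * p t + q t - μ ^ 2) * Y t := by fun_prop
  have cz := (continuous_integral_of_continuous cK 0).const_add d
  refine ⟨fun s => ∫ r in (0 : ℝ)..s,
      (d + ∫ t in (0 : ℝ)..r, (2 * μ * p t + q t - μ ^ 2) * Y t),
    fun r => d + ∫ t in (0 : ℝ)..r, (2 * μ * p t + q t - μ ^ 2) * Y t,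
    ⟨fun s => hasDerivAt_integral_of_continuous cz 0 s, cz, fun s hs => ?_, by simp, ?_, by
      simpa using hd⟩, by simp, fun s hs => (hY s hs).symm⟩
  · rw [← hY s hs]
    exact (hasDerivAt_integral_of_continuous cK 0 s).const_add d
  · rw [← hY L ⟨hL, le_rfl⟩, hYL]

theorem IsDirichletSol.eq_integral {L : ℝ} {p q : ℝ → ℝ} (cp : Continuous p)
    (cq : Continuous q) {μ : ℂ} {y z : ℝ → ℂ} (h : IsDirichletSol L p q μ y z) :
    ∀ s ∈ Icc 0 L, y s = ∫ r in (0 : ℝ)..s,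
      (z 0 + ∫ t in (0 : ℝ)..r, (2 * μ * p t + q t - μ ^ 2) * y t) := by
  intro s hs
  have cy := h.continuous_y
  have h1 := intervalIntegral.integral_eq_sub_of_hasDerivAt (a := 0) (b := s)
    (fun t _ => h.deriv_y t) (h.cont_z.intervalIntegrable _ _)
  rw [h.zero_left, sub_zero] at h1
  rw [← h1]
  refine intervalIntegral.integral_congr fun r hr => ?_
  rw [uIcc_of_le hs.1] at hr
  have h2 := intervalIntegral.integral_eq_sub_of_hasDerivAt (a := 0) (b := r)
    (fun t ht => h.deriv_z t (by
      rw [uIcc_of_le hr.1] at ht; exact ⟨ht.1, ht.2.trans (hr.2.trans hs.2)⟩))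
    (Continuous.intervalIntegrable (by fun_prop) _ _)
  simp only [h2]
  ring

theorem integral_exp_mul_le {κ s : ℝ} (hκ : 0 < κ) :
    ∫ t in (0 : ℝ)..s, Real.exp (κ * t) ≤ Real.exp (κ * s) / κ := by
  rw [intervalIntegral.integral_comp_mul_left (fun x => Real.exp x) hκ.ne', integral_exp,
    mul_zero, Real.exp_zero, smul_eq_mul, ← div_eq_inv_mul]
  gcongr
  linarith

theorem norm_integral_le_exp {κ s C : ℝ} (hκ : 0 < κ) (hs : 0 ≤ s) (hC : 0 ≤ C) {g : ℝ → ℂ}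
    (hg : ∀ t ∈ Icc 0 s, ‖g t‖ ≤ C * Real.exp (κ * t)) :
    ‖∫ t in (0 : ℝ)..s, g t‖ ≤ C / κ * Real.exp (κ * s) := by
  refine (intervalIntegral.norm_integral_le_of_norm_le hs
    (g := fun t => C * Real.exp (κ * t)) (Eventually.of_forall fun t ht =>
      hg t (Ioc_subset_Icc_self ht)) (Continuous.intervalIntegrable (by fun_prop) _ _)).trans ?_
  rw [intervalIntegral.integral_const_mul, div_mul_eq_mul_div, mul_div_assoc]
  exact mul_le_mul_of_nonneg_left (integral_exp_mul_le hκ) hC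

/-- The twofold Volterra integration, conjugated by `exp (κ s)`; its norm is at most `1 / κ²`. -/
theorem exists_volterra {L κ : ℝ} (hL : 0 ≤ L) (hκ : 0 < κ) :
    ∃ T : C(Icc (0 : ℝ) L, ℂ) →L[ℂ] C(Icc (0 : ℝ) L, ℂ), ‖T‖ ≤ 1 / κ ^ 2 ∧
      ∀ w s, T w s = Real.exp (-(κ * s)) * ∫ r in (0 : ℝ)..s, ∫ t in (0 : ℝ)..r,
        (Real.exp (κ * t) : ℂ) * w (projIcc 0 L hL t) := by
  have cg : ∀ w : C(Icc (0 : ℝ) L, ℂ),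
      Continuous fun t => (Real.exp (κ * t) : ℂ) * w (projIcc 0 L hL t) := fun w => by
    have := continuous_projIcc (h := hL)
    fun_prop
  have cG := fun w => continuous_integral_of_continuous (cg w) 0
  have cH := fun w => continuous_integral_of_continuous (cG w) 0
  let T : C(Icc (0 : ℝ) L, ℂ) →ₗ[ℂ] C(Icc (0 : ℝ) L, ℂ) :=
    { toFun := fun w => ⟨fun s => Real.exp (-(κ * s)) * ∫ r in (0 : ℝ)..s, ∫ t in (0 : ℝ)..r,
        (Real.exp (κ * t) : ℂ) * w (projIcc 0 L hL t), by have := cH w; fun_prop⟩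
      map_add' := fun v w => by
        ext s
        simp only [ContinuousMap.coe_mk, ContinuousMap.add_apply, mul_add]
        rw [← mul_add, ← intervalIntegral.integral_add ((cG v).intervalIntegrable _ _)
          ((cG w).intervalIntegrable _ _)]
        congr 1
        exact intervalIntegral.integral_congr fun r _ => intervalIntegral.integral_add
          ((cg v).intervalIntegrable 0 r) ((cg w).intervalIntegrable 0 r)
      map_smul' := fun c w => by
        ext s
        simp only [ContinuousMap.coe_mk, ContinuousMap.smul_apply, smul_eq_mul, RingHom.id_apply,
          mul_left_comm _ c, intervalIntegral.integral_const_mul] }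
  refine ⟨T.mkContinuous (1 / κ ^ 2) fun w => ?_, T.mkContinuous_norm_le (by positivity) _,
    fun w s => rfl⟩
  rw [ContinuousMap.norm_le _ (by positivity)]
  intro s
  have h1 : ∀ r : ℝ, 0 ≤ r → ‖∫ t in (0 : ℝ)..r, (Real.exp (κ * t) : ℂ) * w (projIcc 0 L hL t)‖ ≤
      ‖w‖ / κ * Real.exp (κ * r) := fun r hr =>
    norm_integral_le_exp hκ hr (norm_nonneg _) fun t _ => by
      rw [norm_mul, Complex.norm_real, Real.norm_of_nonneg (Real.exp_pos _).le, mul_comm]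
      gcongr
      exact w.norm_coe_le_norm _
  have h2 := norm_integral_le_exp hκ s.2.1 (C := ‖w‖ / κ) (by positivity)
    fun r hr => h1 r hr.1
  change ‖(Real.exp (-(κ * s)) : ℂ) * _‖ ≤ _
  rw [norm_mul, Complex.norm_real, Real.norm_of_nonneg (Real.exp_pos _).le]
  refine (mul_le_mul_of_nonneg_left h2 (Real.exp_pos _).le).trans (le_of_eq ?_)
  have : Real.exp (-(κ * s)) * Real.exp (κ * s) = 1 := by rw [← Real.exp_add]; simp
  calc _ = ‖w‖ / κ / κ * (Real.exp (-(κ * s)) * Real.exp (κ * s)) := by ring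
    _ = _ := by rw [this]; field_simp

/-- The solution of a linear fixed point equation depends analytically on the coefficient. -/
theorem exists_differentiableOn_solution {E : Type*} [NormedRing E] [NormedAlgebra ℂ E]
    [CompleteSpace E] (T : E →L[ℂ] E) {K : ℂ → E} (hK : Differentiable ℂ K) {U : Set ℂ}
    (hTK : ∀ μ ∈ U, ‖T‖ * ‖K μ‖ < 1) (u : E) :
    ∃ v : ℂ → E, DifferentiableOn ℂ v U ∧ ∀ μ ∈ U, ∀ w, w - T (K μ * w) = u ↔ w = v μ := by
  let S : ℂ → (E →L[ℂ] E) := fun μ =>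
    ((ContinuousLinearMap.compL ℂ E E E T).comp (ContinuousLinearMap.mul ℂ E)) (K μ)
  have hSd : Differentiable ℂ S := fun μ =>
    (ContinuousLinearMap.differentiableAt _).comp μ (hK μ)
  have hSn : ∀ μ ∈ U, ‖S μ‖ < 1 := by
    intro μ hμ
    refine lt_of_le_of_lt (ContinuousLinearMap.opNorm_le_bound _ (by positivity) fun v => ?_)
      (hTK μ hμ)
    refine (T.le_opNorm (K μ * v)).trans ?_
    rw [mul_assoc]
    exact mul_le_mul_of_nonneg_left (norm_mul_le _ _) (norm_nonneg _)
  -- The Neumann series inverts `1 - S μ`, and inversion is differentiable on the units of the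
  -- Banach algebra of operators.
  have hunit : ∀ μ ∈ U, IsUnit (1 - S μ) := fun μ hμ =>
    isUnit_one_sub_of_norm_lt_one (hSn μ hμ)
  refine ⟨fun μ => Ring.inverse (1 - S μ) u, fun μ hμ => ?_, fun μ hμ w => ⟨fun h => ?_, ?_⟩⟩
  · have hi : DifferentiableAt ℂ Ring.inverse (1 - S μ) := differentiableAt_inverse (hunit μ hμ)
    have hc : DifferentiableAt ℂ (fun μ => 1 - S μ) μ := (hSd μ).const_sub 1
    exact ((hi.comp μ hc).clm_apply (differentiableAt_const u)).differentiableWithinAt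
  · have : (1 - S μ) w = u := h
    change w = Ring.inverse (1 - S μ) u
    rw [← this]
    exact (congrArg (fun f : E →L[ℂ] E => f w) (Ring.inverse_mul_cancel _ (hunit μ hμ))).symm
  · rintro rfl
    exact congrArg (fun f : E →L[ℂ] E => f u) (Ring.mul_inverse_cancel _ (hunit μ hμ))

section

variable {L M : ℝ} {p q : ℝ → ℝ}

/-- The characteristic function of the boundary value problem on a disc. -/
theorem exists_characteristic (hL : 0 ≤ L) (cp : Continuous p) (cq : Continuous q) (R : ℝ) :
    ∃ D : ℂ → ℂ, DifferentiableOn ℂ D (Metric.ball 0 R) ∧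
      ∀ μ ∈ Metric.ball (0 : ℂ) R, D μ = 0 ↔ ∃ y z, IsDirichletSol L p q μ y z := by
  let P : C(Icc (0 : ℝ) L, ℂ) := ⟨fun s => (p s : ℂ), by fun_prop⟩
  let Qq : C(Icc (0 : ℝ) L, ℂ) := ⟨fun s => (q s : ℂ), by fun_prop⟩
  let K : ℂ → C(Icc (0 : ℝ) L, ℂ) := fun μ => (2 * μ) • P + Qq - μ ^ 2 • 1
  have hKd : Differentiable ℂ K := by
    intro μ
    have h1 : DifferentiableAt ℂ (fun μ : ℂ => (2 * μ) • P) μ :=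
      DifferentiableAt.smul_const (by fun_prop) P
    have h2 : DifferentiableAt ℂ (fun μ : ℂ => μ ^ 2 • (1 : C(Icc (0 : ℝ) L, ℂ))) μ :=
      DifferentiableAt.smul_const (by fun_prop) _
    exact (h1.add_const Qq).sub h2
  obtain ⟨B, hB⟩ : ∃ B, ∀ μ ∈ Metric.ball (0 : ℂ) R, ‖K μ‖ ≤ B := by
    obtain ⟨B, hB⟩ := (isCompact_closedBall (0 : ℂ) R).exists_bound_of_continuousOn
      hKd.continuous.continuousOn
    exact ⟨B, fun μ hμ => hB μ (Metric.ball_subset_closedBall hμ)⟩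
  -- Chosen so that `κ² > B`: the Volterra operator, of norm at most `1 / κ²` in the weighted form,
  -- then makes the fixed point equation a contraction on the whole disc.
  set κ : ℝ := |B| + 1 with hκdef
  have hκ : 0 < κ := by positivity
  obtain ⟨T, hT, hTv⟩ := exists_volterra hL hκ
  have hTK : ∀ μ ∈ Metric.ball (0 : ℂ) R, ‖T‖ * ‖K μ‖ < 1 := by
    intro μ hμ
    have hB' := hB μ hμ
    refine (mul_le_mul hT hB' (norm_nonneg _) (by positivity)).trans_lt ?_
    rw [one_div, ← div_eq_inv_mul, div_lt_one (by positivity)]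
    have := le_abs_self B
    have := abs_nonneg B
    nlinarith
  -- The solution with `Y 0 = 0` and initial slope `1` satisfies `Y = s + ∬ K Y`; `u₀` is the
  -- inhomogeneous term after conjugation by the weight. The characteristic function is the value at
  -- `L` of the weighted solution.
  let u₀ : C(Icc (0 : ℝ) L, ℂ) := ⟨fun s => Real.exp (-(κ * s)) * (s : ℝ), by fun_prop⟩
  obtain ⟨v, hvd, hv⟩ := exists_differentiableOn_solution T hKd hTK u₀
  have hee : ∀ s : ℝ, (Real.exp (-(κ * s)) : ℂ) * Real.exp (κ * s) = 1 := fun s => by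
    rw [← Complex.ofReal_mul, ← Real.exp_add]; simp
  have hKv : ∀ μ, ∀ t ∈ Icc 0 L, K μ (projIcc 0 L hL t) = 2 * μ * p t + q t - μ ^ 2 := by
    intro μ t ht
    rw [projIcc_of_mem hL ht]
    simp [K, P, Qq]
  have hval : ∀ μ, ∀ Y : ℝ → ℂ, Continuous Y → ∀ w : C(Icc (0 : ℝ) L, ℂ),
      (∀ t ∈ Icc 0 L, Y t = Real.exp (κ * t) * w (projIcc 0 L hL t)) →
      (w - T (K μ * w) = u₀ ↔ ∀ s ∈ Icc 0 L, Y s = ∫ r in (0 : ℝ)..s,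
      (1 + ∫ t in (0 : ℝ)..r, (2 * μ * p t + q t - μ ^ 2) * Y t)) := by
    intro μ Y cY w hw
    have hint : ∀ s ∈ Icc 0 L, (∫ r in (0 : ℝ)..s,
        (1 + ∫ t in (0 : ℝ)..r, (2 * μ * p t + q t - μ ^ 2) * Y t)) =
        s + Real.exp (κ * s) * T (K μ * w) (projIcc 0 L hL s) := by
      intro s hs
      rw [hTv, ← mul_assoc, mul_comm (Real.exp (κ * s) : ℂ), projIcc_of_mem hL hs, hee,
        one_mul, intervalIntegral.integral_add (by simp)
        ((continuous_integral_of_continuous (by fun_prop) 0).intervalIntegrable _ _)]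
      congr 1
      · simp
      · refine intervalIntegral.integral_congr fun r hr => ?_
        rw [uIcc_of_le hs.1] at hr
        refine intervalIntegral.integral_congr fun t ht => ?_
        rw [uIcc_of_le hr.1] at ht
        have htL : t ∈ Icc 0 L := ⟨ht.1, ht.2.trans (hr.2.trans hs.2)⟩
        simp only [ContinuousMap.mul_apply]
        rw [hKv μ t htL, hw t htL]
        ring
    constructor
    · intro h s hs
      have h1 := congrArg (fun f => f (projIcc 0 L hL s)) h
      simp only [ContinuousMap.sub_apply] at h1
      rw [hint s hs, hw s hs]
      have h2 : u₀ (projIcc 0 L hL s) = Real.exp (-(κ * s)) * s := by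
        rw [projIcc_of_mem hL hs]; rfl
      rw [h2] at h1
      linear_combination (Real.exp (κ * s) : ℂ) * h1 + (s : ℂ) * hee s
    · intro h
      ext s
      have h1 := h s s.2
      rw [hint s s.2, hw s s.2, projIcc_val] at h1
      change w s - T (K μ * w) s = Real.exp (-(κ * s)) * (s : ℝ)
      linear_combination (Real.exp (-(κ * s)) : ℂ) * h1 - (w s - T (K μ * w) s) * hee s
  have hLL : L ∈ Icc 0 L := ⟨hL, le_rfl⟩
  refine ⟨fun μ => v μ ⟨L, hLL⟩, fun μ hμ => ?_,
    fun μ hμ => ⟨fun (h : v μ ⟨L, hLL⟩ = 0) => ?_, ?_⟩⟩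
  · exact (ContinuousLinearMap.differentiableAt
      (ContinuousMap.evalCLM ℂ (⟨L, hLL⟩ : Icc (0 : ℝ) L))).comp_differentiableWithinAt μ
      (hvd μ hμ)
  · have cY : Continuous fun t => (Real.exp (κ * t) : ℂ) * v μ (projIcc 0 L hL t) := by
      have := continuous_projIcc (h := hL)
      fun_prop
    obtain ⟨y, z, hyz, -⟩ := exists_isDirichletSol hL cp cq one_ne_zero cY
      ((hval μ _ cY (v μ) fun t _ => rfl).1 ((hv μ hμ _).2 rfl)) (by
        rw [projIcc_of_mem hL hLL, h, mul_zero])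
    exact ⟨y, z, hyz⟩
  · rintro ⟨y, z, h⟩
    have cy := h.continuous_y
    have hd := h.deriv_ne_zero
    let w : C(Icc (0 : ℝ) L, ℂ) := ⟨fun s => Real.exp (-(κ * s)) * ((z 0)⁻¹ * y s), by fun_prop⟩
    have hw : w = v μ := by
      refine (hv μ hμ w).1 ((hval μ (fun t => (z 0)⁻¹ * y t) (by fun_prop) w
        fun t ht => ?_).2 fun s hs => ?_)
      · rw [projIcc_of_mem hL ht]
        change _ = (Real.exp (κ * t) : ℂ) * (Real.exp (-(κ * t)) * ((z 0)⁻¹ * y t))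
        linear_combination (-((z 0)⁻¹ * y t)) * hee t
      · simp only [mul_left_comm _ (z 0)⁻¹]
        rw [h.eq_integral cp cq s hs, ← intervalIntegral.integral_const_mul]
        refine intervalIntegral.integral_congr fun r _ => ?_
        simp only [intervalIntegral.integral_const_mul]
        rw [mul_add, inv_mul_cancel₀ hd]
    change v μ ⟨L, hLL⟩ = 0
    rw [← hw]
    change (Real.exp (-(κ * L)) : ℂ) * ((z 0)⁻¹ * y L) = 0
    rw [h.zero_right]; simp

/-- Infinitely many zeros of the characteristic function in a disc would accumulate and force it to
vanish on a larger one. But `i (M + 1)`, which the radius `R'` is large enough to include, is not an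
eigenvalue. -/
theorem finite_eigenvalues (hL : 0 < L) (cp : Continuous p) (cq : Continuous q)
    (hq : ∀ s, |q s| ≤ M) (R : ℝ) :
    {μ : ℂ | ‖μ‖ ≤ R ∧ ∃ y z, IsDirichletSol L p q μ y z}.Finite := by
  have hM : 0 ≤ M := (abs_nonneg _).trans (hq 0)
  set R' := |R| + M + 2 with hR'
  obtain ⟨D, hD, hDz⟩ := exists_characteristic (L := L) hL.le cp cq R'
  by_contra hinf
  obtain ⟨μ₀, hμ₀, hacc⟩ := Set.Infinite.exists_accPt_of_subset_isCompact hinf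
    (isCompact_closedBall (0 : ℂ) R) fun μ hμ => by simpa using hμ.1
  have hsub : Metric.closedBall (0 : ℂ) R ⊆ Metric.ball 0 R' := by
    refine Metric.closedBall_subset_ball ?_
    have := le_abs_self R
    linarith
  rw [accPt_iff_frequently_nhdsNE] at hacc
  have hzero := (hD.analyticOnNhd Metric.isOpen_ball).eqOn_zero_of_preconnected_of_frequently_eq_zero
    (convex_ball (0 : ℂ) R').isPreconnected (hsub hμ₀) (hacc.mono fun μ hμ =>
      (hDz μ (hsub (by simpa using hμ.1))).2 hμ.2)
  have hmem : (((M + 1 : ℝ) : ℂ) * Complex.I) ∈ Metric.ball (0 : ℂ) R' := by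
    rw [mem_ball_zero_iff, norm_mul, Complex.norm_I, mul_one, Complex.norm_real,
      Real.norm_of_nonneg (by linarith)]
    have := abs_nonneg R
    linarith
  obtain ⟨y, z, hyz⟩ := (hDz _ hmem).1 (hzero hmem)
  have := hyz.im_eq_zero_of_lt_norm_sq hL hq (by
    rw [norm_mul, Complex.norm_I, mul_one, Complex.norm_real,
      Real.norm_of_nonneg (by linarith)]
    nlinarith)
  rw [Complex.im_ofReal_mul, Complex.I_im] at this
  linarith

/-- At an accumulation point of zeros both `y` and `y'` vanish, which the positive energy forbids.
-/
theorem IsDirichletSol.finite_zeros {μ : ℂ} {y z : ℝ → ℂ} (h : IsDirichletSol L p q μ y z)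
    (hp : ∀ s, |p s| ≤ M) (hq : ∀ s, |q s| ≤ M) : {s | s ∈ Icc 0 L ∧ y s = 0}.Finite := by
  by_contra hinf
  obtain ⟨s, hs, hacc⟩ := Set.Infinite.exists_accPt_of_subset_isCompact hinf
    (isCompact_Icc (a := 0) (b := L)) fun s hs => hs.1
  rw [accPt_iff_frequently_nhdsNE] at hacc
  have hfr : ∃ᶠ t in 𝓝[≠] s, y t = 0 := hacc.mono fun t ht => ht.2
  have hy : y s = 0 := by
    by_contra hne
    exact hfr ((h.continuous_y.continuousAt.eventually_ne hne).filter_mono nhdsWithin_le_nhds)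
  have hz : z s = 0 := by
    by_contra hne
    exact hfr ((h.deriv_y s).eventually_ne hne)
  have := h.energy_pos hp hq hs
  simp [hy, hz] at this

/-- Eigenspaces are one-dimensional: `z₁(0) y - z(0) y₁` has zero Cauchy data. Hence one
eigenfunction per eigenvalue accounts for all its nodes. -/
theorem IsDirichletSol.eq_zero_iff {μ : ℂ} {y z y₁ z₁ : ℝ → ℂ} (h : IsDirichletSol L p q μ y z)
    (h₁ : IsDirichletSol L p q μ y₁ z₁) (hp : ∀ s, |p s| ≤ M) (hq : ∀ s, |q s| ≤ M) {s : ℝ}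
    (hs : s ∈ Icc 0 L) (hy : y s = 0) : y₁ s = 0 := by
  have := eq_zero_of_initial_zero (y := fun s => z₁ 0 * y s - z 0 * y₁ s)
    (z := fun s => z₁ 0 * z s - z 0 * z₁ s) (K := fun s => 2 * μ * p s + q s - μ ^ 2)
    (fun s _ => ((h.deriv_y s).const_mul _).sub ((h₁.deriv_y s).const_mul _))
    (fun s hs => (((h.deriv_z s hs).const_mul _).sub ((h₁.deriv_z s hs).const_mul _)).congr_deriv
      (by ring)) (norm_potential_le hp hq μ) (by simp [h.zero_left, h₁.zero_left]) (by ring) hs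
  simpa [hy, h.deriv_ne_zero] using this

theorem finite_nodes (hL : 0 < L) (cp : Continuous p) (cq : Continuous q)
    (hp : ∀ s, |p s| ≤ M) (hq : ∀ s, |q s| ≤ M) (R : ℝ) :
    {s | s ∈ Icc 0 L ∧ ∃ μ y z, ‖μ‖ ≤ R ∧ IsDirichletSol L p q μ y z ∧ y s = 0}.Finite := by
  have hfin := finite_eigenvalues hL cp cq hq R
  choose! Y Z hYZ using fun μ (hμ : μ ∈ {μ : ℂ | ‖μ‖ ≤ R ∧ ∃ y z, IsDirichletSol L p q μ y z}) =>
    hμ.2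
  refine (hfin.biUnion fun μ hμ => (hYZ μ hμ).finite_zeros hp hq).subset ?_
  rintro s ⟨hs, μ, y, z, hμ, hyz, hys⟩
  have hmem : μ ∈ {μ : ℂ | ‖μ‖ ≤ R ∧ ∃ y z, IsDirichletSol L p q μ y z} := ⟨hμ, y, z, hyz⟩
  exact mem_biUnion hmem ⟨hs, hyz.eq_zero_iff (hYZ μ hmem) hp hq hs hys⟩

end

/-! ### Transfer of eigenfunctions and nodal points to the variable `s`. -/

theorem confInv_zero {α : ℝ} (hα : 0 < α) : confInv α 0 = 0 := by
  have := confInv_confVar hα (x := 0) ⟨le_rfl, Real.pi_pos.le⟩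
  rwa [confVar_zero hα] at this

theorem tendsto_confInv_zero {α : ℝ} (hα : 0 < α) : Tendsto (confInv α) (𝓝[>] 0) (𝓝[>] 0) := by
  refine tendsto_nhdsWithin_iff.2 ⟨?_, ?_⟩
  · have := (continuous_confInv hα).continuousAt (x := 0)
    rw [ContinuousAt, confInv_zero hα] at this
    exact this.mono_left nhdsWithin_le_nhds
  · filter_upwards [Ioo_mem_nhdsGT (confVar_pi_pos hα)] with s hs
    exact (confInv_mem_Ioo hα hs).1

theorem exists_bound_comp_confInv {α : ℝ} (hα : 0 < α) {f : ℝ → ℝ}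
    (hf : ContinuousOn f (Icc 0 Real.pi)) : ∃ C, ∀ s, |f (confInv α s)| ≤ C := by
  obtain ⟨C, hC⟩ := (isCompact_Icc (a := 0) (b := Real.pi)).exists_bound_of_continuousOn hf
  exact ⟨C, fun s => hC _ (confInv_mem_Icc s hα)⟩

/-- The differential equation is known only in the open interval, so it is integrated twice. The
resulting integral equation holds up to both ends and provides a solution differentiable there as
well. -/
theorem IsEigenfunction.exists_isDirichletSol {α : ℝ} (hα : 0 < α) {p q : ℝ → ℝ} {μ : ℂ}
    {y : ℝ → ℂ} (h : IsEigenfunction α p q μ y) (hp : ContinuousOn p (Icc 0 Real.pi))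
    (hq : ContinuousOn q (Icc 0 Real.pi)) :
    ∃ Y Z, IsDirichletSol (confVar α Real.pi) (fun s => p (confInv α s))
      (fun s => q (confInv α s)) μ Y Z ∧ ∀ x ∈ Icc 0 Real.pi, y x = Y (confVar α x) := by
  obtain ⟨cy, ⟨z, hz, hw⟩, hy0, hyπ, x₀, hx₀, hne⟩ := h
  set L := confVar α Real.pi with hLdef
  have hL : 0 < L := confVar_pi_pos hα
  have cP := continuous_comp_confInv hα hp
  have cQ := continuous_comp_confInv hα hq
  have cY := continuous_comp_confInv hα cy
  set K : ℝ → ℂ := fun s => 2 * μ * p (confInv α s) + q (confInv α s) - μ ^ 2 with hK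
  have cK : Continuous fun t => K t * y (confInv α t) :=
    (((continuous_const.mul (Complex.continuous_ofReal.comp cP)).add
      (Complex.continuous_ofReal.comp cQ)).sub continuous_const).mul cY
  have cZ := (continuous_integral_of_continuous cK 0).const_add (z 0)
  have hzd : ∀ s ∈ Ioo 0 L, HasDerivAt (fun s => z (confInv α s)) (K s * y (confInv α s)) s := by
    intro s hs
    obtain ⟨w, hw1, hw2⟩ := hw _ (confInv_mem_Ioo hα hs)
    refine (hw1.comp_confInv hα hs).congr_deriv ?_
    simp only [hK]
    linear_combination -hw2
  -- This is where the convention that `D^α y(0)` is the limit from the right is used.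
  have hz0 : ContinuousWithinAt (fun s => z (confInv α s)) (Ici 0) 0 := by
    rw [← continuousWithinAt_Ioi_iff_Ici, ContinuousWithinAt, confInv_zero hα]
    exact hz.2.comp (tendsto_confInv_zero hα)
  have hzeq : ∀ s ∈ Ioo 0 L, z (confInv α s) =
      z 0 + ∫ t in (0 : ℝ)..s, K t * y (confInv α t) := by
    intro s hs
    have := eq_zero_of_hasDerivAt_zero (a := 0) (b := s) (f := fun s => z (confInv α s) -
      (z 0 + ∫ t in (0 : ℝ)..s, K t * y (confInv α t))) ?_ ?_ ?_ s ⟨hs.1.le, le_rfl⟩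
    · exact sub_eq_zero.1 this
    · refine ContinuousOn.sub (fun t ht => ?_) cZ.continuousOn
      rcases eq_or_lt_of_le ht.1 with h0 | h0
      · rw [← h0]; exact hz0.mono Icc_subset_Ici_self
      · exact (hzd t ⟨h0, ht.2.trans_lt hs.2⟩).continuousAt.continuousWithinAt
    · intro t ht
      have := (hzd t ⟨ht.1, ht.2.trans hs.2⟩).sub
        ((hasDerivAt_integral_of_continuous cK 0 t).const_add (z 0))
      rwa [sub_self] at this
    · simp [confInv_zero hα]
  have hYeq : ∀ s ∈ Icc 0 L, y (confInv α s) = ∫ r in (0 : ℝ)..s,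
      (z 0 + ∫ t in (0 : ℝ)..r, K t * y (confInv α t)) := by
    intro s hs
    have := eq_zero_of_hasDerivAt_zero (a := 0) (b := L) (f := fun s => y (confInv α s) -
      ∫ r in (0 : ℝ)..s, (z 0 + ∫ t in (0 : ℝ)..r, K t * y (confInv α t))) ?_ ?_ ?_ s hs
    · exact sub_eq_zero.1 this
    · exact (cY.sub (continuous_integral_of_continuous cZ 0)).continuousOn
    · intro t ht
      have := ((hz.1 _ (Ioo_subset_Ioc_self (confInv_mem_Ioo hα ht))).comp_confInv hα ht).sub
        (hasDerivAt_integral_of_continuous cZ 0 t)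
      rwa [hzeq t ht, sub_self] at this
    · simp [confInv_zero hα, hy0]
  have hd : z 0 ≠ 0 := by
    intro h0
    obtain ⟨C, hC⟩ := exists_bound_comp_confInv hα hp
    obtain ⟨C', hC'⟩ := exists_bound_comp_confInv hα hq
    have := eq_zero_of_initial_zero (L := L) (K := K)
      (y := fun s => ∫ r in (0 : ℝ)..s, (z 0 + ∫ t in (0 : ℝ)..r, K t * y (confInv α t)))
      (z := fun s => z 0 + ∫ t in (0 : ℝ)..s, K t * y (confInv α t))
      (fun s _ => hasDerivAt_integral_of_continuous cZ 0 s)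
      (fun s hs => by
        rw [← hYeq s hs]
        exact (hasDerivAt_integral_of_continuous cK 0 s).const_add _)
      (norm_potential_le (M := max C C') (fun s => (hC s).trans (le_max_left _ _))
        (fun s => (hC' s).trans (le_max_right _ _)) μ) (by simp) (by simp [h0])
      (confVar_mem_Icc hα hx₀)
    rw [← hYeq _ (confVar_mem_Icc hα hx₀), confInv_confVar hα hx₀] at this
    exact hne this
  obtain ⟨Y, Z, hYZ, -, hYY⟩ := _root_.exists_isDirichletSol hL.le cP cQ hd cY hYeq (by
    rw [hLdef, confInv_confVar hα ⟨Real.pi_pos.le, le_rfl⟩, hyπ])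
  refine ⟨Y, Z, hYZ, fun x hx => ?_⟩
  rw [hYY _ (confVar_mem_Icc hα hx), confInv_confVar hα hx]

section admissible

variable {α : ℝ} {p dp q : ℝ → ℝ}

theorem MemConfSobolev.continuousOn {f : ℝ → ℝ} (h : MemConfSobolev α f) :
    ContinuousOn f (Icc 0 Real.pi) := by
  have := h.1.continuousOn
  rwa [uIcc_of_le Real.pi_pos.le] at this

/-- A common bound for the coefficients in the variable `s`. -/
structure IsCoeffBound (α : ℝ) (p dp q : ℝ → ℝ) (M : ℝ) : Prop where
  bound_p : ∀ s, |p (confInv α s)| ≤ M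
  bound_dp : ∀ s, |dp (confInv α s)| ≤ M
  bound_q : ∀ s, |q (confInv α s)| ≤ M
  bound_V : ∀ s, |q (confInv α s) + p (confInv α s) ^ 2| ≤ M

theorem IsCoeffBound.mono {M M' : ℝ} (h : IsCoeffBound α p dp q M) (hM : M ≤ M') :
    IsCoeffBound α p dp q M' :=
  ⟨fun s => (h.1 s).trans hM, fun s => (h.2 s).trans hM, fun s => (h.3 s).trans hM,
    fun s => (h.4 s).trans hM⟩

theorem IsAdmissible.exists_coeffBound (hα : 0 < α) (h : IsAdmissible α p dp q) :
    ∃ M, IsCoeffBound α p dp q M := by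
  have cp := h.sobolev_p.continuousOn
  have cdp := h.sobolev_dp.continuousOn
  have cq := h.sobolev_q.continuousOn
  obtain ⟨C1, h1⟩ := exists_bound_comp_confInv hα cp
  obtain ⟨C2, h2⟩ := exists_bound_comp_confInv hα cdp
  obtain ⟨C3, h3⟩ := exists_bound_comp_confInv hα cq
  obtain ⟨C4, h4⟩ := exists_bound_comp_confInv hα (cq.add (cp.pow 2))
  refine ⟨max (max C1 C2) (max C3 C4), fun s => (h1 s).trans ?_, fun s => (h2 s).trans ?_,
    fun s => (h3 s).trans ?_, fun s => (h4 s).trans ?_⟩ <;> simp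

/-- The unit of frequency `ω = α π ^ (1 - α)` equals `π / L`, so `a = n ω` satisfies `a L = n π`. -/
theorem confVar_pi_mul (hα : 0 < α) :
    α * Real.pi ^ (1 - α) * confVar α Real.pi = Real.pi := by
  unfold confVar
  have : Real.pi ^ (1 - α) * Real.pi ^ α = Real.pi := by
    rw [← Real.rpow_add Real.pi_pos, sub_add_cancel, Real.rpow_one]
  field_simp
  exact this

theorem leading_pos (hα : 0 < α) : 0 < α * Real.pi ^ (1 - α) :=
  mul_pos hα (Real.rpow_pos_of_pos Real.pi_pos _)

theorem abs_re_sub_eigenIndex_le (hα : 0 < α) (μ : ℂ) :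
    |μ.re - eigenIndex α μ * (α * Real.pi ^ (1 - α))| ≤ α * Real.pi ^ (1 - α) / 2 := by
  have hω := leading_pos hα
  have h1 := abs_sub_round (μ.re / (α * Real.pi ^ (1 - α)))
  unfold eigenIndex
  set ω := α * Real.pi ^ (1 - α)
  have : μ.re - round (μ.re / ω) * ω = (μ.re / ω - round (μ.re / ω)) * ω := by
    field_simp
  rw [this, abs_mul, abs_of_pos hω]
  nlinarith

theorem ncard_confVar (hα : 0 < α) {y Y : ℝ → ℂ} {x : ℝ} (hx : x ∈ Icc 0 Real.pi)
    (hY : ∀ x ∈ Icc 0 Real.pi, y x = Y (confVar α x)) :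
    {t | t ∈ Ioc 0 (confVar α x) ∧ Y t = 0}.ncard = {t | t ∈ Ioc 0 x ∧ y t = 0}.ncard := by
  have hm := confVar_strictMonoOn hα
  have hsub : ∀ t ∈ Ioc 0 x, t ∈ Icc 0 Real.pi := fun t ht => ⟨ht.1.le, ht.2.trans hx.2⟩
  have : {t | t ∈ Ioc 0 (confVar α x) ∧ Y t = 0} =
      confVar α '' {t | t ∈ Ioc 0 x ∧ y t = 0} := by
    ext s
    constructor
    · rintro ⟨hs, hYs⟩
      have hsL : s ∈ Icc 0 (confVar α Real.pi) :=
        ⟨hs.1.le, hs.2.trans (confVar_mem_Icc hα hx).2⟩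
      have hi := confInv_mem_Icc s hα
      have he := confVar_confInv hα hsL
      refine ⟨confInv α s, ⟨⟨lt_of_le_of_ne hi.1 fun h0 => ?_, ?_⟩, ?_⟩, he⟩
      · rw [← h0, confVar_zero hα] at he; exact hs.1.ne he
      · rw [← he] at hs
        exact (hm.le_iff_le hi.1 hx.1).1 hs.2
      · rw [hY _ hi, he, hYs]
    · rintro ⟨t, ⟨ht, hyt⟩, rfl⟩
      refine ⟨⟨?_, hm.monotoneOn ht.1.le hx.1 ht.2⟩, by rw [← hY t (hsub t ht), hyt]⟩
      rw [← confVar_zero hα]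
      exact hm (mem_Ici.2 le_rfl) ht.1.le ht.1
  rw [this, InjOn.ncard_image (hm.injOn.mono fun t ht => ht.1.1.le)]

/-- Nodal points of large index are the points where a Prüfer angle takes the value `j π`. -/
theorem exists_phase_of_mem_nodalPoints (hα : 0 < α) (h : IsAdmissible α p dp q) {M : ℝ}
    (hM : IsCoeffBound α p dp q M) : ∃ N : ℝ, ∀ s ∈ nodalPoints α p q, N ≤ |(s.1 : ℝ)| →
      ∃ lam θ, IsPhaseWith (confVar α Real.pi) M (fun t => p (confInv α t))
        (fun t => dp (confInv α t)) (fun t => q (confInv α t) + p (confInv α t) ^ 2) lam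
        (s.1 * (α * Real.pi ^ (1 - α))) θ ∧ θ (confVar α s.2.2) = Real.pi * s.2.1 := by
  have cp := continuous_comp_confInv hα h.sobolev_p.continuousOn
  have cdp := continuous_comp_confInv hα h.sobolev_dp.continuousOn
  have cq := continuous_comp_confInv hα h.sobolev_q.continuousOn
  have hω := leading_pos hα
  have hωL := confVar_pi_mul hα
  set ω := α * Real.pi ^ (1 - α) with hωdef
  have hL : 0 < confVar α Real.pi := confVar_pi_pos hα
  have hM0 : 0 ≤ M := (abs_nonneg _).trans (hM.bound_p 0)
  have hpi := Real.pi_pos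
  have hint : ∫ t in (0 : ℝ)..confVar α Real.pi, p (confInv α t) = 0 := by
    rw [← confInt_eq hα h.sobolev_p.continuousOn ⟨hpi.le, le_rfl⟩]
    exact h.int_eq_zero
  have hpd : ∀ s ∈ Ioo 0 (confVar α Real.pi),
      HasDerivAt (fun t => p (confInv α t)) (dp (confInv α s)) s := fun s hs =>
    (h.confDeriv_p.1 _ (Ioo_subset_Ioc_self (confInv_mem_Ioo hα hs))).comp_confInv hα hs
  set L := confVar α Real.pi with hLdef
  -- The summands meet the requirements of `IsPhaseWith`, the smallness of the remainder at `L` and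
  -- the exclusion of index `0`; the final `1` absorbs the rounding error `ω / 2` between `n ω` and
  -- `Re μ`.
  refine ⟨(4 * M + 4 + 3 * M * L / Real.pi + Real.pi / L) / ω + 1, ?_⟩
  rintro ⟨n, j, x⟩ ⟨μ, y, hy, hn, hx, hyx, hj⟩ hN
  simp only at hn hx hyx hj hN ⊢
  obtain ⟨Y, Z, hYZ, hyY⟩ := hy.exists_isDirichletSol hα h.sobolev_p.continuousOn
    h.sobolev_q.continuousOn
  have hB : 4 * M + 4 + 3 * M * L / Real.pi + Real.pi / L + ω ≤ |n * ω| := by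
    rw [abs_mul, abs_of_pos hω]
    rw [← le_sub_iff_add_le, div_le_iff₀ hω] at hN
    linarith
  have hre : 4 * M + 4 + 3 * M * L / Real.pi + Real.pi / L ≤ |μ.re| := by
    have h1 := abs_re_sub_eigenIndex_le hα μ
    rw [← hn, ← hωdef] at h1
    have h2 := abs_sub_abs_le_abs_sub (n * ω) (n * ω - μ.re)
    rw [sub_sub_cancel, abs_sub_comm (n * ω)] at h2
    linarith
  have e1 : 0 ≤ 3 * M * L / Real.pi := by positivity
  have e2 : 0 ≤ Real.pi / L := by positivity
  have hidx : round (μ.re * L / Real.pi) = n := by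
    rw [hn, eigenIndex, ← hωdef, ← hωL]
    congr 1
    field_simp
  obtain ⟨θ, -, hθ, hθx⟩ := hYZ.exists_phase (dp := fun t => dp (confInv α t)) hL cp cdp cq hpd
    hM.bound_p hM.bound_dp hM.bound_V hM.bound_q (by linarith) hint
    (by
      rw [div_lt_iff₀ (by linarith), ← div_lt_iff₀' hpi]
      linarith)
    (by
      rw [← div_le_iff₀ hL]
      linarith)
  rw [hidx] at hθ hθx
  refine ⟨μ.re, θ, ⟨hL, cp, cdp, cq.add (cp.pow 2), hM.bound_p, hM.bound_dp, hM.bound_V, hint,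
    hθ.cont, hθ.eq, ?_, by linarith, by linarith⟩, ?_⟩
  · rw [hθ.right, mul_assoc, hωL]
  · have hxI := Ioo_subset_Icc_self hx
    rw [hθx _ (confVar_mem_Icc hα hxI) (by rw [← hyY x hxI, hyx]), hj,
      ncard_confVar hα hxI hyY]

theorem finite_nodalPoints (hα : 0 < α) (h : IsAdmissible α p dp q) (N : ℝ) :
    {x | ∃ n j : ℤ, (n, j, x) ∈ nodalPoints α p q ∧ |(n : ℝ)| < N}.Finite := by
  obtain ⟨M, hM⟩ := h.exists_coeffBound hα
  have hM0 : 0 ≤ M := (abs_nonneg _).trans (hM.bound_p 0)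
  have hω := leading_pos hα
  have hfin := finite_nodes (confVar_pi_pos hα)
    (continuous_comp_confInv hα h.sobolev_p.continuousOn)
    (continuous_comp_confInv hα h.sobolev_q.continuousOn) hM.bound_p hM.bound_q
    (M + 1 + (|N| + 1) * (α * Real.pi ^ (1 - α)))
  refine Finite.of_finite_image (f := confVar α) (hfin.subset ?_)
    ((confVar_strictMonoOn hα).injOn.mono ?_)
  · rintro _ ⟨x, ⟨n, j, ⟨μ, y, hy, hn, hx, hyx, hj⟩, hnN⟩, rfl⟩
    simp only at hn hx hyx hj
    have hxI := Ioo_subset_Icc_self hx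
    obtain ⟨Y, Z, hYZ, hyY⟩ := hy.exists_isDirichletSol hα h.sobolev_p.continuousOn
      h.sobolev_q.continuousOn
    refine ⟨confVar_mem_Icc hα hxI, μ, Y, Z, ?_, hYZ, by rw [← hyY x hxI, hyx]⟩
    -- A real eigenvalue is bounded through its index. A nonreal one may have any imaginary part as
    -- far as the index shows, but satisfies `|μ|² ≤ M`.
    by_cases him : μ.im = 0
    · have h1 := abs_re_sub_eigenIndex_le hα μ
      rw [← hn] at h1
      have h2 : ‖μ‖ = |μ.re| := by
        rw [← Real.norm_eq_abs, ← Complex.norm_real]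
        congr 1
        exact Complex.ext rfl him
      rw [h2]
      have h3 := abs_sub_abs_le_abs_sub μ.re (n * (α * Real.pi ^ (1 - α)))
      rw [abs_mul, abs_of_pos hω] at h3
      have h4 := hnN.le.trans (le_abs_self N)
      nlinarith [mul_le_mul_of_nonneg_right h4 hω.le]
    · have h1 : ‖μ‖ ^ 2 ≤ M := by
        by_contra hlt
        exact him (hYZ.im_eq_zero_of_lt_norm_sq (confVar_pi_pos hα) hM.bound_q (not_le.1 hlt))
      have h2 : 0 ≤ (|N| + 1) * (α * Real.pi ^ (1 - α)) := by positivity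
      nlinarith [sq_nonneg (‖μ‖ - 1), norm_nonneg μ]
  · rintro x ⟨n, j, ⟨μ, y, hy, hn, hx, hyx, hj⟩, hnN⟩
    exact hx.1.le

/-- Removing the finitely many nodes of index below `k` from a small interval around `x` leaves a
nonempty open set, which still meets the dense set of nodes. -/
theorem exists_isNodalSeq (hα : 0 < α) (h : IsAdmissible α p dp q) {X₀ : Set (ℤ × ℤ × ℝ)}
    (hX₀ : X₀ ⊆ nodalPoints α p q) (hdense : NodallyDense X₀) {x : ℝ}
    (hx : x ∈ Icc 0 Real.pi) : ∃ s, IsNodalSeq X₀ s x := by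
  have key : ∀ k : ℕ, ∃ t ∈ X₀, (k : ℝ) ≤ |(t.1 : ℝ)| ∧ |t.2.2 - x| < 1 / ((k : ℝ) + 1) := by
    intro k
    set F := {x | ∃ n j : ℤ, (n, j, x) ∈ nodalPoints α p q ∧ |(n : ℝ)| < k} with hF
    have hFfin : F.Finite := finite_nodalPoints hα h k
    set ε : ℝ := 1 / ((k : ℝ) + 1) with hε
    have hεpos : 0 < ε := by positivity
    have hlt : max 0 (x - ε) < min Real.pi (x + ε) := by
      have := Real.pi_pos
      have h1 := hx.1
      have h2 := hx.2
      rw [max_lt_iff, lt_min_iff, lt_min_iff]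
      refine ⟨⟨this, ?_⟩, ?_, ?_⟩ <;> linarith
    obtain ⟨u, hu, huF⟩ := ((Ioo_infinite hlt).sdiff hFfin).nonempty
    have huI : u ∈ Icc 0 Real.pi :=
      ⟨(le_max_left _ _).trans hu.1.le, hu.2.le.trans (min_le_left _ _)⟩
    have hopen : IsOpen (Ioo (max 0 (x - ε)) (min Real.pi (x + ε)) \ F) :=
      isOpen_Ioo.sdiff hFfin.isClosed
    obtain ⟨v, ⟨hv, hvF⟩, t, ht, rfl⟩ := mem_closure_iff.1 (hdense huI) _ hopen ⟨hu, huF⟩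
    refine ⟨t, ht, ?_, ?_⟩
    · by_contra hlt'
      exact hvF ⟨t.1, t.2.1, hX₀ ht, not_le.1 hlt'⟩
    · rw [abs_lt]
      have h1 := (le_max_right 0 (x - ε)).trans_lt hv.1
      have h2 := hv.2.trans_le (min_le_right Real.pi (x + ε))
      simp only at h1 h2
      constructor <;> linarith
  choose s hs hsn hsx using key
  refine ⟨s, hs, ?_, ?_⟩
  · refine tendsto_atTop_mono (fun k => ?_) tendsto_natCast_atTop_atTop
    exact_mod_cast hsn k
  · rw [tendsto_iff_dist_tendsto_zero]
    exact squeeze_zero (fun _ => dist_nonneg) (fun k => (hsx k).le)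
      tendsto_one_div_add_atTop_nhds_zero_nat

end admissible

/-! ### Limits of the nodal quantities, and the two recovery arguments. -/

section reconstruction

variable {α : ℝ} {p dp q : ℝ → ℝ}

/-- The potential `q + p²` in the variable `s`. -/
def confPotential (α : ℝ) (p q : ℝ → ℝ) (t : ℝ) : ℝ := q (confInv α t) + p (confInv α t) ^ 2

theorem confVar_div (hα : 0 < α) (x : ℝ) :
    confVar α x / confVar α Real.pi = x ^ α / Real.pi ^ α := by
  unfold confVar
  field_simp

theorem nodalShift_eq (hα : 0 < α) (s : ℤ × ℤ × ℝ) :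
    nodalShift α s = s.1 * (α * Real.pi ^ (1 - α)) * confVar α s.2.2 - Real.pi * s.2.1 := by
  have : Real.pi ^ (1 - α) * Real.pi ^ α = Real.pi := by
    rw [← Real.rpow_add Real.pi_pos, sub_add_cancel, Real.rpow_one]
  unfold nodalShift confVar
  field_simp
  linear_combination (-(s.2.1 : ℝ)) * this

theorem oscInt_eq (hα : 0 < α) (hp : ContinuousOn p (Icc 0 Real.pi))
    (hdp : ContinuousOn dp (Icc 0 Real.pi)) (hq : ContinuousOn q (Icc 0 Real.pi)) (n : ℤ) {x : ℝ}
    (hx : x ∈ Icc 0 Real.pi) : oscInt α p dp q (confInt α p) n x =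
      oscRem (fun t => p (confInv α t)) (fun t => dp (confInv α t)) (confPotential α p q)
        (n * (α * Real.pi ^ (1 - α))) (confVar α x) := by
  have hQ : ContinuousOn (confInt α p) (Icc 0 Real.pi) := by
    refine ContinuousOn.congr (f := fun x => ∫ s in (0 : ℝ)..confVar α x, p (confInv α s)) ?_
      fun x hx => confInt_eq hα hp hx
    exact ((continuous_integral_of_continuous (continuous_comp_confInv hα hp) 0).comp
      (continuous_confVar hα)).continuousOn
  have hpow : Continuous fun t : ℝ => t ^ α := Real.continuous_rpow_const hα.le
  have hang : ContinuousOn (fun t => 2 * (n : ℝ) * t ^ α / Real.pi ^ (α - 1) - 2 * confInt α p t)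
      (Icc 0 Real.pi) := by fun_prop
  have hval : ∀ u ∈ Icc 0 (confVar α x), 2 * (n : ℝ) * confInv α u ^ α / Real.pi ^ (α - 1) -
      2 * confInt α p (confInv α u) = 2 * (n * (α * Real.pi ^ (1 - α)) * u -
        ∫ t in (0 : ℝ)..u, p (confInv α t)) := by
    intro u hu
    have huL : u ∈ Icc 0 (confVar α Real.pi) := ⟨hu.1, hu.2.trans (confVar_mem_Icc hα hx).2⟩
    have h1 := confVar_confInv hα huL
    rw [confInt_eq hα hp (confInv_mem_Icc u hα), h1]
    have h2 : confInv α u ^ α = α * u := by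
      rw [confVar, div_eq_iff hα.ne'] at h1
      linarith
    have h3 : Real.pi ^ (1 - α) = (Real.pi ^ (α - 1))⁻¹ := by
      rw [← Real.rpow_neg Real.pi_pos.le, neg_sub]
    rw [h2, h3]
    ring
  have hx0 := (confVar_mem_Icc hα hx).1
  unfold oscInt oscRem confPotential
  have hcos := (hq.add (hp.pow 2)).mul (Real.continuous_cos.comp_continuousOn hang)
  have hsin := hdp.mul (Real.continuous_sin.comp_continuousOn hang)
  refine (congrArg₂ (· - ·) (confInt_eq hα hcos hx) (confInt_eq hα hsin hx)).trans ?_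
  congr 1
  · refine intervalIntegral.integral_congr fun u hu => ?_
    rw [uIcc_of_le hx0] at hu
    simp [hval u hu]
  · refine intervalIntegral.integral_congr fun u hu => ?_
    rw [uIcc_of_le hx0] at hu
    simp [hval u hu]

/-- Every shift `K' ≥ K` is allowed, so that two problems with common nodes can be compared along
the same tail. -/
theorem IsNodalSeq.exists_phases (hα : 0 < α) (h : IsAdmissible α p dp q) {M : ℝ}
    (hM : IsCoeffBound α p dp q M) {X₀ : Set (ℤ × ℤ × ℝ)} (hX₀ : X₀ ⊆ nodalPoints α p q)
    {s : ℕ → ℤ × ℤ × ℝ} {x : ℝ} (hs : IsNodalSeq X₀ s x) :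
    ∃ K : ℕ, ∀ K' ≥ K, ∃ (lam : ℕ → ℝ) (θ : ℕ → ℝ → ℝ),
      (∀ k, IsPhaseWith (confVar α Real.pi) M (fun t => p (confInv α t))
        (fun t => dp (confInv α t)) (confPotential α p q) (lam k)
        ((s (k + K')).1 * (α * Real.pi ^ (1 - α))) (θ k)) ∧
      ∀ k, θ k (confVar α (s (k + K')).2.2) = Real.pi * (s (k + K')).2.1 := by
  obtain ⟨N, hN⟩ := exists_phase_of_mem_nodalPoints hα h hM
  obtain ⟨K, hK⟩ := eventually_atTop.1 (hs.index.eventually_ge_atTop ⌈N⌉)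
  refine ⟨K, fun K' hK' => ?_⟩
  have key : ∀ k, N ≤ |((s (k + K')).1 : ℝ)| := fun k => by
    have h1 := hK (k + K') (by omega)
    have h2 : ((⌈N⌉ : ℤ) : ℝ) ≤ |((s (k + K')).1 : ℝ)| := by exact_mod_cast h1
    exact (Int.le_ceil N).trans h2
  choose lam θ h1 h2 using fun k => hN _ (hX₀ (hs.mem (k + K'))) (key k)
  exact ⟨lam, θ, h1, h2⟩

theorem IsNodalSeq.mem_Ioo {X₀ : Set (ℤ × ℤ × ℝ)} (hX₀ : X₀ ⊆ nodalPoints α p q)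
    {s : ℕ → ℤ × ℤ × ℝ} {x : ℝ} (hs : IsNodalSeq X₀ s x) (k : ℕ) :
    (s k).2.2 ∈ Ioo 0 Real.pi := by
  obtain ⟨μ, y, -, -, hx, -⟩ := hX₀ (hs.mem k)
  exact hx

theorem IsNodalSeq.tendsto_abs (hα : 0 < α) {X₀ : Set (ℤ × ℤ × ℝ)}
    {s : ℕ → ℤ × ℤ × ℝ} {x : ℝ} (hs : IsNodalSeq X₀ s x) (K : ℕ) :
    Tendsto (fun k => |((s (k + K)).1 : ℝ) * (α * Real.pi ^ (1 - α))|) atTop atTop := by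
  have hω := leading_pos hα
  simp only [abs_mul, abs_of_pos hω]
  refine Tendsto.atTop_mul_const hω ?_
  have h1 : Tendsto (fun k => |(s (k + K)).1|) atTop atTop :=
    hs.index.comp (tendsto_add_atTop_nat K)
  refine (tendsto_intCast_atTop_atTop.comp h1).congr fun k => ?_
  simp

theorem IsNodalSeq.tendsto_confVar (hα : 0 < α) {X₀ : Set (ℤ × ℤ × ℝ)}
    {s : ℕ → ℤ × ℤ × ℝ} {x : ℝ} (hs : IsNodalSeq X₀ s x) (K : ℕ) :
    Tendsto (fun k => confVar α (s (k + K)).2.2) atTop (𝓝 (confVar α x)) :=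
  ((continuous_confVar hα).tendsto x).comp (hs.lim.comp (tendsto_add_atTop_nat K))

section

variable (hα : 0 < α) (h : IsAdmissible α p dp q) {X₀ : Set (ℤ × ℤ × ℝ)}
  (hX₀ : X₀ ⊆ nodalPoints α p q) {s : ℕ → ℤ × ℤ × ℝ} {x : ℝ} (hx : x ∈ Icc 0 Real.pi)
  (hs : IsNodalSeq X₀ s x)
include hα h hX₀ hx hs

theorem tendsto_nodalShift :
    Tendsto (fun k => nodalShift α (s k)) atTop (𝓝 (confInt α p x)) := by
  obtain ⟨M, hM⟩ := h.exists_coeffBound hα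
  obtain ⟨K, hK⟩ := hs.exists_phases hα h hM hX₀
  obtain ⟨lam, θ, hph, hθ⟩ := hK K le_rfl
  rw [← tendsto_add_atTop_iff_nat K, confInt_eq hα h.sobolev_p.continuousOn hx]
  have := tendsto_phase_shift hph (hs.tendsto_abs hα K)
    (fun k => confVar_mem_Icc hα (Ioo_subset_Icc_self (hs.mem_Ioo hX₀ _)))
    (hs.tendsto_confVar hα K)
  exact this.congr fun k => by rw [nodalShift_eq hα, hθ]

theorem tendsto_nodalShift₁ :
    Tendsto (fun k => nodalShift₁ α (confInt α p) (s k)) atTop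
      (𝓝 (bridge (confVar α Real.pi) (confPotential α p q) (confVar α x))) := by
  obtain ⟨M, hM⟩ := h.exists_coeffBound hα
  obtain ⟨K, hK⟩ := hs.exists_phases hα h hM hX₀
  obtain ⟨lam, θ, hph, hθ⟩ := hK K le_rfl
  rw [← tendsto_add_atTop_iff_nat K]
  have := tendsto_phase_shift₁ hph (hs.tendsto_abs hα K)
    (fun k => confVar_mem_Icc hα (Ioo_subset_Icc_self (hs.mem_Ioo hX₀ _)))
    (confVar_mem_Icc hα hx) (hs.tendsto_confVar hα K)
  refine this.congr fun k => ?_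
  rw [nodalShift₁, nodalShift_eq hα, hθ,
    confInt_eq hα h.sobolev_p.continuousOn (Ioo_subset_Icc_self (hs.mem_Ioo hX₀ _))]
  ring

theorem tendsto_nodalShift₂ :
    Tendsto (fun k => nodalShift₂ α p dp q (confInt α p)
        (fun x => bridge (confVar α Real.pi) (confPotential α p q) (confVar α x)) (s k)) atTop
      (𝓝 (bridge (confVar α Real.pi) (fun t => confPotential α p q t * p (confInv α t))
        (confVar α x))) := by
  obtain ⟨M, hM⟩ := h.exists_coeffBound hα
  obtain ⟨K, hK⟩ := hs.exists_phases hα h hM hX₀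
  obtain ⟨lam, θ, hph, hθ⟩ := hK K le_rfl
  rw [← tendsto_add_atTop_iff_nat K]
  have cp := h.sobolev_p.continuousOn
  have cdp := h.sobolev_dp.continuousOn
  have cq := h.sobolev_q.continuousOn
  have := tendsto_phase_shift₂ hph (hs.tendsto_abs hα K)
    (fun k => confVar_mem_Icc hα (Ioo_subset_Icc_self (hs.mem_Ioo hX₀ _)))
    (confVar_mem_Icc hα hx) (hs.tendsto_confVar hα K)
  refine this.congr fun k => ?_
  have hk := Ioo_subset_Icc_self (hs.mem_Ioo hX₀ (k + K))
  rw [nodalShift₂, nodalShift₁, nodalShift_eq hα, hθ, confInt_eq hα cp hk,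
    oscInt_eq hα cp cdp cq _ hk, oscInt_eq hα cp cdp cq _ ⟨Real.pi_pos.le, le_rfl⟩,
    confVar_div hα]
  ring

/-- If the potentials of two admissible pairs with the same `p` differ by a constant `c`, and the
pairs share nodal points that converge to `x`, then `c = 0` or `∫₀ˣ p = 0`. -/
theorem mul_confInt_eq_zero_of_add_const {p₁ dp₁ q₁ : ℝ → ℝ} {c : ℝ}
    (h₁ : IsAdmissible α p₁ dp₁ q₁) (hX₁ : X₀ ⊆ nodalPoints α p₁ q₁)
    (hp₁ : ∀ x ∈ Icc 0 Real.pi, p₁ x = p x) (hdp₁ : ∀ x ∈ Icc 0 Real.pi, dp₁ x = dp x)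
    (hc : ∀ x ∈ Icc 0 Real.pi, q₁ x = q x + c) :
    c * confInt α p x = 0 := by
  obtain ⟨M, hM⟩ := h.exists_coeffBound hα
  obtain ⟨M₁, hM₁⟩ := h₁.exists_coeffBound hα
  obtain ⟨K, hK⟩ := hs.exists_phases hα h (hM.mono (le_max_left M M₁)) hX₀
  obtain ⟨K₁, hK₁⟩ := hs.exists_phases hα h₁ (hM₁.mono (le_max_right M M₁)) hX₁
  obtain ⟨lam, θ, hph, hθ⟩ := hK (max K K₁) (le_max_left _ _)
  obtain ⟨lam₁, θ₁, hph₁, hθ₁⟩ := hK₁ (max K K₁) (le_max_right _ _)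
  have cp := h.sobolev_p.continuousOn
  have ha := hs.tendsto_abs hα (max K K₁)
  have hsL : ∀ k, confVar α (s (k + max K K₁)).2.2 ∈ Icc 0 (confVar α Real.pi) :=
    fun k => confVar_mem_Icc hα (Ioo_subset_Icc_self (hs.mem_Ioo hX₀ _))
  have hxL := confVar_mem_Icc hα hx
  have hsx := hs.tendsto_confVar hα (max K K₁)
  set L := confVar α Real.pi with hLdef
  set P : ℝ → ℝ := fun t => p (confInv α t) with hP
  set V := confPotential α p q with hV
  have hL : 0 < L := confVar_pi_pos hα
  have hLL : L ∈ Icc 0 L := ⟨hL.le, le_rfl⟩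
  have hV₁ : confPotential α p₁ q₁ = fun t => V t + c := by
    ext t
    simp only [hV, confPotential, hc _ (confInv_mem_Icc t hα), hp₁ _ (confInv_mem_Icc t hα)]
    ring
  have cV := (hph 0).cont_V
  have cP := (hph 0).cont_p
  have cQ := (hph 0).continuous_int
  have hint := (hph 0).int_eq_zero
  simp only [hV₁, hp₁ _ (confInv_mem_Icc _ hα), hdp₁ _ (confInv_mem_Icc _ hα)] at hph₁
  have t1 := tendsto_phase_shift₂ hph ha hsL hxL hsx
  have t2 := tendsto_phase_shift₂ hph₁ ha hsL hxL hsx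
  have t3 := tendsto_mul_integral_cos_zero hph ha hsL hxL hsx fun k => by
    rw [hθ, mul_comm]; exact Real.sin_int_mul_pi _
  have t4 := tendsto_mul_integral_cos_zero hph ha (fun _ => hLL) hLL tendsto_const_nhds fun k => by
    rw [(hph k).right, mul_assoc, hLdef, confVar_pi_mul hα]; exact Real.sin_int_mul_pi _
  -- The second-order limit does not see `c`, because subtracting the linear interpolant removes
  -- constants in `V`. In the third order `c` survives in two places: in the oscillatory integrals
  -- and, since `∫ p = 0` over `[0, L]`, as `c Q` in the limit.
  have hb : ∀ u, bridge L (fun t => V t + c) u = bridge L V u := by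
    intro u
    unfold bridge
    rw [intervalIntegral.integral_add (cV.intervalIntegrable _ _) (by simp),
      intervalIntegral.integral_add (cV.intervalIntegrable _ _) (by simp),
      intervalIntegral.integral_const, intervalIntegral.integral_const]
    simp only [smul_eq_mul, sub_zero]
    field_simp
    ring
  have ho : ∀ a u, oscRem P (fun t => dp (confInv α t)) (fun t => V t + c) a u =
      oscRem P (fun t => dp (confInv α t)) V a u +
        c * ∫ t in (0 : ℝ)..u, Real.cos (2 * (a * t - ∫ r in (0 : ℝ)..t, P r)) := by
    intro a u
    unfold oscRem
    simp only [add_mul]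
    rw [intervalIntegral.integral_add (Continuous.intervalIntegrable (by fun_prop) _ _)
      (Continuous.intervalIntegrable (by fun_prop) _ _), intervalIntegral.integral_const_mul]
    ring
  have hg : bridge L (fun t => (V t + c) * P t) (confVar α x) =
      bridge L (fun t => V t * P t) (confVar α x) + c * confInt α p x := by
    unfold bridge
    simp only [add_mul]
    rw [intervalIntegral.integral_add (Continuous.intervalIntegrable (by fun_prop) _ _)
      (Continuous.intervalIntegrable (by fun_prop) _ _), intervalIntegral.integral_add
      (Continuous.intervalIntegrable (by fun_prop) _ _)
      (Continuous.intervalIntegrable (by fun_prop) _ _), intervalIntegral.integral_const_mul,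
      intervalIntegral.integral_const_mul, hint, confInt_eq hα cp hx]
    ring
  have t5 := (t3.const_mul c).sub (((hsx.div_const L).mul t4).const_mul c)
  rw [mul_zero, mul_zero, mul_zero, sub_zero] at t5
  have t6 := t2.sub t1
  rw [hg, add_sub_cancel_left] at t6
  -- Both angles equal `j π` at the common node, so the third-order expressions differ only by the
  -- oscillatory contribution of `c`. This tends to `0`, while the limits differ by `c Q(x)`.
  refine tendsto_nhds_unique t6 (t5.congr fun k => ?_)
  rw [hθ, hθ₁, hb, ho, ho]
  ring

end

theorem ContinuousOn.tendsto_nhdsGT_zero {f : ℝ → ℝ} (hf : ContinuousOn f (Icc 0 Real.pi)) :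
    Tendsto f (𝓝[>] 0) (𝓝 (f 0)) := by
  have h1 := hf 0 ⟨le_rfl, Real.pi_pos.le⟩
  exact h1.mono_left (nhdsWithin_le_of_mem (Icc_mem_nhdsGT Real.pi_pos))

theorem isConfDeriv_of_hasDerivAt (hα : 0 < α) {f g F : ℝ → ℝ}
    (hF : ∀ x ∈ Ioc 0 Real.pi, HasDerivAt F (g x) (confVar α x))
    (hf : ∀ x ∈ Icc 0 Real.pi, f x = F (confVar α x)) (hg : ContinuousOn g (Icc 0 Real.pi)) :
    IsConfDeriv α f g :=
  ⟨fun x hx => (hF x hx).hasConfDerivAt_of_eqOn hα hx hf, hg.tendsto_nhdsGT_zero⟩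

theorem IsConfDeriv.eqOn {f g f₁ g₁ : ℝ → ℝ} (h : IsConfDeriv α f g) (h₁ : IsConfDeriv α f₁ g₁)
    (hf : ∀ x ∈ Icc 0 Real.pi, f₁ x = f x) : ∀ x ∈ Icc 0 Real.pi, g₁ x = g x := by
  have key : ∀ x ∈ Ioc 0 Real.pi, g₁ x = g x := by
    intro x hx
    have hxI := Ioc_subset_Icc_self hx
    have e := ((hasConfDerivAt_iff hx).1 (h.1 x hx))
    have e₁ := ((hasConfDerivAt_iff hx).1 (h₁.1 x hx)).congr (fun t ht => (hf t ht).symm)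
      (hf x hxI).symm
    have := (uniqueDiffOn_Icc Real.pi_pos x hxI).eq_deriv _ e₁ e
    simpa [(Real.rpow_pos_of_pos hx.1 _).ne'] using this
  intro x hx
  rcases eq_or_lt_of_le hx.1 with h0 | h0
  · rw [← h0]
    refine tendsto_nhds_unique (h₁.2.congr' ?_) h.2
    filter_upwards [Ioc_mem_nhdsGT Real.pi_pos] with t ht using key t ht
  · exact key x ⟨h0, hx.2⟩

theorem confMean_add (hα : 0 < α) {f g : ℝ → ℝ} (hf : ContinuousOn f (Icc 0 Real.pi))
    (hg : ContinuousOn g (Icc 0 Real.pi)) :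
    confMean α (fun t => f t + g t) = confMean α f + confMean α g := by
  have hπ : Real.pi ∈ Icc 0 Real.pi := ⟨Real.pi_pos.le, le_rfl⟩
  unfold confMean
  rw [confInt_eq hα (f := fun t => f t + g t) (hf.add hg) hπ, confInt_eq hα hf hπ, confInt_eq hα hg hπ,
    intervalIntegral.integral_add ((continuous_comp_confInv hα hf).intervalIntegrable _ _)
      ((continuous_comp_confInv hα hg).intervalIntegrable _ _)]
  ring

theorem IsAdmissible.isConfDeriv_confInt (hα : 0 < α) (h : IsAdmissible α p dp q) :
    IsConfDeriv α (confInt α p) p := by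
  have cp := h.sobolev_p.continuousOn
  refine isConfDeriv_of_hasDerivAt hα (F := fun u => ∫ t in (0 : ℝ)..u, p (confInv α t))
    (fun x hx => ?_) (fun x hx => confInt_eq hα cp hx) cp
  have := hasDerivAt_integral_of_continuous (continuous_comp_confInv hα cp) 0 (confVar α x)
  rwa [confInv_confVar hα (Ioc_subset_Icc_self hx)] at this

/-- If `Q` vanished identically, so would `p = D^α Q`, and `p` would be constant. -/
theorem IsAdmissible.exists_confInt_ne_zero (hα : 0 < α) (h : IsAdmissible α p dp q) :
    ∃ x ∈ Icc 0 Real.pi, confInt α p x ≠ 0 := by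
  by_contra! hQ
  refine h.not_const ⟨0, ?_⟩
  have h0 : IsConfDeriv α (fun _ : ℝ => (0 : ℝ)) (fun _ => (0 : ℝ)) :=
    isConfDeriv_of_hasDerivAt hα (F := fun _ => 0) (fun x _ => hasDerivAt_const _ _)
      (fun _ _ => rfl) continuousOn_const
  exact h0.eqOn (h.isConfDeriv_confInt hα) hQ

theorem IsAdmissible.isConfDeriv_bridge (hα : 0 < α) (h : IsAdmissible α p dp q) :
    IsConfDeriv α (fun x => bridge (confVar α Real.pi) (confPotential α p q) (confVar α x))
      (fun x => q x + p x ^ 2 - confMean α fun t => q t + p t ^ 2) := by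
  have cp := h.sobolev_p.continuousOn
  have cq := h.sobolev_q.continuousOn
  have cV : ContinuousOn (fun t => q t + p t ^ 2) (Icc 0 Real.pi) := cq.add (cp.pow 2)
  refine isConfDeriv_of_hasDerivAt hα
    (F := bridge (confVar α Real.pi) (confPotential α p q)) (fun x hx => ?_) (fun _ _ => rfl)
    (cV.sub continuousOn_const)
  have hd := (hasDerivAt_integral_of_continuous (continuous_comp_confInv hα cV) 0
    (confVar α x)).sub (((hasDerivAt_id (confVar α x)).div_const (confVar α Real.pi)).mul_const
      (∫ t in (0 : ℝ)..confVar α Real.pi, (q (confInv α t) + p (confInv α t) ^ 2)))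
  refine hd.congr_deriv ?_
  rw [confInv_confVar hα (Ioc_subset_Icc_self hx), confMean,
    confInt_eq hα cV ⟨Real.pi_pos.le, le_rfl⟩]
  unfold confVar
  field_simp

end reconstruction

end

theorem theorem3 (α : ℝ) (hα : 0 < α) (hα1 : α ≤ 1) (p dp q : ℝ → ℝ)
    (hpq : IsAdmissible α p dp q) (X₀ : Set (ℤ × ℤ × ℝ))
    (hX₀ : X₀ ⊆ nodalPoints α p q) (hdense : NodallyDense X₀) :
    -- uniqueness
    (∀ p₁ dp₁ q₁ : ℝ → ℝ, IsAdmissible α p₁ dp₁ q₁ → X₀ ⊆ nodalPoints α p₁ q₁ →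
      (∀ᵐ x ∂(volume.restrict (Icc 0 Real.pi)), p₁ x = p x) ∧
      (∀ᵐ x ∂(volume.restrict (Icc 0 Real.pi)), q₁ x = q x)) ∧
    -- reconstruction: the sequences exist
    (∀ x ∈ Icc 0 Real.pi, ∃ s, IsNodalSeq X₀ s x) ∧
    ∃ Q f df g r : ℝ → ℝ,
      -- `Q` from the nodes, and `p = D^α Q`
      (∀ x ∈ Icc 0 Real.pi, Q x = confInt α p x) ∧
      (∀ x ∈ Icc 0 Real.pi, ∀ s, IsNodalSeq X₀ s x →
        Tendsto (fun k => nodalShift α (s k)) atTop (𝓝 (Q x))) ∧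
      IsConfDeriv α Q p ∧
      -- `f` from the nodes, and `r`
      (∀ x ∈ Icc 0 Real.pi, ∀ s, IsNodalSeq X₀ s x →
        Tendsto (fun k => nodalShift₁ α Q (s k)) atTop (𝓝 (f x))) ∧
      IsConfDeriv α f df ∧
      (∀ x ∈ Icc 0 Real.pi, r x = df x - p x ^ 2 + confMean α (fun t => p t ^ 2)) ∧
      (∀ x ∈ Icc 0 Real.pi, q x - confMean α q = r x) ∧
      -- `g` from the nodes, and the mean of `q`
      (∀ x ∈ Icc 0 Real.pi, ∀ s, IsNodalSeq X₀ s x →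
        Tendsto (fun k => nodalShift₂ α p dp q Q f (s k)) atTop (𝓝 (g x))) ∧
      (∃ x ∈ Icc 0 Real.pi, Q x ≠ 0) ∧
      (∀ x ∈ Icc 0 Real.pi, Q x ≠ 0 →
        confMean α q = (1 / Q x) *
          (g x - confInt α (fun t => (r t + p t ^ 2) * p t) x +
            x ^ α / Real.pi ^ α * confInt α (fun t => (r t + p t ^ 2) * p t) Real.pi)) ∧
      -- `q`
      (∀ x ∈ Icc 0 Real.pi, q x = r x + confMean α q) := by
  have cp := hpq.sobolev_p.continuousOn
  have cq := hpq.sobolev_q.continuousOn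
  have hseq : ∀ x ∈ Icc 0 Real.pi, ∃ s, IsNodalSeq X₀ s x := fun x hx =>
    exists_isNodalSeq hα hpq hX₀ hdense hx
  refine ⟨fun p₁ dp₁ q₁ h₁ hX₁ => ?_, hseq, confInt α p,
    fun x => bridge (confVar α Real.pi) (confPotential α p q) (confVar α x),
    fun x => q x + p x ^ 2 - confMean α fun t => q t + p t ^ 2,
    fun x => bridge (confVar α Real.pi) (fun t => confPotential α p q t * p (confInv α t))
      (confVar α x),
    fun x => q x - confMean α q, fun _ _ => rfl,
    fun x hx s hs => tendsto_nodalShift hα hpq hX₀ hx hs, hpq.isConfDeriv_confInt hα,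
    fun x hx s hs => tendsto_nodalShift₁ hα hpq hX₀ hx hs, hpq.isConfDeriv_bridge hα,
    fun x _ => ?_, fun _ _ => rfl, fun x hx s hs => tendsto_nodalShift₂ hα hpq hX₀ hx hs,
    hpq.exists_confInt_ne_zero hα, fun x hx hQ => ?_, fun x _ => by ring⟩
  -- Each limit along a common sequence of nodes is computed from either pair: the first gives `p₁ =
  -- p`, the second that `q₁ - q` is constant, the third that this constant is `0`. The equalities
  -- hold everywhere on `[0, π]`.
  · have hQ : ∀ x ∈ Icc 0 Real.pi, confInt α p₁ x = confInt α p x := fun x hx => by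
      obtain ⟨s, hs⟩ := hseq x hx
      exact tendsto_nhds_unique (tendsto_nodalShift hα h₁ hX₁ hx hs)
        (tendsto_nodalShift hα hpq hX₀ hx hs)
    have hp := (hpq.isConfDeriv_confInt hα).eqOn (h₁.isConfDeriv_confInt hα) hQ
    have hf := (hpq.isConfDeriv_bridge hα).eqOn (h₁.isConfDeriv_bridge hα) fun x hx => by
      obtain ⟨s, hs⟩ := hseq x hx
      refine tendsto_nhds_unique (tendsto_nodalShift₁ hα h₁ hX₁ hx hs)
        ((tendsto_nodalShift₁ hα hpq hX₀ hx hs).congr fun k => ?_)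
      rw [nodalShift₁, nodalShift₁, hQ _ (Ioo_subset_Icc_self (hs.mem_Ioo hX₀ k))]
    have hq : ∀ x ∈ Icc 0 Real.pi, q₁ x = q x + ((confMean α fun t => q₁ t + p₁ t ^ 2) -
        confMean α fun t => q t + p t ^ 2) := fun x hx => by
      have := hf x hx
      rw [hp x hx] at this
      linarith
    have hdp := hpq.confDeriv_p.eqOn h₁.confDeriv_p hp
    obtain ⟨x₀, hx₀, hne⟩ := hpq.exists_confInt_ne_zero hα
    obtain ⟨s, hs⟩ := hseq x₀ hx₀
    have hc := (mul_eq_zero.1 (mul_confInt_eq_zero_of_add_const hα hpq hX₀ hx₀ hs h₁ hX₁ hp hdp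
      hq)).resolve_right hne
    refine ⟨(ae_restrict_iff' measurableSet_Icc).2 (Eventually.of_forall hp),
      (ae_restrict_iff' measurableSet_Icc).2 (Eventually.of_forall fun x hx => ?_)⟩
    rw [hq x hx, hc, add_zero]
  · simp only
    rw [confMean_add hα cq (g := fun t => p t ^ 2) (cp.pow 2)]
    ring
  · have hπ : Real.pi ∈ Icc 0 Real.pi := ⟨Real.pi_pos.le, le_rfl⟩
    rw [one_div, eq_inv_mul_iff_mul_eq₀ hQ]
    have hcont : ContinuousOn (fun t => (q t - confMean α q + p t ^ 2) * p t) (Icc 0 Real.pi) := by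
      fun_prop
    -- Splitting `q = r + ⟨q⟩` isolates the mean as the coefficient of `Q(x)`. At `x = π` this term
    -- vanishes because `Q(π) = 0`, so the linear correction contains only known terms.
    have key : ∀ x ∈ Icc 0 Real.pi, ∫ t in (0 : ℝ)..confVar α x,
        confPotential α p q t * p (confInv α t) =
        confInt α (fun t => (q t - confMean α q + p t ^ 2) * p t) x +
          confMean α q * confInt α p x := fun x hx => by
      rw [confInt_eq hα hcont hx, confInt_eq hα cp hx, ← intervalIntegral.integral_const_mul,
        ← intervalIntegral.integral_add
          ((continuous_comp_confInv hα hcont).intervalIntegrable _ _)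
          (((continuous_comp_confInv hα cp).const_mul _).intervalIntegrable _ _)]
      congr 1
      ext t
      simp only [confPotential]
      ring
    simp only [bridge]
    rw [key x hx, key Real.pi hπ, hpq.int_eq_zero, confVar_div hα]
    ring
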